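/- Let $d\ge 1$ and $m\ge 0$ be integers and let $t_0,\delta_0>0$. There is a constant $C>0$, depending only on $d,m,t_0,\delta_0$, such that the following holds. Let $T=\{t_{jk}\}$ be a real $2\times 2$ matrix with $\max_{j,k}|t_{jk}|\le t_0$, $|\det T|\ge\delta_0$ and $t_{11}+t_{12}=1$, and put $\tau=t_{21}+t_{22}$. Let $h_1,h_2:\mathbb R^d\to\mathbb C$ be measurable with $|||h_j|||_{2,\infty}<\infty$, where $$|||h|||_{2,\infty}=\sup_{u\in\mathbb R^d}\Bigl(\int_{\mathcal C_u}|h(x)|^2\,dx\Bigr)^{1/2}$$ and $\mathcal C_u$ is the cube centred at $u$ with edges of unit length. Let $p=p(w,z,\xi)$ be a smooth complex-valued function on $\mathbb R^d\times\mathbb R^d\times\mathbb R^d$ such that $$P_{d+1,m}(w,z,\xi)=\frac1{1+|z-\tau w|^m}\sum_{n_1,n_2=0}^{d+1}\sum_{l=0}^m|\nabla_w^{n_1}\nabla_z^{n_2}\nabla_\xi^l p(w,z,\xi)|$$ is integrable over $\mathbb R^{3d}$. Put $p_T(x,y,\xi)=p(t_{11}x+t_{12}y,\;t_{21}x+t_{22}y,\;\xi)$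 and, for $\alpha>0$, $$(\mathrm{Op}^a_\alpha(p_T)u)(x)=\Bigl(\frac{\alpha}{2\pi}\Bigr)^d\iint e^{i\alpha(x-y)\cdot\xi}\,p_T(x,y,\xi)\,u(y)\,dy\,d\xi .$$ Then for every $\alpha\ge1$ the operator $h_1\,\mathrm{Op}^a_\alpha(p_T)\,h_2$ is defined on Schwartz functions $u$ (the double integral for $h_2u$ converges absolutely at every $x$), it extends to a bounded operator on $L^2(\mathbb R^d)$, this operator belongs to the trace class $\mathfrak S_1$ (it is compact and its singular values, counted with multiplicity, have a finite sum $\|\cdot\|_{\mathfrak S_1}$), and $$\|h_1\,\mathrm{Op}^a_\alpha(p_T)\,h_2\|_{\mathfrak S_1}\le C\,\alpha^d\,|||h_1|||_{2,\infty}\,|||h_2|||_{2,\infty}\sum_{n_1,n_2=0}^{d+1}\sum_{l=0}^m\iiint\frac{|\nabla_w^{n_1}\nabla_z^{n_2}\nabla_\xi^l p(w,z,\xi)|}{1+|\tau w-z|^m}\,dw\,dz\,d\xi .$$ -/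

import Mathlib

open MeasureTheory
open scoped ENNReal InnerProductSpace SchwartzMap

noncomputable section

/-- The Euclidean space `ℝᵈ`. -/
abbrev Eu (d : ℕ) : Type := EuclideanSpace ℝ (Fin d)

/-- The complex Hilbert space `L²(ℝᵈ)`. -/
abbrev L2 (d : ℕ) : Type := Lp ℂ 2 (volume : Measure (Eu d))

/-! ### The trace class `S₁` -/

section TraceClass

variable {H : Type*} [NormedAddCommGroup H] [InnerProductSpace ℂ H] [CompleteSpace H]

/-- The multiplicity of `t > 0` as a singular value of `A`: the dimension of the
eigenspace of `A* A` for the eigenvalue `t²`. -/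
def singularMultiplicity (A : H →L[ℂ] H) (t : ℝ) : ℕ :=
  Module.finrank ℂ
    (Module.End.eigenspace ((ContinuousLinearMap.adjoint A ∘L A : H →L[ℂ] H) : H →ₗ[ℂ] H)
      ((t ^ 2 : ℝ) : ℂ))

/-- The `S₁`-norm `∑ₖ sₖ(A)` of a compact operator `A`. Each positive singular value `t`
(eigenvalue of `(A* A)^{1/2}`) is counted as often as its multiplicity says; all terms are
non-negative, so their order does not matter, and zero singular values contribute nothing. -/
def traceNorm (A : H →L[ℂ] H) : ℝ≥0∞ :=
  ∑' t : {t : ℝ // 0 < t}, (singularMultiplicity A t : ℝ≥0∞) * ENNReal.ofReal t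

/-- `A` belongs to `S₁`: it is compact and the sum of its singular values is finite. -/
def IsTraceClass (A : H →L[ℂ] H) : Prop :=
  IsCompactOperator A ∧ traceNorm A < ∞

end TraceClass

/-! ### Lattice norms -/

/-- The cube in `ℝᵈ` with centre `u` and edges of unit length. -/
def unitCube {d : ℕ} (u : Eu d) : Set (Eu d) := {x | ∀ i, |x i - u i| ≤ 1 / 2}

/-- The lattice norm `|||h|||_{2,∞} = sup_u (∫_{C_u} |h|²)^{1/2}`, as an extended number. -/
def latticeNorm {d : ℕ} (h : Eu d → ℂ) : ℝ≥0∞ :=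
  ⨆ u : Eu d, (∫⁻ x in unitCube u, ‖h x‖ₑ ^ 2) ^ (1 / 2 : ℝ)

/-- `h ∈ l^∞(L²)(ℝᵈ)`. -/
def MemLattice {d : ℕ} (h : Eu d → ℂ) : Prop :=
  AEStronglyMeasurable h volume ∧ latticeNorm h < ∞

/-! ### Amplitudes and operators -/

/-- An amplitude `p = p(x, y, ξ)` on `ℝᵈ × ℝᵈ × ℝᵈ`. -/
abbrev Amplitude (d : ℕ) : Type := Eu d → Eu d → Eu d → ℂ

/-- The amplitude is smooth jointly in its three variables. -/
def Amplitude.IsSmooth {d : ℕ} (p : Amplitude d) : Prop :=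
  ContDiff ℝ ((⊤ : ℕ∞) : WithTop ℕ∞) (fun v : Eu d × Eu d × Eu d => p v.1 v.2.1 v.2.2)

/-- `p_T(x, y, ξ) = p(t₁₁ x + t₁₂ y, t₂₁ x + t₂₂ y, ξ)`. -/
def Amplitude.transform {d : ℕ} (T : Matrix (Fin 2) (Fin 2) ℝ) (p : Amplitude d) :
    Amplitude d :=
  fun x y ξ => p (T 0 0 • x + T 0 1 • y) (T 1 0 • x + T 1 1 • y) ξ

/-- The number `|∇_w^{n₁} ∇_z^{n₂} ∇_ξ^l p(w, z, ξ)|`. -/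
def Amplitude.mixedDeriv {d : ℕ} (p : Amplitude d) (n₁ n₂ l : ℕ) (w z ξ : Eu d) : ℝ :=
  ‖iteratedFDeriv ℝ n₁
    (fun w' => iteratedFDeriv ℝ n₂
      (fun z' => iteratedFDeriv ℝ l (fun ξ' => p w' z' ξ') ξ) z) w‖

/-- `P_{n,m}(w, z, ξ; p)`, with the parameter `τ`. -/
def Amplitude.weightedDeriv {d : ℕ} (p : Amplitude d) (τ : ℝ) (n m : ℕ) (w z ξ : Eu d) : ℝ :=
  (1 / (1 + ‖z - τ • w‖ ^ m)) *
    ∑ n₁ ∈ Finset.range (n + 1), ∑ n₂ ∈ Finset.range (n + 1), ∑ l ∈ Finset.range (m + 1),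
      p.mixedDeriv n₁ n₂ l w z ξ

/-- The integrand `e^{iα(x-y)·ξ} p(x, y, ξ) u(y)`, as a function of `(y, ξ)`. -/
def opIntegrand {d : ℕ} (α : ℝ) (p : Amplitude d) (u : Eu d → ℂ) (x : Eu d)
    (v : Eu d × Eu d) : ℂ :=
  Complex.exp (Complex.I * ((α * ⟪x - v.1, v.2⟫_ℝ : ℝ) : ℂ)) * p x v.1 v.2 * u v.1

/-- `(Op^a_α(p) u)(x) = (α/2π)ᵈ ∬ e^{iα(x-y)·ξ} p(x, y, ξ) u(y) dy dξ`. -/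
def opAmp {d : ℕ} (α : ℝ) (p : Amplitude d) (u : Eu d → ℂ) (x : Eu d) : ℂ :=
  (((α / (2 * Real.pi)) ^ d : ℝ) : ℂ) * ∫ v : Eu d × Eu d, opIntegrand α p u x v

/-- The bounded operator `A` on `L²(ℝᵈ)` is `h₁ Op^a_α(p) h₂`: on every Schwartz function `u`
the defining integral of `Op^a_α(p)(h₂ u)` converges absolutely at each point and
`A u = h₁ Op^a_α(p)(h₂ u)`. Such an `A` is unique, as Schwartz functions are dense. -/
def IsWeightedOp {d : ℕ} (α : ℝ) (p : Amplitude d) (h₁ h₂ : Eu d → ℂ)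
    (A : L2 d →L[ℂ] L2 d) : Prop :=
  ∀ u : 𝓢(Eu d, ℂ),
    (∀ x, Integrable (opIntegrand α p (fun y => h₂ y * u y) x) (volume.prod volume)) ∧
    (A (u.toLp 2 volume) : Eu d → ℂ) =ᵐ[volume]
      fun x => h₁ x * opAmp α p (fun y => h₂ y * u y) x

end

/-!
The operator `h₁ Op^a_α(p_T) h₂` is written as an integral of rank one operators on `L²(ℝᵈ)`, with
coefficients whose `L¹`-norm is bounded by the right-hand side of the estimate.

*Trace norm of a superposition.* For a compact operator `A`, orthonormal eigenvectors `vₖ` of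
`A* A` for positive eigenvalues, together with `uₖ = sₖ⁻¹ A vₖ`, give `∑ sₖ = ∑ ⟨uₖ, A vₖ⟩`. For
`A = ∫ F(θ) ⟨g_θ, ·⟩ f_θ dθ` Bessel's inequality bounds this by `∫ |F(θ)| ‖f_θ‖ ‖g_θ‖ dθ`, and `A`
is compact because the compact operators form a closed subspace (`isTraceClass_integral_rankOne`).

*Decomposition of the kernel.* Up to the factors `(α/2π)ᵈ h₁(x) h₂(y)`, the kernel is
`∫ e^{iα(x-y)·ξ} p(w, z, ξ) dξ` with `w = t₁₁ x + t₁₂ y`, `z = t₂₁ x + t₂₂ y`. Since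
`t₁₁ + t₁₂ = 1`, `z - τ w = det T (y - x)`. A smooth cutoff of integral one localises `(w, z)` to
the unit ball around a point `c = (a, b)`. Let `e` be the unit vector in the direction of
`b - τ a`. Integrating by parts `m` times in `ξ` along `e` replaces `p` by `(1 - α⁻¹ ∂_e)^m p` and
gains the factor `(1 + i (x-y)·e)^{-m}`, a smooth function of `(w, z)`, which on that ball is
bounded by a multiple of `(1 + |z - τ w|)^{-m}`. As `α ≥ 1`, the coefficients of `(1 - α⁻¹ ∂_e)^m`
are bounded uniformly in `α`. This is `integral_phase_mul_xiOperator`, with the bounds on the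
`(w, z)`-derivatives of the localised amplitude in `exists_hasJetBound`.

*Separation of variables.* The localised amplitude is smooth with compact support in `(w, z)`, and
is expanded by Fourier inversion. With `d + 1` derivatives in each of `w` and `z` its Fourier
transform is bounded by the integrable function `freqWeight (d + 1)` times the integral over the
ball of the weighted derivatives (`norm_pairFourier_le`); the integral of the latter over `c` and
`ξ` is a multiple of the integral of the weighted derivatives over `ℝ³ᵈ`
(`integrable_kernelCoeff`). A plane wave in `(w, z)` is a plane wave in `x` times one in `y`
(`windowWave_mul_conj`). As `T` is invertible with bounds depending on `t₀` and `δ₀` only, a ball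
in `(w, z)` confines `x` and `y` to balls of fixed radius, so the waves may be cut off there
without changing the kernel (`integral_kernelCoeff`), and their products with `h₁` and `h₂` have
`L²`-norms controlled by the lattice norms (`enorm_windowVec_le`).
-/

noncomputable section

/-! ### Superpositions of rank one operators -/

section TraceClassCriterion

/-- Bessel's inequality and Cauchy–Schwarz. -/
theorem Orthonormal.sum_norm_inner_mul_norm_inner_le {H : Type*} [NormedAddCommGroup H]
    [InnerProductSpace ℂ H] {ι : Type*} [Fintype ι] {u v : ι → H}
    (hu : Orthonormal ℂ u) (hv : Orthonormal ℂ v) (f g : H) :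
    ∑ i, ‖⟪u i, f⟫_ℂ‖ * ‖⟪g, v i⟫_ℂ‖ ≤ ‖f‖ * ‖g‖ := by
  have h1 : ∑ i, ‖⟪u i, f⟫_ℂ‖ ^ 2 ≤ ‖f‖ ^ 2 := hu.sum_inner_products_le f (s := Finset.univ)
  have h2 : ∑ i, ‖⟪g, v i⟫_ℂ‖ ^ 2 ≤ ‖g‖ ^ 2 := by
    simp only [norm_inner_symm g]
    exact hv.sum_inner_products_le g (s := Finset.univ)
  refine (Real.sum_mul_le_sqrt_mul_sqrt _ _ _).trans ?_
  exact mul_le_mul ((Real.sqrt_le_sqrt h1).trans (by rw [Real.sqrt_sq (norm_nonneg _)]))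
    ((Real.sqrt_le_sqrt h2).trans (by rw [Real.sqrt_sq (norm_nonneg _)]))
    (Real.sqrt_nonneg _) (norm_nonneg _)

theorem isCompactOperator_rankOne {H : Type*} [NormedAddCommGroup H]
    [InnerProductSpace ℂ H] (f g : H) :
    IsCompactOperator (InnerProductSpace.rankOne ℂ f g) := by
  rw [InnerProductSpace.rankOne_def']
  exact (isCompactOperator_of_locallyCompactSpace_rng
    (ContinuousLinearMap.toSpanSingleton ℂ f)).comp_clm (innerSL ℂ g)

variable {H : Type*} [NormedAddCommGroup H] [InnerProductSpace ℂ H] [CompleteSpace H]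

theorem exists_orthonormal_fin_finrank {E : Type*} [NormedAddCommGroup E]
    [InnerProductSpace ℂ E] : ∃ b : Fin (Module.finrank ℂ E) → E, Orthonormal ℂ b := by
  by_cases h : FiniteDimensional ℂ E
  · exact ⟨_, (stdOrthonormalBasis ℂ E).orthonormal⟩
  -- In infinite dimension `finrank` is zero by convention, and the empty family serves.
  · have h0 : Module.finrank ℂ E = 0 := Module.finrank_of_not_finite h
    rw [h0]
    exact ⟨Fin.elim0, ⟨fun i => i.elim0, fun i => i.elim0⟩⟩

/-- The trace norm is at most the supremum of `∑ |⟨uᵢ, A vᵢ⟩|` over finite orthonormal systems: take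
orthonormal bases `v` of finitely many eigenspaces of `A* A`, and `uᵢ = sᵢ⁻¹ A vᵢ`. -/
theorem traceNorm_le_of_orthonormal (A : H →L[ℂ] H) (M : ℝ≥0∞)
    (hM : ∀ (ι : Type) [Fintype ι] (u v : ι → H), Orthonormal ℂ u → Orthonormal ℂ v →
      ∑ i, ‖⟪u i, A (v i)⟫_ℂ‖ₑ ≤ M) :
    traceNorm A ≤ M := by
  classical
  set B : H →L[ℂ] H := ContinuousLinearMap.adjoint A ∘L A with hB
  have hsym : ((B : H →L[ℂ] H) : H →ₗ[ℂ] H).IsSymmetric := by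
    intro x y
    simp [hB, ContinuousLinearMap.adjoint_inner_left, ContinuousLinearMap.adjoint_inner_right]
  rw [traceNorm, ENNReal.tsum_eq_iSup_sum]
  refine iSup_le fun s => ?_
  let V : s → Submodule ℂ H := fun t =>
    Module.End.eigenspace (B : H →ₗ[ℂ] H) (((t.1.1 : ℝ) ^ 2 : ℝ) : ℂ)
  have hinj : Function.Injective (fun t : s => ((((t.1.1 : ℝ) ^ 2 : ℝ)) : ℂ)) := by
    intro a b hab
    have h1 : (a.1.1 : ℝ) ^ 2 = b.1.1 ^ 2 := Complex.ofReal_injective hab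
    have h2 := (sq_eq_sq₀ a.1.2.le b.1.2.le).1 h1
    exact Subtype.ext (Subtype.ext h2)
  have hV : OrthogonalFamily ℂ (fun t => V t) fun t => (V t).subtypeₗᵢ :=
    hsym.orthogonalFamily_eigenspaces.comp hinj
  choose b hb using fun t : s => exists_orthonormal_fin_finrank (E := V t)
  have hv := hV.orthonormal_sigma_orthonormal hb
  set ι := Σ t : s, Fin (Module.finrank ℂ (V t))
  set v : ι → H := fun i => ((b i.1 i.2 : V i.1) : H) with hvdef
  have hv' : Orthonormal ℂ v := hv
  have hBv : ∀ i : ι, B (v i) = (((i.1.1.1 : ℝ) ^ 2 : ℝ) : ℂ) • v i := fun i =>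
    Module.End.mem_eigenspace_iff.1 (b i.1 i.2).2
  have hpos : ∀ i : ι, (0 : ℝ) < i.1.1.1 := fun i => i.1.1.2
  have hAA : ∀ i j : ι, ⟪A (v i), A (v j)⟫_ℂ = (((j.1.1.1 : ℝ) ^ 2 : ℝ) : ℂ) * ⟪v i, v j⟫_ℂ := by
    intro i j
    rw [← ContinuousLinearMap.adjoint_inner_right]
    have : ContinuousLinearMap.adjoint A (A (v j)) = B (v j) := rfl
    rw [this, hBv, inner_smul_right]
  set u : ι → H := fun i => (((i.1.1.1 : ℝ)⁻¹ : ℝ) : ℂ) • A (v i) with hu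
  have huo : Orthonormal ℂ u := by
    rw [orthonormal_iff_ite]
    intro i j
    simp only [hu, inner_smul_left, inner_smul_right, hAA, Complex.conj_ofReal]
    rw [orthonormal_iff_ite.1 hv' i j]
    split_ifs with hij
    · subst hij
      have : ((i.1.1.1 : ℝ) : ℂ) ≠ 0 := Complex.ofReal_ne_zero.2 (hpos i).ne'
      push_cast
      field_simp
    · simp
  have huA : ∀ i : ι, ‖⟪u i, A (v i)⟫_ℂ‖ₑ = ENNReal.ofReal i.1.1.1 := by
    intro i
    have h1 : ⟪u i, A (v i)⟫_ℂ = ((i.1.1.1 : ℝ) : ℂ) := by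
      simp only [hu, inner_smul_left, hAA, Complex.conj_ofReal]
      rw [orthonormal_iff_ite.1 hv' i i, if_pos rfl]
      have : ((i.1.1.1 : ℝ) : ℂ) ≠ 0 := Complex.ofReal_ne_zero.2 (hpos i).ne'
      push_cast
      field_simp
    rw [h1, ← ofReal_norm, Complex.norm_real, Real.norm_of_nonneg (hpos i).le]
  have key := hM ι u v huo hv'
  simp only [huA] at key
  rw [Fintype.sum_sigma] at key
  simp only [Finset.sum_const, Finset.card_univ, Fintype.card_fin, nsmul_eq_mul] at key
  refine le_trans (le_of_eq ?_) key
  rw [← Finset.sum_coe_sort s]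
  rfl

variable {Θ : Type*} [MeasurableSpace Θ] {μ : Measure Θ}

/-- The compact operators form a closed subspace, so an integral of compact operators is compact; a
functional that separated it from the subspace would vanish on the integrand. -/
theorem isCompactOperator_integral {k : Θ → H →L[ℂ] H} (hk : Integrable k μ)
    (hc : ∀ θ, IsCompactOperator (k θ)) :
    IsCompactOperator (∫ θ, k θ ∂μ : H →L[ℂ] H) := by
  let S : Submodule ℝ (H →L[ℂ] H) := (compactOperator (RingHom.id ℂ) H H).restrictScalars ℝ
  have hS : IsClosed (S : Set (H →L[ℂ] H)) := isClosed_setOfPred_isCompactOperator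
  by_contra hne
  have hmem : (∫ θ, k θ ∂μ) ∉ S := hne
  obtain ⟨φ, c, hφ1, hφ2⟩ := geometric_hahn_banach_closed_point S.convex hS hmem
  have hzero : ∀ x ∈ S, φ x = 0 := by
    intro x hx
    by_contra hx0
    -- A functional that is bounded above on a subspace vanishes there.
    have := hφ1 _ (S.smul_mem ((c + 1) / φ x) hx)
    rw [map_smul, smul_eq_mul, div_mul_cancel₀ _ hx0] at this
    linarith
  have h0 : φ (∫ θ, k θ ∂μ) = 0 := by
    rw [← φ.integral_comp_comm hk]
    simp [hzero _ (hc _)]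
  have := hφ1 0 S.zero_mem
  rw [map_zero] at this
  linarith

/-- A superposition of rank one operators `∫ F(θ) ⟨g_θ, ·⟩ f_θ dθ` is in the trace class. -/
theorem isTraceClass_integral_rankOne {F : Θ → ℂ} {f g : Θ → H}
    (hk : Integrable (fun θ => F θ • InnerProductSpace.rankOne ℂ (f θ) (g θ)) μ) :
    IsTraceClass (∫ θ, F θ • InnerProductSpace.rankOne ℂ (f θ) (g θ) ∂μ) ∧
    traceNorm (∫ θ, F θ • InnerProductSpace.rankOne ℂ (f θ) (g θ) ∂μ) ≤
      ∫⁻ θ, ‖F θ‖ₑ * (‖f θ‖ₑ * ‖g θ‖ₑ) ∂μ := by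
  have hle : traceNorm (∫ θ, F θ • InnerProductSpace.rankOne ℂ (f θ) (g θ) ∂μ) ≤
      ∫⁻ θ, ‖F θ‖ₑ * (‖f θ‖ₑ * ‖g θ‖ₑ) ∂μ := by
    refine traceNorm_le_of_orthonormal _ _ fun ι _ u v hu hv => ?_
    have hi : ∀ i, Integrable (fun θ => ⟪u i, (F θ • InnerProductSpace.rankOne ℂ (f θ) (g θ)) (v i)⟫_ℂ) μ :=
      fun i => (hk.apply_continuousLinearMap (v i)).const_inner (u i)
    have h1 : ∀ i, ⟪u i, (∫ θ, F θ • InnerProductSpace.rankOne ℂ (f θ) (g θ) ∂μ) (v i)⟫_ℂ =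
        ∫ θ, ⟪u i, (F θ • InnerProductSpace.rankOne ℂ (f θ) (g θ)) (v i)⟫_ℂ ∂μ := by
      intro i
      rw [ContinuousLinearMap.integral_apply hk,
        integral_inner (hk.apply_continuousLinearMap (v i))]
    calc ∑ i, ‖⟪u i, (∫ θ, F θ • InnerProductSpace.rankOne ℂ (f θ) (g θ) ∂μ) (v i)⟫_ℂ‖ₑ
        ≤ ∑ i, ∫⁻ θ, ‖⟪u i, (F θ • InnerProductSpace.rankOne ℂ (f θ) (g θ)) (v i)⟫_ℂ‖ₑ ∂μ := by
          refine Finset.sum_le_sum fun i _ => ?_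
          rw [h1]
          exact enorm_integral_le_lintegral_enorm _
      _ = ∫⁻ θ, ∑ i, ‖⟪u i, (F θ • InnerProductSpace.rankOne ℂ (f θ) (g θ)) (v i)⟫_ℂ‖ₑ ∂μ := by
          rw [lintegral_finsetSum' _ fun i _ => (hi i).aestronglyMeasurable.enorm]
      _ ≤ ∫⁻ θ, ‖F θ‖ₑ * (‖f θ‖ₑ * ‖g θ‖ₑ) ∂μ := by
          refine lintegral_mono fun θ => ?_
          have h2 : ∀ i, ‖⟪u i, (F θ • InnerProductSpace.rankOne ℂ (f θ) (g θ)) (v i)⟫_ℂ‖ₑ =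
              ‖F θ‖ₑ * ENNReal.ofReal (‖⟪u i, f θ⟫_ℂ‖ * ‖⟪g θ, v i⟫_ℂ‖) := by
            intro i
            rw [smul_apply, InnerProductSpace.rankOne_apply, inner_smul_right,
              inner_smul_right, enorm_mul, enorm_mul, ENNReal.ofReal_mul (norm_nonneg _),
              ofReal_norm, ofReal_norm, mul_comm ‖⟪g θ, v i⟫_ℂ‖ₑ]
          simp only [h2]
          rw [← Finset.mul_sum, ← ENNReal.ofReal_sum_of_nonneg (fun i _ => by positivity)]
          gcongr
          refine (ENNReal.ofReal_le_ofReal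
            (hu.sum_norm_inner_mul_norm_inner_le hv (f θ) (g θ))).trans (le_of_eq ?_)
          rw [ENNReal.ofReal_mul (norm_nonneg _), ofReal_norm, ofReal_norm]
  refine ⟨⟨isCompactOperator_integral hk fun θ => ?_, hle.trans_lt ?_⟩, hle⟩
  · exact (isCompactOperator_rankOne (f θ) (g θ)).smul (F θ)
  · have := hk.2
    simpa only [HasFiniteIntegral, enorm_smul, InnerProductSpace.enorm_rankOne] using this

end TraceClassCriterion

/-! ### Iterated directional derivatives -/

section DirectionalDerivatives

variable {W V F G : Type*} [NormedAddCommGroup W] [NormedSpace ℝ W]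
  [NormedAddCommGroup V] [NormedSpace ℝ V]
  [NormedAddCommGroup F] [NormedSpace ℝ F] [NormedAddCommGroup G] [NormedSpace ℝ G]

/-- Infinitely differentiable functions on a real normed space. -/
abbrev Smooth (f : W → F) : Prop := ContDiff ℝ ((⊤ : ℕ∞) : WithTop ℕ∞) f

/-- The derivative `∂_v f` in the direction `v`, as a function. -/
def dirDeriv (v : W) (f : W → F) : W → F := fun x => fderiv ℝ f x v

theorem Smooth.dirDeriv {f : W → F} (hf : Smooth f) (v : W) : Smooth (dirDeriv v f) :=
  (hf.fderiv_right (m := ((⊤ : ℕ∞) : WithTop ℕ∞)) (by norm_cast)).clm_apply contDiff_const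

theorem Smooth.dirDeriv_iterate {f : W → F} (hf : Smooth f) (v : W) (n : ℕ) :
    Smooth ((_root_.dirDeriv v)^[n] f) := by
  induction n with
  | zero => exact hf
  | succ n ih => rw [Function.iterate_succ_apply']; exact ih.dirDeriv v

theorem Smooth.differentiable {f : W → F} (hf : Smooth f) : Differentiable ℝ f :=
  ContDiff.differentiable hf (by simp)

theorem Smooth.iteratedFDeriv {f : W → F} (hf : Smooth f) (n : ℕ) :
    Smooth (iteratedFDeriv ℝ n f) :=
  hf.iteratedFDeriv_right (by norm_cast)

theorem Smooth.of_le {f : W → F} (hf : Smooth f) (n : ℕ) : ContDiff ℝ n f :=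
  ContDiff.of_le hf (by exact_mod_cast le_top)

theorem iteratedFDeriv_apply_const {f : W → F} (hf : Smooth f) (n : ℕ) (x v : W) :
    iteratedFDeriv ℝ n f x (fun _ => v) = (dirDeriv v)^[n] f x := by
  induction n generalizing x with
  | zero => simp
  | succ n ih =>
    rw [iteratedFDeriv_succ_apply_left, Function.iterate_succ_apply']
    have h : (dirDeriv v)^[n] f = fun x => iteratedFDeriv ℝ n f x (fun _ => v) :=
      funext fun x => (ih x).symm
    rw [h, dirDeriv, fderiv_continuousMultilinear_apply_const_apply
      ((hf.iteratedFDeriv n).differentiable x)]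
    rfl

theorem dirDeriv_iterate_clm_comp (L : F →L[ℝ] G) {f : W → F} (hf : Smooth f) (v : W) (n : ℕ) :
    (dirDeriv v)^[n] (fun x => L (f x)) = fun x => L ((dirDeriv v)^[n] f x) := by
  induction n with
  | zero => rfl
  | succ n ih =>
    rw [Function.iterate_succ_apply', ih, Function.iterate_succ_apply']
    funext x
    simp only [dirDeriv]
    have h : HasFDerivAt (fun x => L ((dirDeriv v)^[n] f x)) _ x :=
      L.hasFDerivAt.comp x ((hf.dirDeriv_iterate v n).differentiable x).hasFDerivAt
    rw [h.fderiv]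
    rfl

theorem dirDeriv_iterate_comp_affine {f : W → F} (hf : Smooth f) (j : V →L[ℝ] W) (x₀ : W)
    (v : V) (n : ℕ) :
    (dirDeriv v)^[n] (fun t => f (x₀ + j t)) = fun t => (dirDeriv (j v))^[n] f (x₀ + j t) := by
  induction n with
  | zero => rfl
  | succ n ih =>
    rw [Function.iterate_succ_apply', ih, Function.iterate_succ_apply']
    funext t
    simp only [dirDeriv]
    have h1 : HasFDerivAt (fun t : V => x₀ + j t) j t := j.hasFDerivAt.const_add x₀
    have h2 := ((hf.dirDeriv_iterate (j v) n).differentiable (x₀ + j t)).hasFDerivAt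
    have h3 : HasFDerivAt (fun t => (dirDeriv (j v))^[n] f (x₀ + j t)) _ t := h2.comp t h1
    rw [h3.fderiv]
    rfl

theorem iteratedFDeriv_comp_affine {f : W → F} (hf : Smooth f) (j : V →L[ℝ] W) (x₀ : W)
    (t : V) (n : ℕ) :
    iteratedFDeriv ℝ n (fun t => f (x₀ + j t)) t =
      (iteratedFDeriv ℝ n f (x₀ + j t)).compContinuousLinearMap fun _ => j := by
  have hf' : Smooth (fun y => f (x₀ + y)) := hf.comp (contDiff_const.add contDiff_id)
  have := j.iteratedFDeriv_comp_right hf' t (i := n) (by exact_mod_cast le_top)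
  rw [iteratedFDeriv_comp_add_left] at this
  exact this

/-- Directional derivatives are derivatives along a line, which reduces Leibniz' rule to functions
of one real variable. -/
theorem dirDeriv_iterate_eq_iteratedDeriv {f : W → F} (hf : Smooth f) (n : ℕ) (x v : W) :
    (dirDeriv v)^[n] f x = iteratedDeriv n (fun t : ℝ => f (x + t • v)) 0 := by
  have h := iteratedFDeriv_comp_affine hf (ContinuousLinearMap.toSpanSingleton ℝ v) x 0 n
  rw [iteratedDeriv_eq_iteratedFDeriv]
  simp only [ContinuousLinearMap.toSpanSingleton_apply] at h
  rw [h, ← iteratedFDeriv_apply_const hf]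
  simp

/-- Leibniz' rule for iterated directional derivatives. -/
theorem dirDeriv_iterate_mul {f g : W → ℂ} (hf : Smooth f) (hg : Smooth g) (n : ℕ) (v : W) :
    (dirDeriv v)^[n] (fun x => f x * g x) = fun x => ∑ k ∈ Finset.range (n + 1),
      (n.choose k : ℂ) * ((dirDeriv v)^[k] f x * (dirDeriv v)^[n - k] g x) := by
  funext x
  have hl : ContDiff ℝ ((⊤ : ℕ∞) : WithTop ℕ∞) (fun t : ℝ => x + t • v) :=
    contDiff_const.add (contDiff_id.smul contDiff_const)
  have hfl : Smooth (fun t : ℝ => f (x + t • v)) := hf.comp hl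
  have hgl : Smooth (fun t : ℝ => g (x + t • v)) := hg.comp hl
  rw [dirDeriv_iterate_eq_iteratedDeriv (hf.mul hg)]
  rw [iteratedDeriv_fun_mul (hfl.of_le n).contDiffAt (hgl.of_le n).contDiffAt]
  refine Finset.sum_congr rfl fun k _ => ?_
  rw [dirDeriv_iterate_eq_iteratedDeriv hf, dirDeriv_iterate_eq_iteratedDeriv hg, mul_assoc]

theorem dirDeriv_iterate_sum {ι : Type*} (s : Finset ι) {f : ι → W → ℂ} (c : ι → ℂ)
    (hf : ∀ i, Smooth (f i)) (n : ℕ) (v : W) :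
    (dirDeriv v)^[n] (fun x => ∑ i ∈ s, c i * f i x) =
      fun x => ∑ i ∈ s, c i * (dirDeriv v)^[n] (f i) x := by
  induction n with
  | zero => rfl
  | succ n ih =>
    rw [Function.iterate_succ_apply', ih]
    funext x
    simp only [Function.iterate_succ_apply']
    simp only [dirDeriv]
    rw [fderiv_fun_sum fun i _ => (((hf i).dirDeriv_iterate v n).differentiable x).const_mul (c i),
      sum_apply]
    refine Finset.sum_congr rfl fun i _ => ?_
    rw [fderiv_const_mul (((hf i).dirDeriv_iterate v n).differentiable x)]
    rfl

/-- The sum of `|∂_{v₁}^i ∂_{v₂}^j f|` over `i, j ≤ N`. -/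
def jetSum (N : ℕ) (v₁ v₂ : W) (f : W → ℂ) (x : W) : ℝ :=
  ∑ i ∈ Finset.range (N + 1), ∑ j ∈ Finset.range (N + 1),
    ‖(dirDeriv v₁)^[i] ((dirDeriv v₂)^[j] f) x‖

theorem jetSum_nonneg (N : ℕ) (v₁ v₂ : W) (f : W → ℂ) (x : W) : 0 ≤ jetSum N v₁ v₂ f x :=
  Finset.sum_nonneg fun _ _ => Finset.sum_nonneg fun _ _ => norm_nonneg _

theorem norm_le_jetSum {N i j : ℕ} (hi : i ≤ N) (hj : j ≤ N) (v₁ v₂ : W) (f : W → ℂ) (x : W) :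
    ‖(dirDeriv v₁)^[i] ((dirDeriv v₂)^[j] f) x‖ ≤ jetSum N v₁ v₂ f x := by
  refine le_trans ?_ (Finset.single_le_sum (f := fun i => ∑ j ∈ Finset.range (N + 1),
    ‖(dirDeriv v₁)^[i] ((dirDeriv v₂)^[j] f) x‖)
    (fun _ _ => Finset.sum_nonneg fun _ _ => norm_nonneg _)
    (Finset.mem_range.2 (Nat.lt_succ_of_le hi)))
  exact Finset.single_le_sum (f := fun j => ‖(dirDeriv v₁)^[i] ((dirDeriv v₂)^[j] f) x‖)
    (fun _ _ => norm_nonneg _) (Finset.mem_range.2 (Nat.lt_succ_of_le hj))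

theorem jetSum_le_of_forall {N : ℕ} {v₁ v₂ : W} {f : W → ℂ} {x : W} {B : ℝ}
    (h : ∀ i ≤ N, ∀ j ≤ N, ‖(dirDeriv v₁)^[i] ((dirDeriv v₂)^[j] f) x‖ ≤ B) :
    jetSum N v₁ v₂ f x ≤ ((N : ℝ) + 1) ^ 2 * B := by
  calc jetSum N v₁ v₂ f x ≤ ∑ i ∈ Finset.range (N + 1), ∑ j ∈ Finset.range (N + 1), B :=
        Finset.sum_le_sum fun i hi => Finset.sum_le_sum fun j hj =>
          h i (Nat.lt_succ_iff.1 (Finset.mem_range.1 hi)) j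
            (Nat.lt_succ_iff.1 (Finset.mem_range.1 hj))
    _ = ((N : ℝ) + 1) ^ 2 * B := by simp; ring

/-- The constant in `jetSum_mul_le`. -/
def jetConst (N : ℕ) : ℝ := ((N : ℝ) + 1) ^ 2 * (((N : ℝ) + 1) ^ 2 * (2 ^ N * 2 ^ N))

theorem jetConst_pos (N : ℕ) : 0 < jetConst N := by unfold jetConst; positivity

/-- Leibniz' rule for `jetSum`: up to a constant it is submultiplicative. -/
theorem jetSum_mul_le {f g : W → ℂ} (hf : Smooth f) (hg : Smooth g) (N : ℕ) (v₁ v₂ x : W) :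
    jetSum N v₁ v₂ (fun x => f x * g x) x ≤
      jetConst N * (jetSum N v₁ v₂ f x * jetSum N v₁ v₂ g x) := by
  rw [jetConst, mul_assoc]
  refine jetSum_le_of_forall fun i hi j hj => ?_
  rw [dirDeriv_iterate_mul hf hg,
    dirDeriv_iterate_sum _ _ fun k => (hf.dirDeriv_iterate v₂ k).mul (hg.dirDeriv_iterate v₂ (j - k))]
  have hterm : ∀ k ∈ Finset.range (j + 1), ‖(j.choose k : ℂ) * (dirDeriv v₁)^[i]
      (fun x => (dirDeriv v₂)^[k] f x * (dirDeriv v₂)^[j - k] g x) x‖ ≤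
      ((N : ℝ) + 1) * ((2 ^ N * 2 ^ N) * (jetSum N v₁ v₂ f x * jetSum N v₁ v₂ g x)) := by
    intro k hk
    have hk' : k ≤ j := Nat.lt_succ_iff.1 (Finset.mem_range.1 hk)
    have hc : ∀ {n : ℕ} (l : ℕ), n ≤ N → ((n.choose l : ℕ) : ℝ) ≤ 2 ^ N := fun {n} l hn => by
      exact_mod_cast (Nat.choose_le_two_pow n l).trans (Nat.pow_le_pow_right (by norm_num) hn)
    rw [dirDeriv_iterate_mul (hf.dirDeriv_iterate v₂ k) (hg.dirDeriv_iterate v₂ (j - k)), norm_mul,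
      Complex.norm_natCast]
    have hin : ‖∑ l ∈ Finset.range (i + 1), (i.choose l : ℂ) *
        ((dirDeriv v₁)^[l] ((dirDeriv v₂)^[k] f) x *
          (dirDeriv v₁)^[i - l] ((dirDeriv v₂)^[j - k] g) x)‖ ≤
        ((N : ℝ) + 1) * (2 ^ N * (jetSum N v₁ v₂ f x * jetSum N v₁ v₂ g x)) := by
      calc _ ≤ ∑ l ∈ Finset.range (i + 1),
            (2 ^ N * (jetSum N v₁ v₂ f x * jetSum N v₁ v₂ g x)) := by
            refine norm_sum_le_of_le _ fun l hl => ?_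
            have hl' : l ≤ i := Nat.lt_succ_iff.1 (Finset.mem_range.1 hl)
            rw [norm_mul, norm_mul, Complex.norm_natCast]
            have hf0 := jetSum_nonneg N v₁ v₂ f x
            gcongr
            · exact hc l hi
            · exact norm_le_jetSum (hl'.trans hi) (hk'.trans hj) _ _ _ _
            · exact norm_le_jetSum ((Nat.sub_le _ _).trans hi) ((Nat.sub_le _ _).trans hj) _ _ _ _
        _ = ((i : ℝ) + 1) * (2 ^ N * (jetSum N v₁ v₂ f x * jetSum N v₁ v₂ g x)) := by simp
        _ ≤ _ := by
            have := jetSum_nonneg N v₁ v₂ f x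
            have := jetSum_nonneg N v₁ v₂ g x
            gcongr
    calc _ ≤ 2 ^ N * (((N : ℝ) + 1) * (2 ^ N * (jetSum N v₁ v₂ f x * jetSum N v₁ v₂ g x))) := by
          gcongr
          exact hc k hj
      _ = _ := by ring
  refine (norm_sum_le_of_le _ hterm).trans ?_
  rw [Finset.sum_const, Finset.card_range, nsmul_eq_mul]
  have h1 := jetSum_nonneg N v₁ v₂ f x
  have h2 := jetSum_nonneg N v₁ v₂ g x
  calc ((j + 1 : ℕ) : ℝ) * (((N : ℝ) + 1) * ((2 ^ N * 2 ^ N) *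
        (jetSum N v₁ v₂ f x * jetSum N v₁ v₂ g x)))
      ≤ ((N : ℝ) + 1) * (((N : ℝ) + 1) * ((2 ^ N * 2 ^ N) *
        (jetSum N v₁ v₂ f x * jetSum N v₁ v₂ g x))) := by
        gcongr
        push_cast
        gcongr
    _ = _ := by ring

end DirectionalDerivatives

/-! ### Mixed derivatives of amplitudes -/

section PartialJets

variable {W V F : Type*} [NormedAddCommGroup W] [NormedSpace ℝ W]
  [NormedAddCommGroup V] [NormedSpace ℝ V] [NormedAddCommGroup F] [NormedSpace ℝ F]

/-- The `n`-th iterated derivative of `f` along the subspace embedded by `j`. -/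
def partialJet (n : ℕ) (j : V →L[ℝ] W) (f : W → F) :
    W → ContinuousMultilinearMap ℝ (fun _ : Fin n => V) F :=
  fun x => (iteratedFDeriv ℝ n f x).compContinuousLinearMap fun _ => j

theorem Smooth.partialJet {f : W → F} (hf : Smooth f) (n : ℕ) (j : V →L[ℝ] W) :
    Smooth (partialJet n j f) :=
  (hf.iteratedFDeriv n).continuousLinearMap_comp
    (ContinuousMultilinearMap.compContinuousLinearMapL (fun _ : Fin n => j))

theorem partialJet_apply_const {f : W → F} (hf : Smooth f) (n : ℕ) (j : V →L[ℝ] W) (v : V) :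
    (dirDeriv (j v))^[n] f = fun x => ContinuousMultilinearMap.apply ℝ (fun _ : Fin n => V) F
      (fun _ => v) (partialJet n j f x) := by
  funext x
  rw [← iteratedFDeriv_apply_const hf]
  rfl

theorem norm_partialJet_apply_const_le {n : ℕ} (T : ContinuousMultilinearMap ℝ (fun _ : Fin n => V) F)
    {v : V} (hv : ‖v‖ ≤ 1) : ‖T fun _ => v‖ ≤ ‖T‖ := by
  refine (T.le_opNorm _).trans ?_
  refine mul_le_of_le_one_right (norm_nonneg _) ?_
  exact Finset.prod_le_one (fun _ _ => norm_nonneg _) fun _ _ => hv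

end PartialJets

section AmplitudeDerivatives

variable {d : ℕ}

/-- An amplitude as a function on the product space. -/
def Amplitude.uncurry (p : Amplitude d) : Eu d × Eu d × Eu d → ℂ := fun v => p v.1 v.2.1 v.2.2

/-- The embedding of the `w`-directions. -/
def embW (d : ℕ) : Eu d →L[ℝ] Eu d × Eu d × Eu d := ContinuousLinearMap.inl ℝ _ _

/-- The embedding of the `z`-directions. -/
def embZ (d : ℕ) : Eu d →L[ℝ] Eu d × Eu d × Eu d :=
  (ContinuousLinearMap.inr ℝ _ _).comp (ContinuousLinearMap.inl ℝ _ _)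

/-- The embedding of the `ξ`-directions. -/
def embXi (d : ℕ) : Eu d →L[ℝ] Eu d × Eu d × Eu d :=
  (ContinuousLinearMap.inr ℝ _ _).comp (ContinuousLinearMap.inr ℝ _ _)

@[simp] theorem embW_apply (v : Eu d) : embW d v = (v, 0, 0) := rfl
@[simp] theorem embZ_apply (v : Eu d) : embZ d v = (0, v, 0) := rfl
@[simp] theorem embXi_apply (v : Eu d) : embXi d v = (0, 0, v) := rfl

/-- The nested partial derivatives in `mixedDeriv` are nested derivatives of one function on the
product space, restricted to the coordinate subspaces. -/
theorem Amplitude.mixedDeriv_eq {p : Amplitude d} (hp : Smooth p.uncurry) (n₁ n₂ l : ℕ)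
    (w z ξ : Eu d) :
    p.mixedDeriv n₁ n₂ l w z ξ =
      ‖partialJet n₁ (embW d) (partialJet n₂ (embZ d) (partialJet l (embXi d) p.uncurry))
        (w, z, ξ)‖ := by
  have h3 : ∀ w z ξ, iteratedFDeriv ℝ l (fun ξ' => p w z ξ') ξ =
      partialJet l (embXi d) p.uncurry (w, z, ξ) := by
    intro w z ξ
    have := iteratedFDeriv_comp_affine hp (embXi d) (w, z, 0) ξ l
    simpa [Amplitude.uncurry, partialJet] using! this
  have h2 : ∀ w z ξ, iteratedFDeriv ℝ n₂ (fun z' => partialJet l (embXi d) p.uncurry (w, z', ξ)) z =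
      partialJet n₂ (embZ d) (partialJet l (embXi d) p.uncurry) (w, z, ξ) := by
    intro w z ξ
    have := iteratedFDeriv_comp_affine (hp.partialJet l (embXi d)) (embZ d) (w, 0, ξ) z n₂
    simpa [partialJet] using! this
  have h1 : iteratedFDeriv ℝ n₁
      (fun w' => partialJet n₂ (embZ d) (partialJet l (embXi d) p.uncurry) (w', z, ξ)) w =
      partialJet n₁ (embW d) (partialJet n₂ (embZ d) (partialJet l (embXi d) p.uncurry))
        (w, z, ξ) := by
    have := iteratedFDeriv_comp_affine ((hp.partialJet l (embXi d)).partialJet n₂ (embZ d))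
      (embW d) (0, z, ξ) w n₁
    simpa [partialJet] using! this
  simp only [Amplitude.mixedDeriv, h3, h2, h1]

theorem Amplitude.continuous_mixedDeriv {p : Amplitude d} (hp : Smooth p.uncurry)
    (n₁ n₂ l : ℕ) :
    Continuous fun v : Eu d × Eu d × Eu d => p.mixedDeriv n₁ n₂ l v.1 v.2.1 v.2.2 := by
  simp only [Amplitude.mixedDeriv_eq hp]
  exact (((hp.partialJet l (embXi d)).partialJet n₂ (embZ d)).partialJet n₁ (embW d)).continuous.norm

theorem Amplitude.mixedDeriv_nonneg (p : Amplitude d) (n₁ n₂ l : ℕ) (w z ξ : Eu d) :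
    0 ≤ p.mixedDeriv n₁ n₂ l w z ξ := norm_nonneg _

theorem Amplitude.norm_dirDeriv_le_mixedDeriv {p : Amplitude d} (hp : Smooth p.uncurry)
    (n₁ n₂ l : ℕ) {e₁ e₂ e : Eu d} (h₁ : ‖e₁‖ ≤ 1) (h₂ : ‖e₂‖ ≤ 1) (h : ‖e‖ ≤ 1) (w z ξ : Eu d) :
    ‖(dirDeriv (embW d e₁))^[n₁] ((dirDeriv (embZ d e₂))^[n₂]
      ((dirDeriv (embXi d e))^[l] p.uncurry)) (w, z, ξ)‖ ≤ p.mixedDeriv n₁ n₂ l w z ξ := by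
  have s3 := hp.partialJet l (embXi d)
  have s2 := s3.partialJet n₂ (embZ d)
  rw [Amplitude.mixedDeriv_eq hp, partialJet_apply_const hp, dirDeriv_iterate_clm_comp _ s3,
    partialJet_apply_const s3]
  have s2' : Smooth fun x => ContinuousMultilinearMap.apply ℝ (fun _ : Fin n₂ => Eu d) _
      (fun _ => e₂) (partialJet n₂ (embZ d) (partialJet l (embXi d) p.uncurry) x) :=
    s2.continuousLinearMap_comp
      (ContinuousMultilinearMap.apply ℝ (fun _ : Fin n₂ => Eu d) _ fun _ => e₂)
  rw [dirDeriv_iterate_clm_comp _ s2', dirDeriv_iterate_clm_comp _ s2, partialJet_apply_const s2]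
  simp only [ContinuousMultilinearMap.apply_apply]
  exact (norm_partialJet_apply_const_le _ h).trans ((norm_partialJet_apply_const_le _ h₂).trans
    (norm_partialJet_apply_const_le _ h₁))

/-- `∑ |∇_w^{n₁} ∇_z^{n₂} ∇_ξ^l p|` over `n₁, n₂ ≤ n` and `l ≤ m`. -/
def Amplitude.totalDeriv (p : Amplitude d) (n m : ℕ) (w z ξ : Eu d) : ℝ :=
  ∑ n₁ ∈ Finset.range (n + 1), ∑ n₂ ∈ Finset.range (n + 1), ∑ l ∈ Finset.range (m + 1),
    p.mixedDeriv n₁ n₂ l w z ξ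

theorem Amplitude.totalDeriv_nonneg (p : Amplitude d) (n m : ℕ) (w z ξ : Eu d) :
    0 ≤ p.totalDeriv n m w z ξ :=
  Finset.sum_nonneg fun _ _ => Finset.sum_nonneg fun _ _ => Finset.sum_nonneg fun _ _ =>
    norm_nonneg _

theorem Amplitude.continuous_totalDeriv {p : Amplitude d} (hp : Smooth p.uncurry) (n m : ℕ) :
    Continuous fun v : Eu d × Eu d × Eu d => p.totalDeriv n m v.1 v.2.1 v.2.2 :=
  continuous_finsetSum _ fun _ _ => continuous_finsetSum _ fun _ _ => continuous_finsetSum _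
    fun _ _ => continuous_mixedDeriv hp _ _ _

/-- The operator `∑_l c_l ∂_{ξ,e}^l`, `l ≤ m`, applied to an amplitude. -/
def Amplitude.xiOperator (p : Amplitude d) (m : ℕ) (c : ℕ → ℂ) (e : Eu d) :
    Eu d × Eu d × Eu d → ℂ :=
  fun v => ∑ l ∈ Finset.range (m + 1), c l * (dirDeriv (embXi d e))^[l] p.uncurry v

theorem Amplitude.smooth_xiOperator {p : Amplitude d} (hp : Smooth p.uncurry) (m : ℕ) (c : ℕ → ℂ)
    (e : Eu d) : Smooth (p.xiOperator m c e) :=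
  ContDiff.sum fun l _ => contDiff_const.mul (hp.dirDeriv_iterate _ l)

theorem Smooth.slice {f : Eu d × Eu d × Eu d → ℂ} (hf : Smooth f) (ξ : Eu d) :
    Smooth fun v : Eu d × Eu d => f (v.1, v.2, ξ) :=
  hf.comp (contDiff_fst.prodMk (contDiff_snd.prodMk contDiff_const))

theorem dirDeriv_slice {f : Eu d × Eu d × Eu d → ℂ} (hf : Smooth f) (ξ : Eu d) (n : ℕ)
    (u : Eu d × Eu d) :
    (dirDeriv u)^[n] (fun v : Eu d × Eu d => f (v.1, v.2, ξ)) =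
      fun v => (dirDeriv ((u.1, u.2, 0) : Eu d × Eu d × Eu d))^[n] f (v.1, v.2, ξ) := by
  have := dirDeriv_iterate_comp_affine hf ((ContinuousLinearMap.fst ℝ (Eu d) (Eu d)).prod
    ((ContinuousLinearMap.snd ℝ (Eu d) (Eu d)).prod 0)) (0, 0, ξ) u n
  simpa using! this

theorem Amplitude.jetSum_xiOperator_le {p : Amplitude d} (hp : Smooth p.uncurry) (N m : ℕ)
    {c : ℕ → ℂ} {B : ℝ} (hc : ∀ l, ‖c l‖ ≤ B) {e₁ e₂ e : Eu d} (h₁ : ‖e₁‖ ≤ 1) (h₂ : ‖e₂‖ ≤ 1)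
    (h : ‖e‖ ≤ 1) (w z ξ : Eu d) :
    jetSum N ((e₁, 0) : Eu d × Eu d) (0, e₂) (fun v => p.xiOperator m c e (v.1, v.2, ξ)) (w, z) ≤
      B * p.totalDeriv N m w z ξ := by
  rw [jetSum, Amplitude.totalDeriv, Finset.mul_sum]
  refine Finset.sum_le_sum fun i _ => ?_
  rw [Finset.mul_sum]
  refine Finset.sum_le_sum fun j _ => ?_
  rw [Finset.mul_sum, dirDeriv_slice (smooth_xiOperator hp m c e),
    dirDeriv_slice ((smooth_xiOperator hp m c e).dirDeriv_iterate _ _)]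
  unfold Amplitude.xiOperator
  rw [dirDeriv_iterate_sum _ _ fun l => hp.dirDeriv_iterate _ l,
    dirDeriv_iterate_sum _ _ fun l => (hp.dirDeriv_iterate _ l).dirDeriv_iterate _ _]
  refine norm_sum_le_of_le _ fun l _ => ?_
  rw [norm_mul]
  exact mul_le_mul (hc l) (norm_dirDeriv_le_mixedDeriv hp i j l h₁ h₂ h w z ξ) (norm_nonneg _)
    ((norm_nonneg _).trans (hc l))

end AmplitudeDerivatives

/-! ### Integration by parts and Fourier decay -/

/-- The oscillating factor `e^{ir}`. -/
def phase (r : ℝ) : ℂ := Complex.exp (Complex.I * ((r : ℝ) : ℂ))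

@[simp] theorem norm_phase (r : ℝ) : ‖phase r‖ = 1 := by
  rw [phase, mul_comm, Complex.norm_exp_ofReal_mul_I]

theorem phase_add (r s : ℝ) : phase (r + s) = phase r * phase s := by
  rw [phase, phase, phase, ← Complex.exp_add]; push_cast; ring_nf

theorem continuous_phase : Continuous phase := by unfold phase; fun_prop

section IntegrationByParts

variable {W : Type*} [NormedAddCommGroup W] [NormedSpace ℝ W]

theorem hasFDerivAt_phase (L : W →L[ℝ] ℝ) (x : W) :
    HasFDerivAt (fun x => phase (L x))
      (phase (L x) • (Complex.I • (Complex.ofRealCLM.comp L))) x := by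
  have h : HasFDerivAt (fun x => Complex.I * ((L x : ℝ) : ℂ)) (Complex.I • (Complex.ofRealCLM.comp L)) x :=
    ((Complex.ofRealCLM.comp L).hasFDerivAt).const_mul Complex.I
  exact h.cexp

variable [FiniteDimensional ℝ W] [MeasurableSpace W] [BorelSpace W] {μ : Measure W}
  [μ.IsAddHaarMeasure]

theorem MeasureTheory.Integrable.phase_mul {α : Type*} [MeasurableSpace α] {ν : Measure α} {G : α → ℂ}
    (hG : Integrable G ν) {r : α → ℝ} (hr : AEMeasurable r ν) :
    Integrable (fun x => phase (r x) * G x) ν := by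
  refine hG.bdd_mul (c := 1) (continuous_phase.measurable.comp_aemeasurable hr).aestronglyMeasurable ?_
  exact Filter.Eventually.of_forall fun x => (norm_phase _).le

theorem integral_phase_mul_dirDeriv (L : W →L[ℝ] ℝ) (v : W) {G : W → ℂ} (hG : Smooth G)
    (hi : Integrable G μ) (hi' : Integrable (dirDeriv v G) μ) :
    ∫ x, phase (L x) * dirDeriv v G x ∂μ = -(Complex.I * (L v : ℝ)) * ∫ x, phase (L x) * G x ∂μ := by
  have hL : AEMeasurable (fun x => L x) μ := L.continuous.measurable.aemeasurable
  have hd : ∀ x, fderiv ℝ (fun x => phase (L x)) x v = Complex.I * (L v : ℝ) * phase (L x) := by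
    intro x
    rw [(hasFDerivAt_phase L x).fderiv]
    simp
    ring
  have h := integral_mul_fderiv_eq_neg_fderiv_mul_of_integrable (μ := μ) (𝕜 := ℂ)
    (f := fun x => phase (L x)) (g := G) (v := v) ?_ (hi'.phase_mul hL) (hi.phase_mul hL)
    (fun x _ => (hasFDerivAt_phase L x).differentiableAt) (fun x _ => hG.differentiable x)
  · refine h.trans ?_
    simp only [hd, mul_assoc]
    rw [← integral_const_mul, ← integral_neg]
    congr 1
    funext x
    ring
  · simp only [hd, mul_assoc]
    exact ((hi.phase_mul hL).const_mul _).const_mul _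

/-- Repeated integration by parts against the oscillating factor `e^{iL(x)}`. -/
theorem integral_phase_mul_dirDeriv_iterate (L : W →L[ℝ] ℝ) (v : W) {G : W → ℂ} (hG : Smooth G)
    (n : ℕ) (hi : ∀ k ≤ n, Integrable ((dirDeriv v)^[k] G) μ) :
    ∫ x, phase (L x) * (dirDeriv v)^[n] G x ∂μ =
      (-(Complex.I * (L v : ℝ))) ^ n * ∫ x, phase (L x) * G x ∂μ := by
  induction n with
  | zero => simp
  | succ n ih =>
    have h1 := hi (n + 1) le_rfl
    rw [Function.iterate_succ_apply'] at h1 ⊢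
    rw [integral_phase_mul_dirDeriv L v (hG.dirDeriv_iterate v n) (hi n (Nat.le_succ n)) h1,
      ih fun k hk => hi k (hk.trans (Nat.le_succ n))]
    ring

end IntegrationByParts

theorem HasCompactSupport.dirDeriv_iterate {W : Type*} [NormedAddCommGroup W] [NormedSpace ℝ W]
    {f : W → ℂ} (hf : HasCompactSupport f) (v : W) (n : ℕ) :
    HasCompactSupport ((dirDeriv v)^[n] f) := by
  induction n with
  | zero => exact hf
  | succ n ih => rw [Function.iterate_succ_apply']; exact ih.fderiv_apply (𝕜 := ℝ) v

section Fourier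

variable {d : ℕ}

instance : (volume : Measure (Eu d × Eu d)).IsAddHaarMeasure := by
  rw [Measure.volume_eq_prod]
  infer_instance

/-- The Fourier transform on `ℝᵈ × ℝᵈ`, in the pair of frequencies `k = (η, μ)`. -/
def pairFourier (G : Eu d × Eu d → ℂ) (k : Eu d × Eu d) : ℂ :=
  ∫ v : Eu d × Eu d, phase (-(2 * Real.pi * (⟪k.1, v.1⟫_ℝ + ⟪k.2, v.2⟫_ℝ))) * G v

/-- Fourier inversion on `ℝᵈ × ℝᵈ`. -/
theorem integral_phase_mul_pairFourier {G : Eu d × Eu d → ℂ} (hc : Continuous G)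
    (hi : Integrable G) (hF : Integrable (pairFourier G)) (v : Eu d × Eu d) :
    ∫ k : Eu d × Eu d, phase (2 * Real.pi * (⟪k.1, v.1⟫_ℝ + ⟪k.2, v.2⟫_ℝ)) * pairFourier G k =
      G v := by
  have hmp := WithLp.volume_preserving_ofLp (Eu d) (Eu d)
  have hme : MeasurableEmbedding (@WithLp.ofLp 2 (Eu d × Eu d)) :=
    (MeasurableEquiv.toLp 2 (Eu d × Eu d)).symm.measurableEmbedding
  set G' : WithLp 2 (Eu d × Eu d) → ℂ := fun x => G (WithLp.ofLp x)
  have hF' : FourierTransform.fourier G' = fun k => pairFourier G (WithLp.ofLp k) := by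
    funext k
    rw [Real.fourier_eq', pairFourier, ← hmp.integral_comp hme]
    refine integral_congr_ae (Filter.Eventually.of_forall fun x => ?_)
    simp only [smul_eq_mul, phase, WithLp.prod_inner_apply, G']
    congr 2
    rw [real_inner_comm k.ofLp.1, real_inner_comm k.ofLp.2]
    push_cast
    ring
  have hc' : Continuous G' := hc.comp (WithLp.prod_continuous_ofLp 2 _ _)
  have hi' : Integrable G' := (hmp.integrable_comp_emb hme).2 hi
  have hFi : Integrable (FourierTransform.fourier G') := by
    rw [hF']
    exact (hmp.integrable_comp_emb hme).2 hF
  have h := congrFun (hc'.fourierInv_fourier_eq hi' hFi) (WithLp.toLp 2 v)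
  rw [hF', Real.fourierInv_eq'] at h
  rw [← hmp.integral_comp hme]
  refine Eq.trans ?_ h
  refine integral_congr_ae (Filter.Eventually.of_forall fun x => ?_)
  simp only [smul_eq_mul, phase, WithLp.prod_inner_apply]
  congr 2
  push_cast
  ring

/-- The function `(1 + |η|^N)⁻¹ (1 + |μ|^N)⁻¹`. -/
def freqWeight (N : ℕ) (k : Eu d × Eu d) : ℝ := (1 + ‖k.1‖ ^ N)⁻¹ * (1 + ‖k.2‖ ^ N)⁻¹

theorem freqWeight_nonneg (N : ℕ) (k : Eu d × Eu d) : 0 ≤ freqWeight N k := by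
  unfold freqWeight; positivity

theorem integrable_freqWeight : Integrable (freqWeight (d + 1) : Eu d × Eu d → ℝ) := by
  have h1 : Integrable (fun x : Eu d => (1 + ‖x‖ ^ (d + 1))⁻¹) := by
    have h0 : Integrable (fun x : Eu d => (1 + ‖x‖) ^ (-((d + 1 : ℕ) : ℝ))) :=
      integrable_one_add_norm (by simp)
    refine (h0.const_mul (2 ^ d)).mono' ?_ (Filter.Eventually.of_forall fun x => ?_)
    · refine (Continuous.inv₀ (by fun_prop) fun x => ?_).aestronglyMeasurable
      positivity
    · have hx := norm_nonneg x
      rw [Real.norm_of_nonneg (by positivity), Real.rpow_neg (by positivity), Real.rpow_natCast,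
        ← div_eq_mul_inv, le_div_iff₀ (by positivity), ← div_eq_inv_mul,
        div_le_iff₀ (by positivity)]
      simpa using add_pow_le zero_le_one hx (d + 1)
  exact h1.mul_prod h1

/-- Decay of the Fourier transform. The derivatives are taken along `η / |η|` and `μ / |μ|`, where
they produce the factors `2π|η|` and `2π|μ|`; the four cases of no or `N` derivatives in each
variable add up to the factor `4`. -/
theorem norm_pairFourier_le {G : Eu d × Eu d → ℂ} (hG : Smooth G) (hs : HasCompactSupport G)
    (N : ℕ) {B : ℝ} (hB : ∀ e₁ e₂ : Eu d, ‖e₁‖ ≤ 1 → ‖e₂‖ ≤ 1 →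
      ∫ v, jetSum N ((e₁, 0) : Eu d × Eu d) (0, e₂) G v ≤ B) (k : Eu d × Eu d) :
    ‖pairFourier G k‖ ≤ 4 * B * freqWeight N k := by
  -- For a zero frequency these directions are zero, which is harmless below.
  set e₁ : Eu d := ‖k.1‖⁻¹ • k.1
  set e₂ : Eu d := ‖k.2‖⁻¹ • k.2
  have he : ∀ x : Eu d, ‖‖x‖⁻¹ • x‖ ≤ 1 := fun x => by
    rw [norm_smul, norm_inv, norm_norm]
    exact inv_mul_le_one
  have hin : ∀ x : Eu d, ⟪x, ‖x‖⁻¹ • x⟫_ℝ = ‖x‖ := fun x => by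
    rw [real_inner_smul_right, real_inner_self_eq_norm_sq]
    rcases eq_or_ne ‖x‖ 0 with h | h
    · simp [h]
    · field_simp
  set L : Eu d × Eu d →L[ℝ] ℝ := -((2 * Real.pi) • ((innerSL ℝ k.1).comp
    (ContinuousLinearMap.fst ℝ _ _) + (innerSL ℝ k.2).comp (ContinuousLinearMap.snd ℝ _ _)))
    with hLdef
  have hL : ∀ v, L v = -(2 * Real.pi * (⟪k.1, v.1⟫_ℝ + ⟪k.2, v.2⟫_ℝ)) := fun v => by
    simp [hLdef]
    ring
  have hint : ∀ i j, Integrable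
      ((dirDeriv ((e₁, 0) : Eu d × Eu d))^[i] ((dirDeriv ((0, e₂) : Eu d × Eu d))^[j] G)) :=
    fun i j => ((hG.dirDeriv_iterate _ j).dirDeriv_iterate _ i).continuous.integrable_of_hasCompactSupport
      ((hs.dirDeriv_iterate _ j).dirDeriv_iterate _ i)
  have hpF : pairFourier G k = ∫ v, phase (L v) * G v := by
    simp only [pairFourier, hL]
  have hterm : ∀ i ≤ N, ∀ j ≤ N, ‖k.1‖ ^ i * ‖k.2‖ ^ j * ‖pairFourier G k‖ ≤ B := by
    intro i hi j hj
    have h1 := integral_phase_mul_dirDeriv_iterate (μ := volume) L ((e₁, 0) : Eu d × Eu d)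
      (hG.dirDeriv_iterate (0, e₂) j) i fun m _ => hint m j
    rw [integral_phase_mul_dirDeriv_iterate (μ := volume) L ((0, e₂) : Eu d × Eu d) hG j
      fun m _ => hint 0 m, ← hpF, hL, hL] at h1
    simp only [inner_zero_right, add_zero, zero_add, e₁, e₂, hin] at h1
    have h2 := congrArg norm h1
    rw [norm_mul, norm_mul, norm_pow, norm_pow] at h2
    simp only [norm_neg, norm_mul, Complex.norm_I, one_mul, Complex.norm_real, Real.norm_eq_abs,
      abs_norm] at h2
    have hpi : (1 : ℝ) ≤ |2| * |Real.pi| := by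
      rw [abs_of_pos Real.pi_pos, abs_two]
      linarith [Real.pi_gt_three]
    have h3 : ∀ x : ℝ, 0 ≤ x → x ≤ |2| * |Real.pi| * x := fun x hx => le_mul_of_one_le_left hx hpi
    calc ‖k.1‖ ^ i * ‖k.2‖ ^ j * ‖pairFourier G k‖
        = ‖k.1‖ ^ i * (‖k.2‖ ^ j * ‖pairFourier G k‖) := by ring
      _ ≤ (|2| * |Real.pi| * ‖k.1‖) ^ i * ((|2| * |Real.pi| * ‖k.2‖) ^ j * ‖pairFourier G k‖) := by
          gcongr
          · exact h3 _ (norm_nonneg _)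
          · exact h3 _ (norm_nonneg _)
      _ = ‖∫ v, phase (L v) * (dirDeriv ((e₁, 0) : Eu d × Eu d))^[i]
            ((dirDeriv ((0, e₂) : Eu d × Eu d))^[j] G) v‖ := h2.symm
      _ ≤ ∫ v, ‖(dirDeriv ((e₁, 0) : Eu d × Eu d))^[i]
            ((dirDeriv ((0, e₂) : Eu d × Eu d))^[j] G) v‖ := by
          refine (norm_integral_le_integral_norm _).trans (le_of_eq ?_)
          simp only [norm_mul, norm_phase, one_mul]
      _ ≤ ∫ v, jetSum N ((e₁, 0) : Eu d × Eu d) (0, e₂) G v := by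
          refine integral_mono (hint i j).norm ?_ fun v => norm_le_jetSum hi hj _ _ _ _
          exact integrable_finsetSum _ fun a _ => integrable_finsetSum _ fun b _ => (hint a b).norm
      _ ≤ B := hB _ _ (he _) (he _)
  have h00 := hterm 0 (Nat.zero_le _) 0 (Nat.zero_le _)
  have h0N := hterm 0 (Nat.zero_le _) N le_rfl
  have hN0 := hterm N le_rfl 0 (Nat.zero_le _)
  have hNN := hterm N le_rfl N le_rfl
  rw [freqWeight, ← mul_inv, ← div_eq_mul_inv, le_div_iff₀ (by positivity)]
  simp only [pow_zero, one_mul, mul_one] at h00 h0N hN0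
  linarith

end Fourier

/-! ### Localised amplitudes -/

section Cutoff

variable {W : Type*} [NormedAddCommGroup W] [NormedSpace ℝ W]

theorem jetSum_comp_sub {f : W → ℂ} (hf : Smooth f) (N : ℕ) (v₁ v₂ c x : W) :
    jetSum N v₁ v₂ (fun v => f (v - c)) x = jetSum N v₁ v₂ f (x - c) := by
  have h : ∀ {g : W → ℂ}, Smooth g → ∀ (u : W) (n : ℕ),
      (dirDeriv u)^[n] (fun v => g (v - c)) = fun v => (dirDeriv u)^[n] g (v - c) := by
    intro g hg u n
    have := dirDeriv_iterate_comp_affine hg (ContinuousLinearMap.id ℝ W) (-c) u n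
    simpa [neg_add_eq_sub] using this
  unfold jetSum
  refine Finset.sum_congr rfl fun i _ => Finset.sum_congr rfl fun j _ => ?_
  rw [h hf, h (hf.dirDeriv_iterate v₂ j)]

/-- All mixed directional derivatives of a compactly supported smooth function are bounded,
uniformly in the directions. -/
theorem exists_jetSum_le_indicator {f : W → ℂ} (hf : Smooth f) (hs : HasCompactSupport f)
    (N : ℕ) : ∃ M : ℝ, 0 ≤ M ∧ ∀ v₁ v₂ : W, ‖v₁‖ ≤ 1 → ‖v₂‖ ≤ 1 → ∀ x,
      jetSum N v₁ v₂ f x ≤ (tsupport f).indicator (fun _ => M) x := by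
  have hb : ∀ i j : ℕ, ∃ C, ∀ x, ‖iteratedFDeriv ℝ i (iteratedFDeriv ℝ j f) x‖ ≤ C := fun i j =>
    ((hs.iteratedFDeriv (𝕜 := ℝ) j).iteratedFDeriv (𝕜 := ℝ) i).exists_bound_of_continuous
      ((hf.iteratedFDeriv j).iteratedFDeriv i).continuous
  choose C hC using hb
  have hle : ∀ v₁ v₂ : W, ‖v₁‖ ≤ 1 → ‖v₂‖ ≤ 1 → ∀ i j x,
      ‖(dirDeriv v₁)^[i] ((dirDeriv v₂)^[j] f) x‖ ≤
        ‖iteratedFDeriv ℝ i (iteratedFDeriv ℝ j f) x‖ := by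
    intro v₁ v₂ h₁ h₂ i j x
    have h : (dirDeriv v₂)^[j] f = fun x => ContinuousMultilinearMap.apply ℝ (fun _ : Fin j => W) ℂ
        (fun _ => v₂) (iteratedFDeriv ℝ j f x) :=
      funext fun y => (iteratedFDeriv_apply_const hf j y v₂).symm
    rw [h, dirDeriv_iterate_clm_comp _ (hf.iteratedFDeriv j)]
    beta_reduce
    rw [← iteratedFDeriv_apply_const (hf.iteratedFDeriv j)]
    exact (norm_partialJet_apply_const_le _ h₂).trans (norm_partialJet_apply_const_le _ h₁)
  refine ⟨∑ i ∈ Finset.range (N + 1), ∑ j ∈ Finset.range (N + 1), C i j,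
    Finset.sum_nonneg fun i _ => Finset.sum_nonneg fun j _ => (norm_nonneg _).trans (hC i j 0),
    fun v₁ v₂ h₁ h₂ x => ?_⟩
  by_cases hx : x ∈ tsupport f
  · rw [Set.indicator_of_mem hx]
    exact Finset.sum_le_sum fun i _ => Finset.sum_le_sum fun j _ =>
      (hle v₁ v₂ h₁ h₂ i j x).trans (hC i j x)
  · rw [Set.indicator_of_notMem hx]
    refine (Finset.sum_eq_zero fun i _ => Finset.sum_eq_zero fun j _ => ?_).le
    refine le_antisymm ((hle v₁ v₂ h₁ h₂ i j x).trans (le_of_eq ?_)) (norm_nonneg _)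
    rw [norm_eq_zero]
    by_contra hne
    exact hx (tsupport_iteratedFDeriv_subset (𝕜 := ℝ) j
      (tsupport_iteratedFDeriv_subset (𝕜 := ℝ) i (subset_tsupport _ hne)))

/-- The function `(1 + i L(v))⁻¹`. -/
def resolventFactor (L : W →L[ℝ] ℝ) (v : W) : ℂ := (1 + Complex.I * (L v : ℝ))⁻¹

theorem one_add_I_mul_ne_zero (x : ℝ) : (1 + Complex.I * (x : ℂ)) ≠ 0 := by
  intro h
  have := congrArg Complex.re h
  simp at this

theorem one_le_norm_one_add_I_mul (x : ℝ) : 1 ≤ ‖1 + Complex.I * (x : ℂ)‖ := by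
  have := Complex.abs_re_le_norm (1 + Complex.I * (x : ℂ))
  simpa using this

theorem abs_le_norm_one_add_I_mul (x : ℝ) : |x| ≤ ‖1 + Complex.I * (x : ℂ)‖ := by
  have := Complex.abs_im_le_norm (1 + Complex.I * (x : ℂ))
  simpa using this

theorem norm_resolventFactor_le_one (L : W →L[ℝ] ℝ) (v : W) : ‖resolventFactor L v‖ ≤ 1 := by
  rw [resolventFactor, norm_inv]
  exact inv_le_one_of_one_le₀ (one_le_norm_one_add_I_mul _)

theorem hasFDerivAt_one_add_I_mul (L : W →L[ℝ] ℝ) (v : W) :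
    HasFDerivAt (fun v => 1 + Complex.I * ((L v : ℝ) : ℂ))
      (Complex.I • (Complex.ofRealCLM.comp L)) v :=
  (((Complex.ofRealCLM.comp L).hasFDerivAt).const_mul Complex.I).const_add 1

theorem smooth_resolventFactor (L : W →L[ℝ] ℝ) : Smooth (resolventFactor L) := by
  refine ContDiff.inv ?_ fun v => one_add_I_mul_ne_zero _
  exact contDiff_const.add (contDiff_const.mul (Complex.ofRealCLM.comp L).contDiff)

theorem dirDeriv_resolventFactor_pow (L : W →L[ℝ] ℝ) (u : W) (n : ℕ) :
    dirDeriv u (fun v => resolventFactor L v ^ n) =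
      fun v => (-(n * (Complex.I * (L u : ℝ)))) * resolventFactor L v ^ (n + 1) := by
  funext v
  have h := ((hasDerivAt_inv (one_add_I_mul_ne_zero (L v))).pow n).hasFDerivAt.restrictScalars ℝ
  have h₁ := HasFDerivAt.comp v h (hasFDerivAt_one_add_I_mul L v)
  have h' : HasFDerivAt (fun v => resolventFactor L v ^ n) _ v := h₁
  rw [dirDeriv, h'.fderiv]
  rcases n with _ | n
  · simp
  · simp [resolventFactor]
    field_simp
    rw [← pow_add, show 2 + n = n + 1 + 1 by ring]

/-- Derivatives of `(1 + iL)^{-n}` are multiples of higher powers of `(1 + iL)⁻¹`, hence at most a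
constant times `|1 + iL|^{-n}`. -/
theorem dirDeriv_iterate_resolventFactor_pow (L : W →L[ℝ] ℝ) (u : W) (n k : ℕ) :
    (dirDeriv u)^[k] (fun v => resolventFactor L v ^ n) =
      fun v => ((n.ascFactorial k : ℂ) * (-(Complex.I * (L u : ℝ))) ^ k) *
        resolventFactor L v ^ (n + k) := by
  induction k with
  | zero => simp
  | succ k ih =>
    rw [Function.iterate_succ_apply', ih]
    funext v
    have h1 := congrFun (dirDeriv_resolventFactor_pow L u (n + k)) v
    rw [dirDeriv] at h1 ⊢
    rw [fderiv_const_mul (((smooth_resolventFactor L).pow (n + k)).differentiable (by simp) v),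
      smul_apply, h1, Nat.ascFactorial_succ]
    push_cast
    simp only [smul_eq_mul]
    ring

/-- The constant in `jetSum_resolventFactor_pow_le`. -/
def resolventConst (N m : ℕ) (Λ : ℝ) : ℝ :=
  ∑ i ∈ Finset.range (N + 1), ∑ j ∈ Finset.range (N + 1),
    ((m.ascFactorial j : ℝ) * Λ ^ j) * (((m + j).ascFactorial i : ℝ) * Λ ^ i)

theorem resolventConst_nonneg (N m : ℕ) {Λ : ℝ} (hΛ : 0 ≤ Λ) : 0 ≤ resolventConst N m Λ :=
  Finset.sum_nonneg fun _ _ => Finset.sum_nonneg fun _ _ => by positivity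

theorem jetSum_resolventFactor_pow_le (L : W →L[ℝ] ℝ) (N m : ℕ) {Λ : ℝ} {v₁ v₂ : W}
    (h₁ : |L v₁| ≤ Λ) (h₂ : |L v₂| ≤ Λ) (v : W) :
    jetSum N v₁ v₂ (fun v => resolventFactor L v ^ m) v ≤
      resolventConst N m Λ * ‖resolventFactor L v‖ ^ m := by
  have hΛ : 0 ≤ Λ := (abs_nonneg _).trans h₁
  rw [jetSum, resolventConst, Finset.sum_mul]
  refine Finset.sum_le_sum fun i _ => ?_
  rw [Finset.sum_mul]
  refine Finset.sum_le_sum fun j _ => ?_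
  rw [dirDeriv_iterate_resolventFactor_pow]
  have h := dirDeriv_iterate_sum (W := W) {()}
    (f := fun _ v => resolventFactor L v ^ (m + j))
    (fun _ => ((m.ascFactorial j : ℂ) * (-(Complex.I * (L v₂ : ℝ))) ^ j))
    (fun _ => (smooth_resolventFactor L).pow (m + j)) i v₁
  simp only [Finset.sum_singleton] at h
  rw [h, dirDeriv_iterate_resolventFactor_pow]
  simp only [norm_mul, norm_pow, norm_neg, Complex.norm_I, Complex.norm_real, Real.norm_eq_abs,
    Complex.norm_natCast, one_mul]
  have hr : ‖resolventFactor L v‖ ^ (m + j + i) ≤ ‖resolventFactor L v‖ ^ m :=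
    pow_le_pow_of_le_one (norm_nonneg _) (norm_resolventFactor_le_one L v) (by omega)
  calc _ ≤ ((m.ascFactorial j : ℝ) * Λ ^ j) * ((((m + j).ascFactorial i : ℝ) * Λ ^ i) *
        ‖resolventFactor L v‖ ^ m) := by gcongr
    _ = _ := by ring

end Cutoff

section Localisation

variable {d : ℕ}

/-- A smooth cutoff on `ℝᵈ × ℝᵈ` with integral one, supported in the unit ball. -/
def pairCutoff (d : ℕ) : Eu d × Eu d → ℂ := fun v =>
  (((⟨1 / 2, 1, by norm_num, by norm_num⟩ : ContDiffBump (0 : Eu d × Eu d)).normed volume v : ℝ) : ℂ)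

theorem smooth_pairCutoff : Smooth (pairCutoff d) :=
  Complex.ofRealCLM.contDiff.comp (ContDiffBump.contDiff_normed _)

theorem integral_pairCutoff : ∫ v, pairCutoff d v = 1 := by
  unfold pairCutoff
  rw [integral_complex_ofReal, ContDiffBump.integral_normed, Complex.ofReal_one]

theorem tsupport_pairCutoff_subset :
    tsupport (pairCutoff d) ⊆ Metric.closedBall 0 1 := by
  refine closure_minimal (fun v hv => ?_) Metric.isClosed_closedBall
  have h : v ∈ Function.support ((⟨1 / 2, 1, by norm_num, by norm_num⟩ :
      ContDiffBump (0 : Eu d × Eu d)).normed volume) := by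
    intro h0
    exact hv (Complex.ofReal_eq_zero.2 h0)
  rw [ContDiffBump.support_normed_eq] at h
  exact Metric.ball_subset_closedBall h

theorem hasCompactSupport_pairCutoff : HasCompactSupport (pairCutoff d) :=
  HasCompactSupport.of_support_subset_isCompact (isCompact_closedBall 0 1)
    ((subset_tsupport _).trans tsupport_pairCutoff_subset)

theorem pairCutoff_zero_ne : pairCutoff d 0 ≠ 0 := by
  have h : (0 : Eu d × Eu d) ∈ Function.support ((⟨1 / 2, 1, by norm_num, by norm_num⟩ :
      ContDiffBump (0 : Eu d × Eu d)).normed volume) := by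
    rw [ContDiffBump.support_normed_eq]
    exact Metric.mem_ball_self (by norm_num)
  exact Complex.ofReal_ne_zero.2 h

/-- The unit vector in the direction of `b - τ a`, where `c = (a, b)`. It is zero if `b = τ a`, so
that no integration by parts takes place there. -/
def unitDir (τ : ℝ) (c : Eu d × Eu d) : Eu d := ‖c.2 - τ • c.1‖⁻¹ • (c.2 - τ • c.1)

theorem norm_unitDir_le (τ : ℝ) (c : Eu d × Eu d) : ‖unitDir τ c‖ ≤ 1 := by
  rw [unitDir, norm_smul, norm_inv, norm_norm]
  exact inv_mul_le_one

theorem inner_unitDir (τ : ℝ) (c : Eu d × Eu d) :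
    ⟪c.2 - τ • c.1, unitDir τ c⟫_ℝ = ‖c.2 - τ • c.1‖ := by
  rw [unitDir, real_inner_smul_right, real_inner_self_eq_norm_sq]
  rcases eq_or_ne ‖c.2 - τ • c.1‖ 0 with h | h
  · simp [h]
  · field_simp

/-- The linear form `(w, z) ↦ -⟨z - τ w, e⟩ / δ`. For `δ = det T` it equals `(x - y) · e`. -/
def offDiagForm (τ δ : ℝ) (e : Eu d) : Eu d × Eu d →L[ℝ] ℝ :=
  (-δ⁻¹) • (innerSL ℝ e).comp
    (ContinuousLinearMap.snd ℝ (Eu d) (Eu d) - τ • ContinuousLinearMap.fst ℝ (Eu d) (Eu d))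

theorem offDiagForm_apply (τ δ : ℝ) (e : Eu d) (v : Eu d × Eu d) :
    offDiagForm τ δ e v = -δ⁻¹ * ⟪v.2 - τ • v.1, e⟫_ℝ := by
  simp only [offDiagForm, smul_apply, ContinuousLinearMap.comp_apply,
    sub_apply, ContinuousLinearMap.coe_snd', ContinuousLinearMap.coe_fst',
    innerSL_apply_apply, smul_eq_mul]
  rw [real_inner_comm]

/-- On the unit ball around `c`, the factor `1 + iL` controls the distance to the diagonal: there
`z - τ w` is within `1 + 2 t₀` of `b - τ a`, to which the direction `e` of `L` is parallel. -/
theorem norm_sub_le_mul_norm_one_add {t₀ τ δ : ℝ} (hδ : δ ≠ 0) (hδ' : |δ| ≤ 2 * t₀ ^ 2)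
    (hτ : |τ| ≤ 2 * t₀) {c v : Eu d × Eu d} (hv : v ∈ Metric.closedBall c 1) :
    ‖v.2 - τ • v.1‖ ≤ (2 * t₀ ^ 2 + 2 * (1 + 2 * t₀)) *
      ‖1 + Complex.I * ((offDiagForm τ δ (unitDir τ c) v : ℝ) : ℂ)‖ := by
  set X := ‖1 + Complex.I * ((offDiagForm τ δ (unitDir τ c) v : ℝ) : ℂ)‖
  have hX1 : 1 ≤ X := one_le_norm_one_add_I_mul _
  have hXL : |offDiagForm τ δ (unitDir τ c) v| ≤ X := abs_le_norm_one_add_I_mul _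
  have ht : 0 ≤ t₀ := by linarith [abs_nonneg τ]
  have hd : ‖(c.2 - τ • c.1) - (v.2 - τ • v.1)‖ ≤ 1 + 2 * t₀ := by
    have h1 : ‖c.1 - v.1‖ ≤ 1 := by
      have := (norm_fst_le (v - c)).trans (mem_closedBall_iff_norm.1 hv)
      rwa [Prod.fst_sub, norm_sub_rev] at this
    have h2 : ‖c.2 - v.2‖ ≤ 1 := by
      have := (norm_snd_le (v - c)).trans (mem_closedBall_iff_norm.1 hv)
      rwa [Prod.snd_sub, norm_sub_rev] at this
    calc ‖(c.2 - τ • c.1) - (v.2 - τ • v.1)‖ = ‖(c.2 - v.2) - τ • (c.1 - v.1)‖ := by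
          congr 1; rw [smul_sub]; abel
      _ ≤ ‖c.2 - v.2‖ + ‖τ • (c.1 - v.1)‖ := norm_sub_le _ _
      _ ≤ 1 + 2 * t₀ := by
          rw [norm_smul, Real.norm_eq_abs]
          nlinarith [abs_nonneg τ, norm_nonneg (c.1 - v.1)]
  have hc : ‖c.2 - τ • c.1‖ ≤ |δ| * |offDiagForm τ δ (unitDir τ c) v| + (1 + 2 * t₀) := by
    have h1 : ⟪v.2 - τ • v.1, unitDir τ c⟫_ℝ = -δ * offDiagForm τ δ (unitDir τ c) v := by
      rw [offDiagForm_apply]; field_simp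
    have h2 : ⟪(c.2 - τ • c.1) - (v.2 - τ • v.1), unitDir τ c⟫_ℝ ≤ 1 + 2 * t₀ :=
      (real_inner_le_norm _ _).trans ((mul_le_of_le_one_right (norm_nonneg _)
        (norm_unitDir_le τ c)).trans hd)
    rw [inner_sub_left, inner_unitDir, h1] at h2
    have h3 : -δ * offDiagForm τ δ (unitDir τ c) v ≤ |δ| * |offDiagForm τ δ (unitDir τ c) v| := by
      rw [← abs_neg δ, ← abs_mul]
      exact le_abs_self _
    linarith
  have hv' : ‖v.2 - τ • v.1‖ ≤ ‖c.2 - τ • c.1‖ + (1 + 2 * t₀) := by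
    rw [norm_sub_rev] at hd
    have := norm_le_norm_add_norm_sub' (v.2 - τ • v.1) (c.2 - τ • c.1)
    linarith
  have h5 : |δ| * |offDiagForm τ δ (unitDir τ c) v| ≤ 2 * t₀ ^ 2 * X := by gcongr
  nlinarith

/-- The localised amplitude: `Q` multiplied by the cutoff at `c` and by `(1 + iL)^{-m}`, where `L`
is the form `offDiagForm` in the direction of `b - τ a`. -/
def localise (τ δ : ℝ) (m : ℕ) (c : Eu d × Eu d) (Q : Eu d × Eu d → ℂ) : Eu d × Eu d → ℂ :=
  fun v => pairCutoff d (v - c) *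
    (resolventFactor (offDiagForm τ δ (unitDir τ c)) v ^ m * Q v)

theorem smooth_localise (τ δ : ℝ) (m : ℕ) (c : Eu d × Eu d) {Q : Eu d × Eu d → ℂ} (hQ : Smooth Q) :
    Smooth (localise τ δ m c Q) :=
  (smooth_pairCutoff.comp (contDiff_id.sub contDiff_const)).mul
    (((smooth_resolventFactor _).pow m).mul hQ)

theorem support_localise_subset (τ δ : ℝ) (m : ℕ) (c : Eu d × Eu d) (Q : Eu d × Eu d → ℂ) :
    Function.support (localise τ δ m c Q) ⊆ Metric.closedBall c 1 := by
  intro v hv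
  have h : pairCutoff d (v - c) ≠ 0 := left_ne_zero_of_mul hv
  have := tsupport_pairCutoff_subset (subset_tsupport _ h)
  simpa [dist_eq_norm] using this

theorem hasCompactSupport_localise (τ δ : ℝ) (m : ℕ) (c : Eu d × Eu d) (Q : Eu d × Eu d → ℂ) :
    HasCompactSupport (localise τ δ m c Q) :=
  HasCompactSupport.of_support_subset_isCompact (isCompact_closedBall c 1)
    (support_localise_subset τ δ m c Q)

/-- The mixed derivatives of all localised amplitudes of `p` (with `ξ`-derivatives combined with the
coefficients `b`) are bounded by `C` times the weighted derivatives of `p`. -/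
def HasJetBound (τ δ : ℝ) (N m : ℕ) (p : Amplitude d) (b : ℕ → ℂ) (C : ℝ) : Prop :=
  ∀ e e₁ e₂ : Eu d, ‖e‖ ≤ 1 → ‖e₁‖ ≤ 1 → ‖e₂‖ ≤ 1 → ∀ (c : Eu d × Eu d) (ξ : Eu d) v,
    jetSum N ((e₁, 0) : Eu d × Eu d) (0, e₂)
      (localise τ δ m c fun v => p.xiOperator m b e (v.1, v.2, ξ)) v ≤
      C * (Metric.closedBall c 1).indicator (fun v => p.weightedDeriv τ N m v.1 v.2 ξ) v

/-- The constant in the jet bound depends only on `d`, `N`, `m`, `t₀`, `δ₀` and the bound `B` for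
the coefficients. -/
theorem exists_hasJetBound (d N m : ℕ) (t₀ δ₀ : ℝ) (hδ₀ : 0 < δ₀) (B : ℝ) (hB : 0 ≤ B) :
    ∃ C : ℝ, 0 ≤ C ∧ ∀ τ δ : ℝ, |τ| ≤ 2 * t₀ → |δ| ≤ 2 * t₀ ^ 2 → δ₀ ≤ |δ| →
      ∀ p : Amplitude d, Smooth p.uncurry → ∀ b : ℕ → ℂ, (∀ l, ‖b l‖ ≤ B) →
      HasJetBound τ δ N m p b C := by
  obtain ⟨M, hM0, hM⟩ := exists_jetSum_le_indicator (smooth_pairCutoff (d := d))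
    hasCompactSupport_pairCutoff N
  -- `Λ` bounds the form `L` in the unit directions `(e₁, 0)` and `(0, e₂)`; `K` is the constant
  -- in the comparison of `|z - τ w|` with `|1 + iL|`.
  set Λ : ℝ := (|2 * t₀| + 1) / δ₀ with hΛ
  have hΛ0 : 0 ≤ Λ := by positivity
  set K : ℝ := |2 * t₀ ^ 2 + 2 * (1 + 2 * t₀)|
  have hJ := (jetConst_pos N).le
  have hR := resolventConst_nonneg N m hΛ0
  refine ⟨jetConst N * (M * (jetConst N * (resolventConst N m Λ * (1 + K ^ m) * B))), by positivity,
    fun τ δ hτ hδ1 hδ2 p hp b hb e e₁ e₂ he h₁ h₂ c ξ v => ?_⟩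
  have hδpos : 0 < |δ| := hδ₀.trans_le hδ2
  have hδne : δ ≠ 0 := abs_pos.1 hδpos
  set L := offDiagForm τ δ (unitDir τ c)
  have hn₁ : ‖((e₁, 0) : Eu d × Eu d)‖ ≤ 1 := by simpa [Prod.norm_def] using h₁
  have hn₂ : ‖((0, e₂) : Eu d × Eu d)‖ ≤ 1 := by simpa [Prod.norm_def] using h₂
  have hin : ∀ x : Eu d, ‖x‖ ≤ 1 → |⟪x, unitDir τ c⟫_ℝ| ≤ 1 := fun x hx =>
    (abs_real_inner_le_norm _ _).trans
      (mul_le_one₀ hx (norm_nonneg _) (norm_unitDir_le τ c))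
  have hL₁ : |L (e₁, 0)| ≤ Λ := by
    rw [offDiagForm_apply]
    simp only [zero_sub, inner_neg_left, real_inner_smul_left]
    rw [neg_mul_neg, abs_mul, abs_inv, abs_mul, hΛ, ← div_eq_inv_mul]
    have := hin e₁ h₁
    gcongr
    nlinarith [abs_nonneg τ, abs_nonneg ⟪e₁, unitDir τ c⟫_ℝ, le_abs_self (2 * t₀)]
  have hL₂ : |L (0, e₂)| ≤ Λ := by
    rw [offDiagForm_apply]
    simp only [smul_zero, sub_zero]
    rw [abs_mul, abs_neg, abs_inv, hΛ, ← div_eq_inv_mul]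
    have := hin e₂ h₂
    gcongr
    linarith [abs_nonneg (2 * t₀)]
  have hQ : Smooth fun v : Eu d × Eu d => p.xiOperator m b e (v.1, v.2, ξ) :=
    Smooth.slice (Amplitude.smooth_xiOperator hp m b e) ξ
  have hχ : Smooth fun v => pairCutoff d (v - c) :=
    smooth_pairCutoff.comp (contDiff_id.sub contDiff_const)
  have hρ : Smooth fun v => resolventFactor L v ^ m := (smooth_resolventFactor L).pow m
  have hW : 0 ≤ p.totalDeriv N m v.1 v.2 ξ := p.totalDeriv_nonneg _ _ _ _ _
  have hjχ : jetSum N ((e₁, 0) : Eu d × Eu d) (0, e₂) (fun v => pairCutoff d (v - c)) v ≤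
      (Metric.closedBall c 1).indicator (fun _ => M) v := by
    rw [jetSum_comp_sub smooth_pairCutoff]
    refine (hM _ _ hn₁ hn₂ _).trans ?_
    by_cases hv : v ∈ Metric.closedBall c 1
    · rw [Set.indicator_of_mem hv]
      exact Set.indicator_le_self' (fun _ _ => hM0) _
    · rw [Set.indicator_of_notMem hv, Set.indicator_of_notMem]
      intro h
      apply hv
      simpa [dist_eq_norm] using tsupport_pairCutoff_subset h
  have hjQ := Amplitude.jetSum_xiOperator_le hp N m hb h₁ h₂ he v.1 v.2 ξ
  have hjρ := jetSum_resolventFactor_pow_le L N m hL₁ hL₂ v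
  refine (jetSum_mul_le hχ (hρ.mul hQ) N _ _ v).trans ?_
  by_cases hv : v ∈ Metric.closedBall c 1
  · rw [Set.indicator_of_mem hv] at hjχ ⊢
    have hdist := norm_sub_le_mul_norm_one_add hδne hδ1 hτ hv
    have hdecay : ‖resolventFactor L v‖ ^ m ≤ (1 + K ^ m) * (1 / (1 + ‖v.2 - τ • v.1‖ ^ m)) := by
      rw [mul_one_div, le_div_iff₀ (by positivity), resolventFactor, norm_inv, inv_pow,
        ← div_eq_inv_mul, div_le_iff₀ (by
          have := one_le_norm_one_add_I_mul (L v)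
          positivity)]
      have h1 : 1 ≤ ‖1 + Complex.I * ((L v : ℝ) : ℂ)‖ ^ m :=
        one_le_pow₀ (one_le_norm_one_add_I_mul (L v))
      have h2 : ‖v.2 - τ • v.1‖ ^ m ≤ K ^ m * ‖1 + Complex.I * ((L v : ℝ) : ℂ)‖ ^ m := by
        rw [← mul_pow]
        refine pow_le_pow_left₀ (norm_nonneg _) (hdist.trans ?_) m
        gcongr
        exact le_abs_self _
      linarith
    calc jetConst N * (jetSum N ((e₁, 0) : Eu d × Eu d) (0, e₂) (fun v => pairCutoff d (v - c)) v *
          jetSum N ((e₁, 0) : Eu d × Eu d) (0, e₂)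
            (fun v => resolventFactor L v ^ m * p.xiOperator m b e (v.1, v.2, ξ)) v)
        ≤ jetConst N * (M * (jetConst N *
          ((resolventConst N m Λ * ((1 + K ^ m) * (1 / (1 + ‖v.2 - τ • v.1‖ ^ m)))) *
            (B * p.totalDeriv N m v.1 v.2 ξ)))) := by
          gcongr
          · exact jetSum_nonneg _ _ _ _ _
          · refine (jetSum_mul_le hρ hQ N _ _ v).trans ?_
            gcongr
            · exact jetSum_nonneg _ _ _ _ _
            · exact hjρ.trans (by gcongr)
      _ = _ := by
          rw [Amplitude.weightedDeriv, Amplitude.totalDeriv]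
          ring
  · rw [Set.indicator_of_notMem hv] at hjχ ⊢
    have h0 : jetSum N ((e₁, 0) : Eu d × Eu d) (0, e₂) (fun v => pairCutoff d (v - c)) v = 0 :=
      le_antisymm hjχ (jetSum_nonneg _ _ _ _ _)
    rw [h0]
    simp

end Localisation

/-! ### Estimates for the localised Fourier transforms -/

section LocalEstimates

variable {d : ℕ}

instance : (volume : Measure ((Eu d × Eu d) × Eu d)).IsAddHaarMeasure := by
  rw [Measure.volume_eq_prod]
  exact Measure.prod.instIsAddHaarMeasure _ _

/-- The integral of the weighted derivatives of `p(·, ·, ξ)` over the unit ball around `c`. -/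
def localMass (p : Amplitude d) (τ : ℝ) (N m : ℕ) (c : Eu d × Eu d) (ξ : Eu d) : ℝ :=
  ∫ v in Metric.closedBall c 1, p.weightedDeriv τ N m v.1 v.2 ξ

theorem Amplitude.weightedDeriv_nonneg (p : Amplitude d) (τ : ℝ) (N m : ℕ) (w z ξ : Eu d) :
    0 ≤ p.weightedDeriv τ N m w z ξ :=
  mul_nonneg (by positivity) (p.totalDeriv_nonneg N m w z ξ)

theorem Amplitude.continuous_weightedDeriv {p : Amplitude d} (hp : Smooth p.uncurry) (τ : ℝ)
    (N m : ℕ) :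
    Continuous fun q : (Eu d × Eu d) × Eu d => p.weightedDeriv τ N m q.1.1 q.1.2 q.2 := by
  unfold Amplitude.weightedDeriv
  refine Continuous.mul ?_ ?_
  · simp only [one_div]
    refine Continuous.inv₀ (by fun_prop) fun q => ?_
    positivity
  · exact (continuous_totalDeriv hp N m).comp
      (f := fun q : (Eu d × Eu d) × Eu d => (q.1.1, q.1.2, q.2)) (by fun_prop)

/-- The weighted derivative of `p` is integrable over `ℝ³ᵈ`. -/
def WeightIntegrable (p : Amplitude d) (τ : ℝ) (N m : ℕ) : Prop :=
  Integrable fun q : (Eu d × Eu d) × Eu d => p.weightedDeriv τ N m q.1.1 q.1.2 q.2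

theorem localMass_eq_integral_add (p : Amplitude d) (τ : ℝ) (N m : ℕ) (c : Eu d × Eu d)
    (ξ : Eu d) : localMass p τ N m c ξ = ∫ u : Eu d × Eu d, (Metric.closedBall 0 1).indicator
      (fun _ => (1 : ℝ)) u * p.weightedDeriv τ N m (u + c).1 (u + c).2 ξ := by
  rw [localMass, ← integral_indicator Metric.isClosed_closedBall.measurableSet,
    ← integral_add_right_eq_self _ c]
  refine integral_congr_ae (Filter.Eventually.of_forall fun u => ?_)
  have : u + c ∈ Metric.closedBall c 1 ↔ u ∈ Metric.closedBall (0 : Eu d × Eu d) 1 := by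
    simp [dist_eq_norm]
  by_cases hu : u ∈ Metric.closedBall (0 : Eu d × Eu d) 1
  · simp only [Set.indicator_of_mem hu, Set.indicator_of_mem (this.2 hu), one_mul]
  · simp only [Set.indicator_of_notMem hu, Set.indicator_of_notMem (fun h => hu (this.1 h)), zero_mul]

/-- By Fubini and translation invariance, averaging over unit balls multiplies the integral by the
volume of the unit ball. -/
theorem integrable_localMass {p : Amplitude d} (hp : Smooth p.uncurry) {τ : ℝ} {N m : ℕ}
    (hi : WeightIntegrable p τ N m) :
    Integrable (fun q : (Eu d × Eu d) × Eu d => localMass p τ N m q.1 q.2) ∧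
    ∫ q : (Eu d × Eu d) × Eu d, localMass p τ N m q.1 q.2 =
      (volume (Metric.closedBall (0 : Eu d × Eu d) 1)).toReal *
        ∫ q : (Eu d × Eu d) × Eu d, p.weightedDeriv τ N m q.1.1 q.1.2 q.2 := by
  set I := ∫ q : (Eu d × Eu d) × Eu d, p.weightedDeriv τ N m q.1.1 q.1.2 q.2
  set χ : Eu d × Eu d → ℝ := (Metric.closedBall 0 1).indicator (fun _ => (1 : ℝ)) with hχ
  have hχi : Integrable χ :=
    (integrable_indicator_iff Metric.isClosed_closedBall.measurableSet).2
      (integrableOn_const (isCompact_closedBall _ _).measure_lt_top.ne)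
  set Ψ : ((Eu d × Eu d) × Eu d) × (Eu d × Eu d) → ℝ := fun q =>
    χ q.2 * p.weightedDeriv τ N m (q.2 + q.1.1).1 (q.2 + q.1.1).2 q.1.2 with hΨ
  have hshift : ∀ u : Eu d × Eu d, Integrable (fun q : (Eu d × Eu d) × Eu d =>
      p.weightedDeriv τ N m (u + q.1).1 (u + q.1).2 q.2) ∧
      ∫ q : (Eu d × Eu d) × Eu d, p.weightedDeriv τ N m (u + q.1).1 (u + q.1).2 q.2 = I := by
    intro u
    have h1 := Integrable.comp_add_left hi ((u, 0) : (Eu d × Eu d) × Eu d)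
    have h2 := integral_add_left_eq_self (μ := volume)
      (fun q : (Eu d × Eu d) × Eu d => p.weightedDeriv τ N m q.1.1 q.1.2 q.2) (u, 0)
    simp only [Prod.fst_add, Prod.snd_add, zero_add] at h1 h2 ⊢
    exact ⟨h1, h2⟩
  have hmeas : AEStronglyMeasurable Ψ (volume.prod volume) := by
    refine AEStronglyMeasurable.mul ?_ ?_
    · exact ((measurable_const.indicator Metric.isClosed_closedBall.measurableSet).comp
        measurable_snd).aestronglyMeasurable
    · refine Continuous.aestronglyMeasurable ?_
      exact (Amplitude.continuous_weightedDeriv hp τ N m).comp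
        (f := fun q : ((Eu d × Eu d) × Eu d) × (Eu d × Eu d) => (q.2 + q.1.1, q.1.2)) (by fun_prop)
  have hΨi : Integrable Ψ (volume.prod volume) := by
    rw [integrable_prod_iff' hmeas]
    refine ⟨Filter.Eventually.of_forall fun u => (hshift u).1.const_mul (χ u), ?_⟩
    have : (fun u => ∫ q : (Eu d × Eu d) × Eu d, ‖Ψ (q, u)‖) = fun u => ‖χ u‖ * I := by
      funext u
      simp only [hΨ, norm_mul]
      rw [integral_const_mul, ← (hshift u).2]
      congr 1
      refine integral_congr_ae (Filter.Eventually.of_forall fun q => ?_)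
      exact Real.norm_of_nonneg (p.weightedDeriv_nonneg _ _ _ _ _ _)
    rw [this]
    exact hχi.norm.mul_const _
  have hM : ∀ q : (Eu d × Eu d) × Eu d, localMass p τ N m q.1 q.2 = ∫ u, Ψ (q, u) :=
    fun q => localMass_eq_integral_add _ _ _ _ _ _
  simp only [hM]
  refine ⟨hΨi.integral_prod_left, ?_⟩
  rw [← integral_prod _ hΨi, integral_prod_symm _ hΨi]
  simp only [hΨ]
  have : ∀ u : Eu d × Eu d, ∫ q : (Eu d × Eu d) × Eu d,
      χ u * p.weightedDeriv τ N m (u + q.1).1 (u + q.1).2 q.2 = χ u * I := fun u => by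
    rw [integral_const_mul, (hshift u).2]
  simp only [this]
  rw [integral_mul_const, hχ, integral_indicator Metric.isClosed_closedBall.measurableSet]
  simp [Measure.real]

/-- At a fixed centre the local mass is integrable in `ξ`, with a bound independent of the
centre. -/
theorem integrable_localMass_slice {p : Amplitude d} {τ : ℝ} {N m : ℕ}
    (hi : WeightIntegrable p τ N m) (c : Eu d × Eu d) :
    Integrable (fun ξ => localMass p τ N m c ξ) ∧
    ∫ ξ, localMass p τ N m c ξ ≤
      ∫ q : (Eu d × Eu d) × Eu d, p.weightedDeriv τ N m q.1.1 q.1.2 q.2 := by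
  have h1 : Integrable (fun q : (Eu d × Eu d) × Eu d => p.weightedDeriv τ N m q.1.1 q.1.2 q.2)
      ((volume.restrict (Metric.closedBall c 1)).prod volume) := by
    have h := Integrable.integrableOn hi (s := Metric.closedBall c 1 ×ˢ Set.univ)
    rw [IntegrableOn, Measure.volume_eq_prod, ← Measure.prod_restrict, Measure.restrict_univ] at h
    exact h
  refine ⟨h1.integral_prod_right, ?_⟩
  have h2 := integral_prod_symm _ h1
  refine (le_of_eq ?_).trans (setIntegral_le_integral (s := Metric.closedBall c 1 ×ˢ Set.univ) hi
    (Filter.Eventually.of_forall fun q => p.weightedDeriv_nonneg _ _ _ _ _ _))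
  rw [Measure.volume_eq_prod, ← Measure.prod_restrict, Measure.restrict_univ]
  exact h2.symm

theorem measurable_pairFourier_param {Ω : Type*} [MeasurableSpace Ω] {G : Ω → Eu d × Eu d → ℂ}
    (hG : Measurable fun q : Ω × (Eu d × Eu d) => G q.1 q.2) :
    Measurable fun q : Ω × (Eu d × Eu d) => pairFourier (G q.1) q.2 := by
  have h : StronglyMeasurable fun q : (Ω × (Eu d × Eu d)) × (Eu d × Eu d) =>
      phase (-(2 * Real.pi * (⟪q.1.2.1, q.2.1⟫_ℝ + ⟪q.1.2.2, q.2.2⟫_ℝ))) * G q.1.1 q.2 := by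
    refine Measurable.stronglyMeasurable (Measurable.mul ?_ ?_)
    · refine continuous_phase.measurable.comp ?_
      have : Continuous fun r : (Eu d × Eu d) × (Eu d × Eu d) =>
          (-(2 * Real.pi * (⟪r.1.1, r.2.1⟫_ℝ + ⟪r.1.2, r.2.2⟫_ℝ))) := by fun_prop
      exact this.measurable.comp (g := fun r : (Eu d × Eu d) × (Eu d × Eu d) =>
          (-(2 * Real.pi * (⟪r.1.1, r.2.1⟫_ℝ + ⟪r.1.2, r.2.2⟫_ℝ))))
        (f := fun q : (Ω × (Eu d × Eu d)) × (Eu d × Eu d) => (q.1.2, q.2)) (by fun_prop)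
    · exact hG.comp (f := fun q : (Ω × (Eu d × Eu d)) × (Eu d × Eu d) => (q.1.1, q.2)) (by fun_prop)
  exact h.integral_prod_right'.measurable

variable {p : Amplitude d} {τ δ : ℝ} {m : ℕ} {b : ℕ → ℂ} {C : ℝ}

theorem integral_jetSum_localise_le {N : ℕ} (hp : Smooth p.uncurry)
    (hJ : HasJetBound τ δ N m p b C) {e e₁ e₂ : Eu d}
    (he : ‖e‖ ≤ 1) (h₁ : ‖e₁‖ ≤ 1) (h₂ : ‖e₂‖ ≤ 1) (c : Eu d × Eu d) (ξ : Eu d) :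
    ∫ v, jetSum N ((e₁, 0) : Eu d × Eu d) (0, e₂)
      (localise τ δ m c fun v => p.xiOperator m b e (v.1, v.2, ξ)) v ≤
      C * localMass p τ N m c ξ := by
  have hc : Continuous fun v : Eu d × Eu d => p.weightedDeriv τ N m v.1 v.2 ξ :=
    (Amplitude.continuous_weightedDeriv hp τ N m).comp
      (f := fun v : Eu d × Eu d => (v, ξ)) (by fun_prop)
  rw [localMass, ← integral_indicator Metric.isClosed_closedBall.measurableSet, ← integral_const_mul]
  refine integral_mono_of_nonneg (Filter.Eventually.of_forall fun v => jetSum_nonneg _ _ _ _ _) ?_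
    (Filter.Eventually.of_forall fun v => hJ e e₁ e₂ he h₁ h₂ c ξ v)
  refine Integrable.const_mul ?_ _
  rw [integrable_indicator_iff Metric.isClosed_closedBall.measurableSet]
  exact hc.continuousOn.integrableOn_compact (isCompact_closedBall _ _)

theorem norm_pairFourier_localise_le {N : ℕ} (hp : Smooth p.uncurry)
    (hJ : HasJetBound τ δ N m p b C) {e : Eu d} (he : ‖e‖ ≤ 1) (c : Eu d × Eu d) (ξ : Eu d)
    (k : Eu d × Eu d) :
    ‖pairFourier (localise τ δ m c fun v => p.xiOperator m b e (v.1, v.2, ξ)) k‖ ≤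
      4 * (C * localMass p τ N m c ξ) * freqWeight N k :=
  norm_pairFourier_le (smooth_localise _ _ _ _ (Smooth.slice (Amplitude.smooth_xiOperator hp m b e) ξ))
    (hasCompactSupport_localise _ _ _ _ _) N
    (fun _ _ h₁ h₂ => integral_jetSum_localise_le hp hJ he h₁ h₂ c ξ) k

theorem integrable_pairFourier_localise (hp : Smooth p.uncurry)
    (hJ : HasJetBound τ δ (d + 1) m p b C) {e : Eu d} (he : ‖e‖ ≤ 1) (c : Eu d × Eu d) (ξ : Eu d) :
    Integrable (pairFourier (localise τ δ m c fun v => p.xiOperator m b e (v.1, v.2, ξ))) := by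
  have hs := smooth_localise τ δ m c (Smooth.slice (Amplitude.smooth_xiOperator hp m b e) ξ)
  refine (integrable_freqWeight.const_mul (4 * (C * localMass p τ (d + 1) m c ξ))).mono' ?_
    (Filter.Eventually.of_forall fun k => norm_pairFourier_localise_le hp hJ he c ξ k)
  have := measurable_pairFourier_param (Ω := Unit)
    (G := fun _ => localise τ δ m c fun v => p.xiOperator m b e (v.1, v.2, ξ))
    (hs.continuous.measurable.comp measurable_snd)
  exact (this.comp (measurable_prodMk_left (x := ()))).aestronglyMeasurable

theorem integral_phase_mul_pairFourier_localise (hp : Smooth p.uncurry)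
    (hJ : HasJetBound τ δ (d + 1) m p b C) {e : Eu d} (he : ‖e‖ ≤ 1) (c : Eu d × Eu d) (ξ : Eu d)
    (v : Eu d × Eu d) :
    ∫ k : Eu d × Eu d, phase (2 * Real.pi * (⟪k.1, v.1⟫_ℝ + ⟪k.2, v.2⟫_ℝ)) *
      pairFourier (localise τ δ m c fun v => p.xiOperator m b e (v.1, v.2, ξ)) k =
      localise τ δ m c (fun v => p.xiOperator m b e (v.1, v.2, ξ)) v := by
  have hs := smooth_localise τ δ m c (Smooth.slice (Amplitude.smooth_xiOperator hp m b e) ξ)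
  exact integral_phase_mul_pairFourier hs.continuous
    (hs.continuous.integrable_of_hasCompactSupport (hasCompactSupport_localise _ _ _ _ _))
    (integrable_pairFourier_localise hp hJ he c ξ) v

/-- A Sobolev embedding: the localised amplitude is bounded by the mass of its derivatives. -/
theorem norm_localise_le (hp : Smooth p.uncurry)
    (hJ : HasJetBound τ δ (d + 1) m p b C) {e : Eu d} (he : ‖e‖ ≤ 1) (c : Eu d × Eu d) (ξ : Eu d)
    (v : Eu d × Eu d) :
    ‖localise τ δ m c (fun v => p.xiOperator m b e (v.1, v.2, ξ)) v‖ ≤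
      4 * (C * localMass p τ (d + 1) m c ξ) * ∫ k : Eu d × Eu d, freqWeight (d + 1) k := by
  rw [← integral_phase_mul_pairFourier_localise hp hJ he, ← integral_const_mul]
  refine norm_integral_le_of_norm_le (integrable_freqWeight.const_mul _)
    (Filter.Eventually.of_forall fun k => ?_)
  rw [norm_mul, norm_phase, one_mul]
  exact norm_pairFourier_localise_le hp hJ he c ξ k

/-- Pointwise bound for an amplitude after differentiation in `ξ`: at the centre of the ball, the
cutoff and the factor `(1 + iL)^{-m}` can be divided out. -/
theorem norm_xiOperator_le (hp : Smooth p.uncurry)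
    (hJ : HasJetBound τ δ (d + 1) m p b C) {e : Eu d} (he : ‖e‖ ≤ 1)
    (v : Eu d × Eu d) (ξ : Eu d) :
    ‖p.xiOperator m b e (v.1, v.2, ξ)‖ ≤ ‖pairCutoff d 0‖⁻¹ *
      (1 + |δ|⁻¹ * ‖v.2 - τ • v.1‖) ^ m *
      (4 * (C * localMass p τ (d + 1) m v ξ) * ∫ k : Eu d × Eu d, freqWeight (d + 1) k) := by
  have h := norm_localise_le hp hJ he v ξ v
  set L := offDiagForm τ δ (unitDir τ v) with hL
  have hLv : |L v| ≤ |δ|⁻¹ * ‖v.2 - τ • v.1‖ := by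
    rw [hL, offDiagForm_apply, inner_unitDir, abs_mul, abs_neg, abs_inv, abs_norm]
  have hn : ‖1 + Complex.I * ((L v : ℝ) : ℂ)‖ ≤ 1 + |δ|⁻¹ * ‖v.2 - τ • v.1‖ := by
    refine (norm_add_le _ _).trans ?_
    rw [norm_one, norm_mul, Complex.norm_I, one_mul, Complex.norm_real, Real.norm_eq_abs]
    linarith
  have hχ : (pairCutoff d 0) ≠ 0 := pairCutoff_zero_ne
  have hne := one_add_I_mul_ne_zero (L v)
  have hq : p.xiOperator m b e (v.1, v.2, ξ) = (pairCutoff d 0)⁻¹ *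
      (1 + Complex.I * ((L v : ℝ) : ℂ)) ^ m *
      localise τ δ m v (fun v => p.xiOperator m b e (v.1, v.2, ξ)) v := by
    have hne' := pow_ne_zero m hne
    rw [localise, sub_self, resolventFactor, ← hL, inv_pow]
    field_simp
  rw [hq, norm_mul, norm_mul, norm_inv, norm_pow]
  gcongr

theorem integrable_xiOperator (hp : Smooth p.uncurry)
    (hJ : HasJetBound τ δ (d + 1) m p b C) (hi : WeightIntegrable p τ (d + 1) m)
    {e : Eu d} (he : ‖e‖ ≤ 1) (v : Eu d × Eu d) :
    Integrable fun ξ => p.xiOperator m b e (v.1, v.2, ξ) := by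
  refine Integrable.mono' (g := fun ξ => ‖pairCutoff d 0‖⁻¹ *
      (1 + |δ|⁻¹ * ‖v.2 - τ • v.1‖) ^ m *
      (4 * (C * localMass p τ (d + 1) m v ξ) * ∫ k : Eu d × Eu d, freqWeight (d + 1) k)) ?_ ?_
    (Filter.Eventually.of_forall fun ξ => norm_xiOperator_le hp hJ he v ξ)
  · exact ((((integrable_localMass_slice hi v).1.const_mul C).const_mul 4).mul_const _).const_mul _
  · exact ((Amplitude.smooth_xiOperator hp m b e).continuous.comp
      (f := fun ξ => (v.1, v.2, ξ)) (by fun_prop)).aestronglyMeasurable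

end LocalEstimates

/-! ### The kernel as a superposition of products -/

section KernelRepresentation

variable {d : ℕ}

/-- The coefficients of `(1 - α⁻¹ ∂)^m`. -/
def ibpCoeff (α : ℝ) (m l : ℕ) : ℂ := (m.choose l : ℂ) * (-(α : ℂ)⁻¹) ^ l

theorem norm_ibpCoeff_le {α : ℝ} (hα : 1 ≤ α) (m l : ℕ) : ‖ibpCoeff α m l‖ ≤ 2 ^ m := by
  have h1 : ‖(-(α : ℂ)⁻¹) ^ l‖ ≤ 1 := by
    rw [norm_pow, norm_neg, norm_inv, Complex.norm_real, Real.norm_of_nonneg (by linarith)]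
    exact pow_le_one₀ (by positivity) (inv_le_one_of_one_le₀ hα)
  rw [ibpCoeff, norm_mul, Complex.norm_natCast]
  calc (m.choose l : ℝ) * ‖(-(α : ℂ)⁻¹) ^ l‖ ≤ 2 ^ m * 1 := by
        gcongr
        exact_mod_cast Nat.choose_le_two_pow m l
    _ = 2 ^ m := mul_one _

theorem dirDeriv_xi_slice {f : Eu d × Eu d × Eu d → ℂ} (hf : Smooth f) (w z e : Eu d) (n : ℕ) :
    (dirDeriv e)^[n] (fun ξ => f (w, z, ξ)) =
      fun ξ => (dirDeriv (embXi d e))^[n] f (w, z, ξ) := by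
  have := dirDeriv_iterate_comp_affine hf (embXi d) (w, z, 0) e n
  simpa using this

theorem xiOperator_single (p : Amplitude d) {m l : ℕ} (hl : l ≤ m) (e : Eu d) :
    p.xiOperator m (fun k => if k = l then 1 else 0) e = (dirDeriv (embXi d e))^[l] p.uncurry := by
  funext v
  have : l ∈ Finset.range (m + 1) := Finset.mem_range.2 (Nat.lt_succ_of_le hl)
  simp [Amplitude.xiOperator, Finset.sum_ite_eq', this]

/-- Integration by parts in `ξ`: it gains the factor `(1 + i s·e)^{-m}`. -/
theorem integral_phase_mul_xiOperator {p : Amplitude d} (hp : Smooth p.uncurry) {α : ℝ}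
    (hα : α ≠ 0) (m : ℕ) (s e : Eu d) (v : Eu d × Eu d)
    (hint : ∀ l ≤ m, Integrable fun ξ => (dirDeriv (embXi d e))^[l] p.uncurry (v.1, v.2, ξ)) :
    ∫ ξ, phase (α * ⟪s, ξ⟫_ℝ) * p.xiOperator m (ibpCoeff α m) e (v.1, v.2, ξ) =
      (1 + Complex.I * ((⟪s, e⟫_ℝ : ℝ) : ℂ)) ^ m *
        ∫ ξ, phase (α * ⟪s, ξ⟫_ℝ) * p v.1 v.2 ξ := by
  set L : Eu d →L[ℝ] ℝ := α • innerSL ℝ s with hL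
  have hLa : ∀ ξ, L ξ = α * ⟪s, ξ⟫_ℝ := fun ξ => by simp [hL]
  have hsm : Smooth fun ξ => p.uncurry (v.1, v.2, ξ) :=
    hp.comp (contDiff_const.prodMk (contDiff_const.prodMk contDiff_id))
  have hl : ∀ l ≤ m, ∫ ξ, phase (α * ⟪s, ξ⟫_ℝ) *
      (dirDeriv (embXi d e))^[l] p.uncurry (v.1, v.2, ξ) =
      (-(Complex.I * ((α * ⟪s, e⟫_ℝ : ℝ) : ℂ))) ^ l * ∫ ξ, phase (α * ⟪s, ξ⟫_ℝ) * p v.1 v.2 ξ := by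
    intro l hl
    have h := integral_phase_mul_dirDeriv_iterate (μ := volume) L e hsm l fun k hk => by
      rw [dirDeriv_xi_slice hp]
      exact hint k (hk.trans hl)
    rw [dirDeriv_xi_slice hp] at h
    simp only [hLa] at h
    exact h
  have hαm : AEMeasurable (fun ξ : Eu d => α * ⟪s, ξ⟫_ℝ) := by fun_prop
  simp only [Amplitude.xiOperator, Finset.mul_sum]
  rw [integral_finsetSum]
  · have : ∀ l ∈ Finset.range (m + 1), ∫ ξ, phase (α * ⟪s, ξ⟫_ℝ) * (ibpCoeff α m l *
        (dirDeriv (embXi d e))^[l] p.uncurry (v.1, v.2, ξ)) =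
        ((Complex.I * ((⟪s, e⟫_ℝ : ℝ) : ℂ)) ^ l * 1 ^ (m - l) * (m.choose l : ℂ)) *
          ∫ ξ, phase (α * ⟪s, ξ⟫_ℝ) * p v.1 v.2 ξ := by
      intro l hlm
      have hlm' : l ≤ m := Nat.lt_succ_iff.1 (Finset.mem_range.1 hlm)
      have h1 : ∀ ξ, phase (α * ⟪s, ξ⟫_ℝ) * (ibpCoeff α m l *
          (dirDeriv (embXi d e))^[l] p.uncurry (v.1, v.2, ξ)) = ibpCoeff α m l *
          (phase (α * ⟪s, ξ⟫_ℝ) * (dirDeriv (embXi d e))^[l] p.uncurry (v.1, v.2, ξ)) :=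
        fun ξ => by ring
      simp only [h1]
      rw [integral_const_mul, hl l hlm', ibpCoeff, ← mul_assoc]
      congr 1
      have hα' : (α : ℂ) ≠ 0 := Complex.ofReal_ne_zero.2 hα
      have h2 : (-(α : ℂ)⁻¹) * (-(Complex.I * ((α * ⟪s, e⟫_ℝ : ℝ) : ℂ))) =
          Complex.I * ((⟪s, e⟫_ℝ : ℝ) : ℂ) := by
        push_cast
        field_simp
      rw [mul_assoc, ← mul_pow, h2]
      ring
    rw [Finset.sum_congr rfl this, ← Finset.sum_mul, ← add_pow, add_comm]
  · intro l hlm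
    refine ((hint l (Nat.lt_succ_iff.1 (Finset.mem_range.1 hlm))).const_mul _).phase_mul hαm

theorem continuous_dirDeriv_embXi {p : Amplitude d} (hp : Smooth p.uncurry) (l : ℕ) :
    Continuous fun r : Eu d × (Eu d × Eu d × Eu d) =>
      (dirDeriv (embXi d r.1))^[l] p.uncurry r.2 := by
  simp only [← iteratedFDeriv_apply_const hp]
  refine Continuous.eval ((hp.iteratedFDeriv l).continuous.comp continuous_snd) ?_
  exact continuous_pi fun _ => (embXi d).continuous.comp continuous_fst

theorem measurable_unitDir (τ : ℝ) : Measurable (unitDir τ : Eu d × Eu d → Eu d) := by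
  unfold unitDir
  have h : Measurable fun c : Eu d × Eu d => c.2 - τ • c.1 := by fun_prop
  exact h.norm.inv.smul h

/-- The coefficient of `e^{2πi(η·w + μ·z)}` in the expansion of the amplitude localised at `c`;
the parameter is `((c, ξ), (η, μ))`. -/
def kernelCoeff (τ δ : ℝ) (m : ℕ) (p : Amplitude d) (b : ℕ → ℂ)
    (θ : ((Eu d × Eu d) × Eu d) × (Eu d × Eu d)) : ℂ :=
  pairFourier (localise τ δ m θ.1.1 fun v => p.xiOperator m b (unitDir τ θ.1.1) (v.1, v.2, θ.1.2)) θ.2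

variable {p : Amplitude d} {τ δ : ℝ} {m : ℕ} {b : ℕ → ℂ} {C : ℝ}

theorem measurable_kernelCoeff (hp : Smooth p.uncurry) : Measurable (kernelCoeff τ δ m p b) := by
  refine measurable_pairFourier_param (G := fun q : (Eu d × Eu d) × Eu d =>
    localise τ δ m q.1 fun v => p.xiOperator m b (unitDir τ q.1) (v.1, v.2, q.2)) ?_
  have hu : Measurable fun q : ((Eu d × Eu d) × Eu d) × (Eu d × Eu d) => unitDir τ q.1.1 :=
    (measurable_unitDir τ).comp (by fun_prop)
  refine Measurable.mul ?_ (Measurable.mul (Measurable.pow_const ?_ m) ?_)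
  · exact (smooth_pairCutoff.continuous.comp
      (f := fun q : ((Eu d × Eu d) × Eu d) × (Eu d × Eu d) => q.2 - q.1.1) (by fun_prop)).measurable
  · simp only [resolventFactor, offDiagForm_apply]
    have h1 : Measurable fun q : ((Eu d × Eu d) × Eu d) × (Eu d × Eu d) =>
        ⟪q.2.2 - τ • q.2.1, unitDir τ q.1.1⟫_ℝ := by
      refine Measurable.inner ?_ hu
      fun_prop
    exact (measurable_const.add (measurable_const.mul
      (Complex.measurable_ofReal.comp (measurable_const.mul h1)))).inv
  · unfold Amplitude.xiOperator
    refine Finset.measurable_fun_sum _ fun l _ => measurable_const.mul ?_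
    exact (continuous_dirDeriv_embXi hp l).measurable.comp
      (f := fun q : ((Eu d × Eu d) × Eu d) × (Eu d × Eu d) =>
        (unitDir τ q.1.1, (q.2.1, q.2.2, q.1.2)))
      (hu.prodMk (by fun_prop))

theorem integrable_kernelCoeff (hp : Smooth p.uncurry)
    (hJ : HasJetBound τ δ (d + 1) m p b C) (hi : WeightIntegrable p τ (d + 1) m) :
    Integrable (kernelCoeff τ δ m p b) ∧ ∫ θ, ‖kernelCoeff τ δ m p b θ‖ ≤
      4 * C * (volume (Metric.closedBall (0 : Eu d × Eu d) 1)).toReal *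
        (∫ k : Eu d × Eu d, freqWeight (d + 1) k) *
        ∫ q : (Eu d × Eu d) × Eu d, p.weightedDeriv τ (d + 1) m q.1.1 q.1.2 q.2 := by
  have hM := integrable_localMass hp hi
  have hbi := ((hM.1.const_mul C).const_mul 4).mul_prod (integrable_freqWeight (d := d))
  have hle : ∀ θ : ((Eu d × Eu d) × Eu d) × (Eu d × Eu d), ‖kernelCoeff τ δ m p b θ‖ ≤
      4 * (C * localMass p τ (d + 1) m θ.1.1 θ.1.2) * freqWeight (d + 1) θ.2 :=
    fun θ => norm_pairFourier_localise_le hp hJ (norm_unitDir_le τ _) _ _ _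
  have hint : Integrable (kernelCoeff τ δ m p b) :=
    Integrable.mono' hbi (measurable_kernelCoeff hp).aestronglyMeasurable
      (Filter.Eventually.of_forall hle)
  refine ⟨hint, (integral_mono hint.norm hbi hle).trans (le_of_eq ?_)⟩
  rw [Measure.volume_eq_prod, integral_prod_mul
    (fun q : (Eu d × Eu d) × Eu d => 4 * (C * localMass p τ (d + 1) m q.1 q.2)),
    integral_const_mul, integral_const_mul, hM.2]
  ring

/-- The kernel of the operator as a superposition of plane waves in `(w, z)`. The function `Ψ`
stands for the cutoffs in `x` and `y`: it must be one for all `c` whose unit ball contains `v`,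
and elsewhere the localised amplitude vanishes. -/
theorem integral_kernelCoeff (hp : Smooth p.uncurry) {α : ℝ} (hα : 1 ≤ α)
    (hJ : ∀ b : ℕ → ℂ, (∀ l, ‖b l‖ ≤ 2 ^ m) → HasJetBound τ δ (d + 1) m p b C)
    (hi : WeightIntegrable p τ (d + 1) m) (s : Eu d) (v : Eu d × Eu d)
    (hs : ∀ e, ⟪s, e⟫_ℝ = offDiagForm τ δ e v) {Ψ : Eu d × Eu d → ℂ} (hΨm : Measurable Ψ)
    (hΨ : ∀ c, ‖Ψ c‖ ≤ 1) (hΨ1 : ∀ c, v ∈ Metric.closedBall c 1 → Ψ c = 1) :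
    ∫ θ : ((Eu d × Eu d) × Eu d) × (Eu d × Eu d), Ψ θ.1.1 * phase (α * ⟪s, θ.1.2⟫_ℝ) *
      (phase (2 * Real.pi * (⟪θ.2.1, v.1⟫_ℝ + ⟪θ.2.2, v.2⟫_ℝ)) *
        kernelCoeff τ δ m p (ibpCoeff α m) θ) =
      ∫ ξ, phase (α * ⟪s, ξ⟫_ℝ) * p v.1 v.2 ξ := by
  have hJb := hJ _ (norm_ibpCoeff_le hα m)
  have hFi := (integrable_kernelCoeff hp hJb hi).1
  have hm1 : Measurable fun θ : ((Eu d × Eu d) × Eu d) × (Eu d × Eu d) =>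
      Ψ θ.1.1 * phase (α * ⟪s, θ.1.2⟫_ℝ) := by
    refine (hΨm.comp (by fun_prop)).mul (continuous_phase.measurable.comp ?_)
    fun_prop
  have hI : Integrable (fun θ : ((Eu d × Eu d) × Eu d) × (Eu d × Eu d) =>
      Ψ θ.1.1 * phase (α * ⟪s, θ.1.2⟫_ℝ) *
      (phase (2 * Real.pi * (⟪θ.2.1, v.1⟫_ℝ + ⟪θ.2.2, v.2⟫_ℝ)) *
        kernelCoeff τ δ m p (ibpCoeff α m) θ)) := by
    refine (hFi.phase_mul (by fun_prop)).bdd_mul (c := 1) hm1.aestronglyMeasurable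
      (Filter.Eventually.of_forall fun θ => ?_)
    rw [norm_mul, norm_phase, mul_one]
    exact hΨ _
  -- Integrating over the frequencies undoes the Fourier transform, and `Ψ` can be dropped.
  have hin : ∀ q : (Eu d × Eu d) × Eu d, ∫ k : Eu d × Eu d, Ψ q.1 * phase (α * ⟪s, q.2⟫_ℝ) *
      (phase (2 * Real.pi * (⟪k.1, v.1⟫_ℝ + ⟪k.2, v.2⟫_ℝ)) *
        kernelCoeff τ δ m p (ibpCoeff α m) (q, k)) =
      phase (α * ⟪s, q.2⟫_ℝ) * localise τ δ m q.1 (fun v => p.xiOperator m (ibpCoeff α m)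
        (unitDir τ q.1) (v.1, v.2, q.2)) v := by
    intro q
    rw [integral_const_mul]
    simp only [kernelCoeff]
    rw [integral_phase_mul_pairFourier_localise hp hJb (norm_unitDir_le τ _)]
    by_cases hv : v ∈ Metric.closedBall q.1 1
    · rw [hΨ1 _ hv, one_mul]
    · rw [Function.notMem_support.1 fun h => hv (support_localise_subset _ _ _ _ _ h), mul_zero,
        mul_zero]
  -- Integrating over `ξ` undoes the integration by parts: the powers of `1 + iL` cancel.
  have hξ : ∀ c : Eu d × Eu d, ∫ ξ, phase (α * ⟪s, ξ⟫_ℝ) * localise τ δ m c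
      (fun v => p.xiOperator m (ibpCoeff α m) (unitDir τ c) (v.1, v.2, ξ)) v =
      pairCutoff d (v - c) * ∫ ξ, phase (α * ⟪s, ξ⟫_ℝ) * p v.1 v.2 ξ := by
    intro c
    have h1 : ∀ ξ, phase (α * ⟪s, ξ⟫_ℝ) * localise τ δ m c
        (fun v => p.xiOperator m (ibpCoeff α m) (unitDir τ c) (v.1, v.2, ξ)) v =
        (pairCutoff d (v - c) * resolventFactor (offDiagForm τ δ (unitDir τ c)) v ^ m) *
          (phase (α * ⟪s, ξ⟫_ℝ) * p.xiOperator m (ibpCoeff α m) (unitDir τ c) (v.1, v.2, ξ)) :=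
      fun ξ => by rw [localise]; ring
    simp only [h1]
    rw [integral_const_mul, integral_phase_mul_xiOperator hp (by linarith) m s _ v, hs]
    · rw [resolventFactor, inv_pow]
      have := pow_ne_zero m (one_add_I_mul_ne_zero (offDiagForm τ δ (unitDir τ c) v))
      field_simp
    · intro l hl
      rw [← xiOperator_single p hl]
      refine integrable_xiOperator hp (hJ _ fun k => ?_) hi (norm_unitDir_le τ c) v
      have h2 : (1 : ℝ) ≤ 2 ^ m := one_le_pow₀ (by norm_num)
      split_ifs
      · simpa using h2
      · simp
  rw [Measure.volume_eq_prod] at hI ⊢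
  have hI' := hI.integral_prod_left
  rw [integral_prod _ hI]
  simp only [hin] at hI' ⊢
  rw [Measure.volume_eq_prod] at hI' ⊢
  rw [integral_prod _ hI']
  simp only [hξ]
  -- The integral over `c` that remains is that of the cutoff.
  have := Measure.IsAddHaarMeasure.isNegInvariant_of_regular (volume : Measure (Eu d × Eu d))
  rw [integral_mul_const, integral_sub_left_eq_self (fun c => pairCutoff d c), integral_pairCutoff,
    one_mul]

end KernelRepresentation

/-! ### Functions with finite lattice norm -/

section Lattice

variable {d : ℕ}

theorem setLIntegral_unitCube_le (h : Eu d → ℂ) (u : Eu d) :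
    ∫⁻ x in unitCube u, ‖h x‖ₑ ^ 2 ≤ latticeNorm h ^ 2 := by
  have h1 : (∫⁻ x in unitCube u, ‖h x‖ₑ ^ 2) ^ (1 / 2 : ℝ) ≤ latticeNorm h :=
    le_iSup (fun u => (∫⁻ x in unitCube u, ‖h x‖ₑ ^ 2) ^ (1 / 2 : ℝ)) u
  have h2 := pow_le_pow_left' h1 2
  rwa [← ENNReal.rpow_natCast, ← ENNReal.rpow_mul, show (1 / 2 : ℝ) * ((2 : ℕ) : ℝ) = 1 by norm_num,
    ENNReal.rpow_one] at h2

theorem unitCube_mem_nhds (u : Eu d) : unitCube u ∈ nhds u := by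
  refine Filter.mem_of_superset (Metric.ball_mem_nhds u (by norm_num : (0 : ℝ) < 1 / 2)) ?_
  intro x hx i
  have h1 : ‖(x - u) i‖ ≤ ‖x - u‖ := PiLp.norm_apply_le (x - u) i
  rw [Metric.mem_ball, dist_eq_norm] at hx
  simpa [Real.norm_eq_abs] using h1.trans hx.le

/-- A ball of radius `R` is covered by a number of unit cubes that depends on `R` only. -/
theorem exists_setLIntegral_closedBall_le (d : ℕ) (R : ℝ) : ∃ n : ℕ, ∀ (h : Eu d → ℂ) (X : Eu d),
    ∫⁻ x in Metric.closedBall X R, ‖h x‖ₑ ^ 2 ≤ n * latticeNorm h ^ 2 := by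
  obtain ⟨t, -, ht⟩ := (isCompact_closedBall (0 : Eu d) R).elim_nhds_subcover
    (fun u => unitCube u) fun u _ => unitCube_mem_nhds u
  refine ⟨t.card, fun h X => ?_⟩
  have hsub : Metric.closedBall X R ⊆ ⋃ u : t, unitCube (X + u.1) := by
    intro x hx
    have hx' : x - X ∈ Metric.closedBall (0 : Eu d) R := by simpa [dist_eq_norm] using hx
    obtain ⟨u, hu, hxu⟩ := Set.mem_iUnion₂.1 (ht hx')
    refine Set.mem_iUnion.2 ⟨⟨u, hu⟩, fun i => ?_⟩
    have := hxu i
    simp only [PiLp.sub_apply, PiLp.add_apply] at this ⊢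
    rwa [← sub_sub]
  calc ∫⁻ x in Metric.closedBall X R, ‖h x‖ₑ ^ 2
      ≤ ∫⁻ x in ⋃ u : t, unitCube (X + u.1), ‖h x‖ₑ ^ 2 := lintegral_mono_set hsub
    _ ≤ ∑' u : t, ∫⁻ x in unitCube (X + u.1), ‖h x‖ₑ ^ 2 := lintegral_iUnion_le _ _
    _ ≤ ∑' _ : t, latticeNorm h ^ 2 := ENNReal.tsum_le_tsum fun u => setLIntegral_unitCube_le h _
    _ = t.card * latticeNorm h ^ 2 := by
        rw [tsum_fintype, Finset.sum_const, nsmul_eq_mul, Finset.card_univ, Fintype.card_coe]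

/-- A continuous cutoff, equal to one on the ball of radius `R` and to zero off the ball of
radius `R + 1`. -/
def ballWindow (R : ℝ) (x : Eu d) : ℝ := max 0 (min 1 (R + 1 - ‖x‖))

theorem ballWindow_eq_one {R : ℝ} {x : Eu d} (hx : ‖x‖ ≤ R) : ballWindow R x = 1 := by
  rw [ballWindow, min_eq_left (by linarith), max_eq_right zero_le_one]

theorem ballWindow_eq_zero {R : ℝ} {x : Eu d} (hx : R + 1 ≤ ‖x‖) : ballWindow R x = 0 :=
  max_eq_left ((min_le_right _ _).trans (by linarith))

theorem abs_ballWindow_le (R : ℝ) (x : Eu d) : |ballWindow R x| ≤ 1 := by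
  rw [abs_of_nonneg (le_max_left _ _)]
  exact max_le zero_le_one (min_le_left _ _)

theorem continuous_ballWindow (R : ℝ) : Continuous (ballWindow R : Eu d → ℝ) := by
  unfold ballWindow; fun_prop

/-- The plane wave of frequency `π.2`, cut off around the point `π.1`. -/
def windowWave (R : ℝ) (π : Eu d × Eu d) (x : Eu d) : ℂ :=
  (ballWindow R (x - π.1) : ℂ) * phase ⟪π.2, x⟫_ℝ

theorem continuous_windowWave (R : ℝ) :
    Continuous fun q : (Eu d × Eu d) × Eu d => windowWave R q.1 q.2 := by
  refine Continuous.mul ?_ (continuous_phase.comp (by fun_prop))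
  exact Complex.continuous_ofReal.comp ((continuous_ballWindow R).comp (by fun_prop))

theorem norm_windowWave_le (R : ℝ) (π : Eu d × Eu d) (x : Eu d) : ‖windowWave R π x‖ ≤ 1 := by
  rw [windowWave, norm_mul, norm_phase, mul_one, Complex.norm_real]
  exact abs_ballWindow_le _ _

theorem windowWave_eq_zero {R : ℝ} {π : Eu d × Eu d} {x : Eu d}
    (hx : x ∉ Metric.closedBall π.1 (R + 1)) : windowWave R π x = 0 := by
  rw [Metric.mem_closedBall, dist_eq_norm, not_le] at hx
  rw [windowWave, ballWindow_eq_zero hx.le, Complex.ofReal_zero, zero_mul]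

theorem eLpNorm_two_eq (f : Eu d → ℂ) :
    eLpNorm f 2 volume = (∫⁻ x, ‖f x‖ₑ ^ 2) ^ (1 / 2 : ℝ) := by
  rw [eLpNorm_eq_lintegral_rpow_enorm_toReal (by norm_num) (by norm_num)]
  simp

theorem eLpNorm_mul_windowWave_le {R : ℝ} {n : ℕ} {h : Eu d → ℂ}
    (hn : ∀ X : Eu d, ∫⁻ x in Metric.closedBall X (R + 1), ‖h x‖ₑ ^ 2 ≤ n * latticeNorm h ^ 2)
    (π : Eu d × Eu d) : eLpNorm (fun x => h x * windowWave R π x) 2 volume ≤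
      ENNReal.ofReal (Real.sqrt n) * latticeNorm h := by
  have h1 : ∫⁻ x, ‖h x * windowWave R π x‖ₑ ^ 2 ≤
      ∫⁻ x in Metric.closedBall π.1 (R + 1), ‖h x‖ₑ ^ 2 := by
    rw [← lintegral_indicator Metric.isClosed_closedBall.measurableSet]
    refine lintegral_mono fun x => ?_
    by_cases hx : x ∈ Metric.closedBall π.1 (R + 1)
    · rw [Set.indicator_of_mem hx, enorm_mul]
      refine pow_le_pow_left' ?_ 2
      refine mul_le_of_le_one_right (zero_le) ?_
      rw [← ofReal_norm]
      exact ENNReal.ofReal_le_one.2 (norm_windowWave_le R π x)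
    · rw [windowWave_eq_zero hx]
      simp
  rw [eLpNorm_two_eq]
  calc (∫⁻ x, ‖h x * windowWave R π x‖ₑ ^ 2) ^ (1 / 2 : ℝ)
      ≤ (n * latticeNorm h ^ 2) ^ (1 / 2 : ℝ) :=
        ENNReal.rpow_le_rpow (h1.trans (hn _)) (by norm_num)
    _ = ENNReal.ofReal (Real.sqrt n) * latticeNorm h := by
        rw [ENNReal.mul_rpow_of_nonneg _ _ (by norm_num), ← ENNReal.rpow_natCast,
          ← ENNReal.rpow_mul, show ((2 : ℕ) : ℝ) * (1 / 2 : ℝ) = 1 by norm_num, ENNReal.rpow_one,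
          Real.sqrt_eq_rpow, ← ENNReal.ofReal_rpow_of_nonneg (by positivity) (by norm_num),
          ENNReal.ofReal_natCast]

theorem memLp_mul_windowWave {h : Eu d → ℂ} (hh : MemLattice h) (R : ℝ) (π : Eu d × Eu d) :
    MemLp (fun x => h x * windowWave R π x) 2 volume := by
  obtain ⟨n, hn⟩ := exists_setLIntegral_closedBall_le d (R + 1)
  refine ⟨hh.1.mul ((continuous_windowWave R).comp
    (f := fun x => (π, x)) (by fun_prop)).aestronglyMeasurable, ?_⟩
  exact (eLpNorm_mul_windowWave_le (hn h) π).trans_lt (ENNReal.mul_lt_top ENNReal.ofReal_lt_top hh.2)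

/-- The vector `h · windowWave R π` of `L²`. -/
def windowVec {h : Eu d → ℂ} (hh : MemLattice h) (R : ℝ) (π : Eu d × Eu d) : L2 d :=
  (memLp_mul_windowWave hh R π).toLp _

theorem coeFn_windowVec {h : Eu d → ℂ} (hh : MemLattice h) (R : ℝ) (π : Eu d × Eu d) :
    windowVec hh R π =ᵐ[volume] fun x => h x * windowWave R π x :=
  MemLp.coeFn_toLp _

/-- `windowVec` is continuous in its parameters, by dominated convergence. -/
theorem continuous_windowVec {h : Eu d → ℂ} (hh : MemLattice h) (R : ℝ) :
    Continuous (windowVec hh R) := by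
  obtain ⟨n, hn⟩ := exists_setLIntegral_closedBall_le d (R + 2)
  rw [continuous_iff_continuousAt]
  intro π₀
  rw [ContinuousAt, tendsto_iff_edist_tendsto_0]
  simp only [windowVec, Lp.edist_toLp_toLp, eLpNorm_two_eq]
  have hlim : Filter.Tendsto (fun π : Eu d × Eu d => ∫⁻ x,
      ‖((fun x => h x * windowWave R π x) - fun x => h x * windowWave R π₀ x) x‖ₑ ^ 2)
      (nhds π₀) (nhds (∫⁻ _ : Eu d, 0)) := by
    refine tendsto_lintegral_filter_of_dominated_convergence'
      (fun x => (Metric.closedBall π₀.1 (R + 2)).indicator (fun x => 4 * ‖h x‖ₑ ^ 2) x) ?_ ?_ ?_ ?_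
    · refine Filter.Eventually.of_forall fun π => ?_
      exact (((memLp_mul_windowWave hh R π).1.sub (memLp_mul_windowWave hh R π₀).1).enorm).pow_const 2
    · filter_upwards [Metric.ball_mem_nhds π₀ zero_lt_one] with π hπ
      refine Filter.Eventually.of_forall fun x => ?_
      simp only [Pi.sub_apply]
      by_cases hx : x ∈ Metric.closedBall π₀.1 (R + 2)
      · rw [Set.indicator_of_mem hx, ← mul_sub, enorm_mul, mul_pow, mul_comm]
        gcongr
        have h2 : ‖windowWave R π x - windowWave R π₀ x‖ ≤ 2 :=
          (norm_sub_le _ _).trans (by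
            linarith [norm_windowWave_le R π x, norm_windowWave_le R π₀ x])
        have h3 : ‖windowWave R π x - windowWave R π₀ x‖ₑ ≤ 2 := by
          rw [← ofReal_norm]
          exact (ENNReal.ofReal_le_ofReal h2).trans (by simp)
        exact (pow_le_pow_left' h3 2).trans (by norm_num)
      · rw [windowWave_eq_zero (R := R) (π := π), windowWave_eq_zero (R := R) (π := π₀)]
        · simp
        · intro hx'
          exact hx (Metric.closedBall_subset_closedBall (by linarith) hx')
        · intro hx'
          apply hx
          rw [Metric.mem_closedBall] at hx' ⊢
          have h4 : dist π.1 π₀.1 ≤ 1 :=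
            (le_max_left (dist π.1 π₀.1) (dist π.2 π₀.2)).trans (Metric.mem_ball.1 hπ).le
          linarith [dist_triangle x π.1 π₀.1]
    · rw [lintegral_indicator Metric.isClosed_closedBall.measurableSet,
        lintegral_const_mul' _ _ (by norm_num)]
      refine ENNReal.mul_ne_top (by norm_num) ((hn h π₀.1).trans_lt ?_).ne
      exact ENNReal.mul_lt_top (ENNReal.natCast_lt_top n) (ENNReal.pow_lt_top hh.2)
    · refine Filter.Eventually.of_forall fun x => ?_
      have hc : Continuous fun π : Eu d × Eu d =>
          ‖h x * windowWave R π x - h x * windowWave R π₀ x‖ₑ ^ 2 := by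
        have h1 : Continuous fun π : Eu d × Eu d => windowWave R π x :=
          (continuous_windowWave R).comp (f := fun π : Eu d × Eu d => (π, x)) (by fun_prop)
        exact (ENNReal.continuous_pow 2).comp ((continuous_const.mul h1).sub continuous_const).enorm
      have := hc.tendsto π₀
      simpa using this
  rw [lintegral_zero] at hlim
  have := (ENNReal.continuous_rpow_const (y := (1 / 2 : ℝ))).tendsto 0 |>.comp hlim
  rw [ENNReal.zero_rpow_of_pos (by norm_num)] at this
  exact this

theorem enorm_windowVec_le {R : ℝ} {n : ℕ} {h : Eu d → ℂ} (hh : MemLattice h)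
    (hn : ∀ X : Eu d, ∫⁻ x in Metric.closedBall X (R + 1), ‖h x‖ₑ ^ 2 ≤ n * latticeNorm h ^ 2)
    (π : Eu d × Eu d) : ‖windowVec hh R π‖ₑ ≤ ENNReal.ofReal (Real.sqrt n) * latticeNorm h := by
  rw [windowVec, Lp.enorm_toLp]
  exact eLpNorm_mul_windowWave_le hn π

/-- A function with finite lattice norm is square integrable with a decaying weight: average the
bound over unit balls. -/
theorem lintegral_sq_mul_weight_lt_top {h : Eu d → ℂ} (hh : MemLattice h) :
    ∫⁻ y, ‖h y‖ₑ ^ 2 * ENNReal.ofReal ((1 + ‖y‖) ^ (-((d + 1 : ℕ) : ℝ))) < ∞ := by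
  obtain ⟨n, hn⟩ := exists_setLIntegral_closedBall_le d 1
  set w : Eu d → ℝ≥0∞ := fun y => ENNReal.ofReal ((1 + ‖y‖) ^ (-((d + 1 : ℕ) : ℝ))) with hw
  have hwm : Measurable w := by
    refine ENNReal.measurable_ofReal.comp (Measurable.pow_const ?_ _)
    fun_prop
  have hwi : ∫⁻ y, w y < ∞ := by
    have h0 : Integrable (fun x : Eu d => (1 + ‖x‖) ^ (-((d + 1 : ℕ) : ℝ))) :=
      integrable_one_add_norm (by simp)
    exact h0.lintegral_lt_top
  have hwle : ∀ a y : Eu d, y ∈ Metric.closedBall a 1 → w y ≤ 2 ^ (d + 1) * w a := by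
    intro a y hy
    have h1 : ‖a‖ ≤ ‖y‖ + 1 := by
      rw [Metric.mem_closedBall, dist_comm, dist_eq_norm] at hy
      have := norm_le_norm_add_norm_sub' a y
      linarith
    have h2 : (2 : ℝ≥0∞) ^ (d + 1) = ENNReal.ofReal (2 ^ (d + 1)) := by
      rw [ENNReal.ofReal_pow (by norm_num)]; simp
    simp only [hw]
    rw [h2, ← ENNReal.ofReal_mul (by positivity)]
    refine ENNReal.ofReal_le_ofReal ?_
    have hy0 := norm_nonneg y
    have ha0 := norm_nonneg a
    rw [Real.rpow_neg (by positivity), Real.rpow_neg (by positivity), Real.rpow_natCast,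
      Real.rpow_natCast, ← div_eq_mul_inv, inv_eq_one_div,
      div_le_div_iff₀ (by positivity) (by positivity), one_mul, ← mul_pow]
    gcongr
    linarith
  set V := volume (Metric.closedBall (0 : Eu d) 1)
  have hV : V ≠ 0 := (Metric.measure_closedBall_pos volume _ zero_lt_one).ne'
  have hV' : V ≠ ∞ := (isCompact_closedBall (0 : Eu d) 1).measure_lt_top.ne
  have hmeas : AEMeasurable (fun q : Eu d × Eu d =>
      {r : Eu d × Eu d | dist r.2 r.1 ≤ 1}.indicator (fun r => ‖h r.2‖ₑ ^ 2 * w r.2) q)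
      (volume.prod volume) := by
    refine AEMeasurable.indicator ?_ (measurableSet_le (by fun_prop) (by fun_prop))
    exact (((hh.1.enorm.pow_const 2).mul hwm.aemeasurable)).comp_snd
  have hswap := lintegral_lintegral_swap (f := fun a y : Eu d =>
    {r : Eu d × Eu d | dist r.2 r.1 ≤ 1}.indicator (fun r => ‖h r.2‖ₑ ^ 2 * w r.2) (a, y)) hmeas
  have hL : ∀ a : Eu d, ∫⁻ y, {r : Eu d × Eu d | dist r.2 r.1 ≤ 1}.indicator
      (fun r => ‖h r.2‖ₑ ^ 2 * w r.2) (a, y) ≤ n * latticeNorm h ^ 2 * 2 ^ (d + 1) * w a := by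
    intro a
    calc _ ≤ ∫⁻ y in Metric.closedBall a 1, ‖h y‖ₑ ^ 2 * (2 ^ (d + 1) * w a) := by
          rw [← lintegral_indicator Metric.isClosed_closedBall.measurableSet]
          refine lintegral_mono fun y => ?_
          by_cases hy : y ∈ Metric.closedBall a 1
          · rw [Set.indicator_of_mem hy, Set.indicator_of_mem (show (a, y) ∈
              {r : Eu d × Eu d | dist r.2 r.1 ≤ 1} from hy)]
            exact mul_le_mul_right (hwle a y hy) _
          · rw [Set.indicator_of_notMem (show (a, y) ∉
              {r : Eu d × Eu d | dist r.2 r.1 ≤ 1} from hy)]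
            exact zero_le
      _ = (∫⁻ y in Metric.closedBall a 1, ‖h y‖ₑ ^ 2) * (2 ^ (d + 1) * w a) :=
          lintegral_mul_const' _ _ (ENNReal.mul_ne_top (by simp) ENNReal.ofReal_ne_top)
      _ ≤ n * latticeNorm h ^ 2 * (2 ^ (d + 1) * w a) := by gcongr; exact hn h a
      _ = _ := by ring
  have hR : ∀ y : Eu d, ∫⁻ a, {r : Eu d × Eu d | dist r.2 r.1 ≤ 1}.indicator
      (fun r => ‖h r.2‖ₑ ^ 2 * w r.2) (a, y) = ‖h y‖ₑ ^ 2 * w y * V := by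
    intro y
    have : (fun a : Eu d => {r : Eu d × Eu d | dist r.2 r.1 ≤ 1}.indicator
        (fun r => ‖h r.2‖ₑ ^ 2 * w r.2) (a, y)) =
        (Metric.closedBall y 1).indicator fun _ => ‖h y‖ₑ ^ 2 * w y := by
      funext a
      by_cases ha : a ∈ Metric.closedBall y 1
      · rw [Set.indicator_of_mem ha, Set.indicator_of_mem]
        simpa [dist_comm] using ha
      · rw [Set.indicator_of_notMem ha, Set.indicator_of_notMem]
        simpa [dist_comm] using ha
    rw [this, lintegral_indicator Metric.isClosed_closedBall.measurableSet, setLIntegral_const,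
      Measure.addHaar_closedBall_center]
  simp only [hR] at hswap
  rw [lintegral_mul_const' _ _ hV'] at hswap
  have hfin : (∫⁻ y, ‖h y‖ₑ ^ 2 * w y) * V < ∞ := by
    rw [← hswap]
    refine (lintegral_mono hL).trans_lt ?_
    rw [lintegral_const_mul _ hwm]
    refine ENNReal.mul_lt_top (ENNReal.mul_lt_top (ENNReal.mul_lt_top (ENNReal.natCast_lt_top n)
      (ENNReal.pow_lt_top hh.2)) ?_) hwi
    exact ENNReal.pow_lt_top (by simp)
  by_contra hne
  rw [not_lt, top_le_iff] at hne
  rw [hne, ENNReal.top_mul hV] at hfin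
  exact lt_irrefl _ hfin

/-- A function with finite lattice norm is integrable against a factor of decay `(1 + |y|)^{-d-1}`,
by `|h| ≤ 1 + |h|²`. -/
theorem MemLattice.integrable_mul {h g : Eu d → ℂ} (hh : MemLattice h)
    (hg : AEStronglyMeasurable g volume) {K : ℝ}
    (hK : ∀ y, ‖g y‖ ≤ K * (1 + ‖y‖) ^ (-((d + 1 : ℕ) : ℝ))) :
    Integrable fun y => h y * g y := by
  refine ⟨hh.1.mul hg, ?_⟩
  have h0 : Integrable (fun x : Eu d => (1 + ‖x‖) ^ (-((d + 1 : ℕ) : ℝ))) :=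
    integrable_one_add_norm (by simp)
  set w : Eu d → ℝ≥0∞ := fun y => ENNReal.ofReal ((1 + ‖y‖) ^ (-((d + 1 : ℕ) : ℝ))) with hw
  have hwm : Measurable w := by
    refine ENNReal.measurable_ofReal.comp (Measurable.pow_const ?_ _)
    fun_prop
  have hKnn : 0 ≤ K := by
    have := (norm_nonneg _).trans (hK 0)
    simpa using this
  rw [HasFiniteIntegral]
  have hpt : ∀ y, ‖h y * g y‖ₑ ≤ ENNReal.ofReal K * (w y + ‖h y‖ₑ ^ 2 * w y) := by
    intro y
    have h1 : ‖g y‖ₑ ≤ ENNReal.ofReal K * w y := by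
      rw [← ofReal_norm, ← ENNReal.ofReal_mul hKnn]
      exact ENNReal.ofReal_le_ofReal (hK y)
    have h2 : ‖h y‖ₑ ≤ 1 + ‖h y‖ₑ ^ 2 := by
      rcases le_total ‖h y‖ₑ 1 with h3 | h3
      · exact h3.trans le_self_add
      · refine le_trans ?_ le_add_self
        rw [sq]
        exact le_mul_of_one_le_left' h3
    calc ‖h y * g y‖ₑ = ‖h y‖ₑ * ‖g y‖ₑ := enorm_mul _ _
      _ ≤ (1 + ‖h y‖ₑ ^ 2) * (ENNReal.ofReal K * w y) := mul_le_mul' h2 h1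
      _ = _ := by ring
  refine (lintegral_mono hpt).trans_lt ?_
  rw [lintegral_const_mul' _ _ ENNReal.ofReal_ne_top, lintegral_add_left hwm]
  exact ENNReal.mul_lt_top ENNReal.ofReal_lt_top
    (ENNReal.add_lt_top.2 ⟨h0.lintegral_lt_top, lintegral_sq_mul_weight_lt_top hh⟩)

theorem exists_norm_mul_one_add_le (u : 𝓢(Eu d, ℂ)) (k : ℕ) :
    ∃ K : ℝ, ∀ y, ‖u y‖ * (1 + ‖y‖) ^ k ≤ K * (1 + ‖y‖) ^ (-((d + 1 : ℕ) : ℝ)) := by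
  refine ⟨2 ^ (k + (d + 1)) * ((Finset.Iic (k + (d + 1), 0)).sup
    (fun m => SchwartzMap.seminorm ℂ m.1 m.2)) u, fun y => ?_⟩
  have h := SchwartzMap.one_add_le_sup_seminorm_apply (𝕜 := ℂ) (m := (k + (d + 1), 0))
    (le_refl (k + (d + 1))) (le_refl 0) u y
  rw [norm_iteratedFDeriv_zero] at h
  have hy := norm_nonneg y
  rw [Real.rpow_neg (by positivity), Real.rpow_natCast, ← div_eq_mul_inv,
    le_div_iff₀ (by positivity), mul_assoc, ← pow_add, mul_comm]
  exact h

/-- A function with finite lattice norm times a Schwartz function times a polynomial weight is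
integrable. -/
theorem MemLattice.integrable_mul_schwartz {h : Eu d → ℂ} (hh : MemLattice h) (u : 𝓢(Eu d, ℂ))
    (k : ℕ) : Integrable fun y => h y * (u y * (((1 + ‖y‖) ^ k : ℝ) : ℂ)) := by
  obtain ⟨K, hK⟩ := exists_norm_mul_one_add_le u k
  refine hh.integrable_mul (Continuous.aestronglyMeasurable ?_) (K := K) fun y => ?_
  · have := u.continuous
    fun_prop
  · rw [norm_mul, Complex.norm_real, Real.norm_of_nonneg (by positivity)]
    exact hK y

theorem MemLattice.conj {h : Eu d → ℂ} (hh : MemLattice h) :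
    MemLattice fun y => (starRingEnd ℂ) (h y) := by
  refine ⟨Complex.continuous_conj.comp_aestronglyMeasurable hh.1, ?_⟩
  simpa [latticeNorm] using hh.2

theorem latticeNorm_conj (h : Eu d → ℂ) :
    latticeNorm (fun y => (starRingEnd ℂ) (h y)) = latticeNorm h := by
  simp [latticeNorm]

/-- Pointwise values of a Bochner integral in `L²`: both sides have the same integrals over all sets
of finite measure. -/
theorem coeFn_integral_L2 {Θ : Type*} [MeasurableSpace Θ] {μ : Measure Θ} [SigmaFinite μ]
    {G : Θ → L2 d} (hG : Integrable G μ) {Φ : Θ × Eu d → ℂ}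
    (hΦ : AEStronglyMeasurable Φ (μ.prod volume))
    (hGΦ : ∀ θ, G θ =ᵐ[volume] fun x => Φ (θ, x)) :
    (∫ θ, G θ ∂μ : L2 d) =ᵐ[volume] fun x => ∫ θ, Φ (θ, x) ∂μ := by
  have hS : ∀ S : Set (Eu d), MeasurableSet S → volume S < ∞ →
      Integrable Φ (μ.prod (volume.restrict S)) := by
    intro S hS hSfin
    have hm : AEStronglyMeasurable Φ (μ.prod (volume.restrict S)) :=
      hΦ.mono_ac (Measure.AbsolutelyContinuous.rfl.prod Measure.absolutelyContinuous_restrict)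
    have : IsFiniteMeasure (volume.restrict S) := ⟨by simpa using hSfin⟩
    have hGi : ∀ θ, Integrable (G θ) (volume.restrict S) := fun θ =>
      ((Lp.memLp (G θ)).restrict S).integrable (by norm_num)
    rw [integrable_prod_iff hm]
    refine ⟨Filter.Eventually.of_forall fun θ =>
      (hGi θ).congr (ae_restrict_of_ae (hGΦ θ)), ?_⟩
    refine Integrable.mono' (hG.norm.mul_const ((volume S).toReal ^ (1 / 2 : ℝ)))
      hm.norm.integral_prod_right' (Filter.Eventually.of_forall fun θ => ?_)
    rw [Real.norm_of_nonneg (integral_nonneg fun _ => norm_nonneg _)]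
    have h1 : ∫ x in S, ‖Φ (θ, x)‖ = ∫ x in S, ‖G θ x‖ :=
      integral_congr_ae ((ae_restrict_of_ae (hGΦ θ)).mono fun x hx => by simp only [hx])
    rw [h1, integral_norm_eq_lintegral_enorm (hGi θ).1, ← eLpNorm_one_eq_lintegral_enorm]
    have h2 := eLpNorm_le_eLpNorm_mul_rpow_measure_univ (p := 1) (q := 2) (by norm_num) (hGi θ).1
    have h3 : eLpNorm (G θ) 2 (volume.restrict S) ≤ eLpNorm (G θ) 2 volume :=
      eLpNorm_mono_measure _ Measure.restrict_le_self
    have h4 : eLpNorm (G θ) 1 (volume.restrict S) ≤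
        eLpNorm (G θ) 2 volume * (volume S) ^ (1 / 2 : ℝ) := by
      refine h2.trans ?_
      rw [Measure.restrict_apply_univ]
      have : (1 / (1 : ℝ≥0∞).toReal - 1 / (2 : ℝ≥0∞).toReal) = (1 / 2 : ℝ) := by norm_num
      rw [this]
      gcongr
    have h5 := ENNReal.toReal_mono (ENNReal.mul_ne_top (Lp.eLpNorm_ne_top (G θ))
      (ENNReal.rpow_ne_top_of_nonneg (by norm_num) hSfin.ne)) h4
    rwa [ENNReal.toReal_mul, ← ENNReal.toReal_rpow, ← Lp.norm_def] at h5
  refine ae_eq_of_forall_setIntegral_eq_of_sigmaFinite ?_ ?_ ?_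
  · intro S _ hSfin
    have : IsFiniteMeasure (volume.restrict S) := ⟨by simpa using hSfin⟩
    exact ((Lp.memLp _).restrict S).integrable (by norm_num)
  · intro S hSm hSfin
    exact (hS S hSm hSfin).integral_prod_right
  · intro S hSm hSfin
    rw [← L2.inner_indicatorConstLp_one hSm hSfin.ne, ← integral_inner hG,
      integral_integral_swap (f := fun x θ => Φ (θ, x)) (hS S hSm hSfin).swap]
    refine integral_congr_ae (Filter.Eventually.of_forall fun θ => ?_)
    simp only
    rw [L2.inner_indicatorConstLp_one]
    exact integral_congr_ae (ae_restrict_of_ae (hGΦ θ))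

end Lattice

/-! ### The operator -/

section Assembly

variable {d : ℕ}

theorem conj_phase (r : ℝ) : (starRingEnd ℂ) (phase r) = phase (-r) := by
  rw [phase, phase, ← Complex.exp_conj]
  simp

/-- The point `(w, z) = (t₁₁ x + t₁₂ y, t₂₁ x + t₂₂ y)`. -/
def linPair (T : Matrix (Fin 2) (Fin 2) ℝ) (x y : Eu d) : Eu d × Eu d :=
  (T 0 0 • x + T 0 1 • y, T 1 0 • x + T 1 1 • y)

theorem linPair_snd_sub {T : Matrix (Fin 2) (Fin 2) ℝ} (hT : T 0 0 + T 0 1 = 1) (x y : Eu d) :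
    (linPair T x y).2 - (T 1 0 + T 1 1) • (linPair T x y).1 = T.det • (y - x) := by
  have h : T 0 1 = 1 - T 0 0 := by linarith
  rw [Matrix.det_fin_two, linPair, h]
  module

theorem inner_sub_eq_offDiagForm {T : Matrix (Fin 2) (Fin 2) ℝ} (hT : T 0 0 + T 0 1 = 1)
    (hdet : T.det ≠ 0) (x y e : Eu d) :
    ⟪x - y, e⟫_ℝ = offDiagForm (T 1 0 + T 1 1) T.det e (linPair T x y) := by
  rw [offDiagForm_apply, linPair_snd_sub hT, real_inner_smul_left, ← neg_sub y x, inner_neg_left]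
  field_simp

/-- The parameters of the wave in `x` attached to `((c, ξ), (η, μ))`: its centre is the
`x`-component of the preimage of `c`. -/
def leftParam (T : Matrix (Fin 2) (Fin 2) ℝ) (α : ℝ)
    (θ : ((Eu d × Eu d) × Eu d) × (Eu d × Eu d)) : Eu d × Eu d :=
  (T.det⁻¹ • (T 1 1 • θ.1.1.1 - T 0 1 • θ.1.1.2),
    α • θ.1.2 + (2 * Real.pi) • (T 0 0 • θ.2.1 + T 1 0 • θ.2.2))

/-- The parameters of the wave in `y` attached to `((c, ξ), (η, μ))`. The wave enters through its
complex conjugate. -/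
def rightParam (T : Matrix (Fin 2) (Fin 2) ℝ) (α : ℝ)
    (θ : ((Eu d × Eu d) × Eu d) × (Eu d × Eu d)) : Eu d × Eu d :=
  (T.det⁻¹ • (T 0 0 • θ.1.1.2 - T 1 0 • θ.1.1.1),
    α • θ.1.2 - (2 * Real.pi) • (T 0 1 • θ.2.1 + T 1 1 • θ.2.2))

theorem continuous_leftParam (T : Matrix (Fin 2) (Fin 2) ℝ) (α : ℝ) :
    Continuous (leftParam T α : ((Eu d × Eu d) × Eu d) × (Eu d × Eu d) → _) := by
  unfold leftParam; fun_prop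

theorem continuous_rightParam (T : Matrix (Fin 2) (Fin 2) ℝ) (α : ℝ) :
    Continuous (rightParam T α : ((Eu d × Eu d) × Eu d) × (Eu d × Eu d) → _) := by
  unfold rightParam; fun_prop

/-- The product of the two cutoffs, as a function of the centre `c` of the localisation. -/
def pairWindow (T : Matrix (Fin 2) (Fin 2) ℝ) (R : ℝ) (x y : Eu d) (c : Eu d × Eu d) : ℂ :=
  (ballWindow R (x - T.det⁻¹ • (T 1 1 • c.1 - T 0 1 • c.2)) : ℂ) *
    (ballWindow R (y - T.det⁻¹ • (T 0 0 • c.2 - T 1 0 • c.1)) : ℂ)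

theorem continuous_pairWindow (T : Matrix (Fin 2) (Fin 2) ℝ) (R : ℝ) (x y : Eu d) :
    Continuous (pairWindow T R x y) :=
  (Complex.continuous_ofReal.comp ((continuous_ballWindow R).comp (by fun_prop))).mul
    (Complex.continuous_ofReal.comp ((continuous_ballWindow R).comp (by fun_prop)))

theorem norm_pairWindow_le (T : Matrix (Fin 2) (Fin 2) ℝ) (R : ℝ) (x y : Eu d) (c : Eu d × Eu d) :
    ‖pairWindow T R x y c‖ ≤ 1 := by
  rw [pairWindow, norm_mul, Complex.norm_real, Complex.norm_real]
  exact mul_le_one₀ (abs_ballWindow_le _ _) (norm_nonneg _) (abs_ballWindow_le _ _)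

theorem norm_inv_smul_sub_le {t₀ δ₀ δ a b : ℝ} (hδ₀ : 0 < δ₀) (hδ : δ₀ ≤ |δ|) (ha : |a| ≤ t₀)
    (hb : |b| ≤ t₀) {u v : Eu d} (hu : ‖u‖ ≤ 1) (hv : ‖v‖ ≤ 1) :
    ‖δ⁻¹ • (a • u - b • v)‖ ≤ 2 * t₀ / δ₀ := by
  rw [norm_smul, norm_inv, Real.norm_eq_abs, ← div_eq_inv_mul]
  have h : ‖a • u - b • v‖ ≤ 2 * t₀ := by
    refine (norm_sub_le _ _).trans ?_
    rw [norm_smul, norm_smul, Real.norm_eq_abs, Real.norm_eq_abs]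
    nlinarith [abs_nonneg a, abs_nonneg b, norm_nonneg u, norm_nonneg v]
  have ht : 0 ≤ t₀ := (abs_nonneg a).trans ha
  gcongr

/-- If `(w, z)` is in the unit ball around `c`, then `x` and `y` are within `2 t₀ / δ₀` of the
preimage of `c`, and the cutoffs are one. -/
theorem pairWindow_eq_one {T : Matrix (Fin 2) (Fin 2) ℝ} {t₀ δ₀ : ℝ} (hδ₀ : 0 < δ₀)
    (hT : ∀ j k, |T j k| ≤ t₀) (hdet : δ₀ ≤ |T.det|) (x y : Eu d) (c : Eu d × Eu d)
    (hc : linPair T x y ∈ Metric.closedBall c 1) : pairWindow T (2 * t₀ / δ₀) x y c = 1 := by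
  have hne : T.det ≠ 0 := abs_pos.1 (hδ₀.trans_le hdet)
  rw [mem_closedBall_iff_norm] at hc
  have h1 : ‖(linPair T x y).1 - c.1‖ ≤ 1 := (norm_fst_le (linPair T x y - c)).trans hc
  have h2 : ‖(linPair T x y).2 - c.2‖ ≤ 1 := (norm_snd_le (linPair T x y - c)).trans hc
  have hx : x - T.det⁻¹ • (T 1 1 • c.1 - T 0 1 • c.2) = T.det⁻¹ •
      (T 1 1 • ((linPair T x y).1 - c.1) - T 0 1 • ((linPair T x y).2 - c.2)) := by
    have h3 : x = T.det⁻¹ • (T 1 1 • (linPair T x y).1 - T 0 1 • (linPair T x y).2) := by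
      have h4 : T 1 1 • (linPair T x y).1 - T 0 1 • (linPair T x y).2 = T.det • x := by
        rw [Matrix.det_fin_two, linPair]; module
      rw [h4, inv_smul_smul₀ hne]
    nth_rewrite 1 [h3]
    module
  have hy : y - T.det⁻¹ • (T 0 0 • c.2 - T 1 0 • c.1) = T.det⁻¹ •
      (T 0 0 • ((linPair T x y).2 - c.2) - T 1 0 • ((linPair T x y).1 - c.1)) := by
    have h3 : y = T.det⁻¹ • (T 0 0 • (linPair T x y).2 - T 1 0 • (linPair T x y).1) := by
      have h4 : T 0 0 • (linPair T x y).2 - T 1 0 • (linPair T x y).1 = T.det • y := by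
        rw [Matrix.det_fin_two, linPair]; module
      rw [h4, inv_smul_smul₀ hne]
    nth_rewrite 1 [h3]
    module
  rw [pairWindow, hx, hy,
    ballWindow_eq_one (norm_inv_smul_sub_le hδ₀ hdet (hT 1 1) (hT 0 1) h1 h2),
    ballWindow_eq_one (norm_inv_smul_sub_le hδ₀ hdet (hT 0 0) (hT 1 0) h2 h1)]
  simp

/-- Plane waves in `(w, z)` factor into a function of `x` and a function of `y`. -/
theorem windowWave_mul_conj (T : Matrix (Fin 2) (Fin 2) ℝ) (α R : ℝ)
    (θ : ((Eu d × Eu d) × Eu d) × (Eu d × Eu d)) (x y : Eu d) :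
    windowWave R (leftParam T α θ) x * (starRingEnd ℂ) (windowWave R (rightParam T α θ) y) =
      pairWindow T R x y θ.1.1 * phase (α * ⟪x - y, θ.1.2⟫_ℝ) *
        phase (2 * Real.pi * (⟪θ.2.1, (linPair T x y).1⟫_ℝ + ⟪θ.2.2, (linPair T x y).2⟫_ℝ)) := by
  have hph : phase ⟪(leftParam T α θ).2, x⟫_ℝ * phase (-⟪(rightParam T α θ).2, y⟫_ℝ) =
      phase (α * ⟪x - y, θ.1.2⟫_ℝ) *
        phase (2 * Real.pi * (⟪θ.2.1, (linPair T x y).1⟫_ℝ + ⟪θ.2.2, (linPair T x y).2⟫_ℝ)) := by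
    rw [← phase_add, ← phase_add]
    congr 1
    simp only [leftParam, rightParam, linPair, inner_add_left, inner_sub_left, inner_add_right,
      real_inner_smul_left, real_inner_smul_right]
    rw [real_inner_comm θ.1.2 x, real_inner_comm θ.1.2 y]
    ring
  rw [windowWave, windowWave, map_mul, Complex.conj_ofReal, conj_phase, pairWindow]
  rw [mul_assoc _ (phase (α * _)), ← hph]
  simp only [leftParam, rightParam]
  ring

variable {p : Amplitude d} {m : ℕ} {C : ℝ} {T : Matrix (Fin 2) (Fin 2) ℝ}

/-- Pointwise bound for the amplitude in terms of the local mass of its derivatives. -/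
theorem norm_amplitude_le {τ δ : ℝ} (hp : Smooth p.uncurry)
    (hJ : ∀ b : ℕ → ℂ, (∀ l, ‖b l‖ ≤ 2 ^ m) → HasJetBound τ δ (d + 1) m p b C)
    (v : Eu d × Eu d) (ξ : Eu d) :
    ‖p v.1 v.2 ξ‖ ≤ ‖pairCutoff d 0‖⁻¹ * (1 + |δ|⁻¹ * ‖v.2 - τ • v.1‖) ^ m *
      (4 * (C * localMass p τ (d + 1) m v ξ) * ∫ k : Eu d × Eu d, freqWeight (d + 1) k) := by
  have h := norm_xiOperator_le hp (hJ (fun k => if k = 0 then 1 else 0) fun k => by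
    have h2 : (1 : ℝ) ≤ 2 ^ m := one_le_pow₀ (by norm_num)
    split_ifs
    · simpa using h2
    · simp) (e := 0) (by simp) v ξ
  rw [xiOperator_single p (Nat.zero_le m)] at h
  exact h

theorem integrable_amplitude_slice {τ δ : ℝ} (hp : Smooth p.uncurry)
    (hJ : ∀ b : ℕ → ℂ, (∀ l, ‖b l‖ ≤ 2 ^ m) → HasJetBound τ δ (d + 1) m p b C)
    (hi : WeightIntegrable p τ (d + 1) m) (v : Eu d × Eu d) :
    Integrable fun ξ => p v.1 v.2 ξ := by
  refine Integrable.mono' (g := fun ξ => ‖pairCutoff d 0‖⁻¹ *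
      (1 + |δ|⁻¹ * ‖v.2 - τ • v.1‖) ^ m *
      (4 * (C * localMass p τ (d + 1) m v ξ) * ∫ k : Eu d × Eu d, freqWeight (d + 1) k)) ?_ ?_
    (Filter.Eventually.of_forall fun ξ => norm_amplitude_le hp hJ v ξ)
  · exact ((((integrable_localMass_slice hi v).1.const_mul C).const_mul 4).mul_const _).const_mul _
  · exact (hp.continuous.comp (f := fun ξ => (v.1, v.2, ξ)) (by fun_prop)).aestronglyMeasurable

/-- The amplitude is integrable in `ξ`, with polynomial growth off the diagonal; the Schwartz
function absorbs it. -/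
theorem integral_norm_amplitude_le {τ δ : ℝ} (hp : Smooth p.uncurry) (hC : 0 ≤ C)
    (hJ : ∀ b : ℕ → ℂ, (∀ l, ‖b l‖ ≤ 2 ^ m) → HasJetBound τ δ (d + 1) m p b C)
    (hi : WeightIntegrable p τ (d + 1) m) :
    ∃ K : ℝ, 0 ≤ K ∧ ∀ v : Eu d × Eu d,
      ∫ ξ, ‖p v.1 v.2 ξ‖ ≤ K * (1 + |δ|⁻¹ * ‖v.2 - τ • v.1‖) ^ m := by
  set κ := ∫ k : Eu d × Eu d, freqWeight (d + 1) k
  set I := ∫ q : (Eu d × Eu d) × Eu d, p.weightedDeriv τ (d + 1) m q.1.1 q.1.2 q.2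
  have hκ : 0 ≤ κ := integral_nonneg fun k => freqWeight_nonneg _ k
  have hI : 0 ≤ I := integral_nonneg fun q => p.weightedDeriv_nonneg _ _ _ _ _ _
  refine ⟨‖pairCutoff d 0‖⁻¹ * (4 * (C * I) * κ), by positivity, fun v => ?_⟩
  have hM := integrable_localMass_slice hi v
  calc ∫ ξ, ‖p v.1 v.2 ξ‖ ≤ ∫ ξ, ‖pairCutoff d 0‖⁻¹ * (1 + |δ|⁻¹ * ‖v.2 - τ • v.1‖) ^ m *
        (4 * (C * localMass p τ (d + 1) m v ξ) * κ) := by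
        refine integral_mono (integrable_amplitude_slice hp hJ hi v).norm ?_
          fun ξ => norm_amplitude_le hp hJ v ξ
        exact (((hM.1.const_mul C).const_mul 4).mul_const _).const_mul _
    _ = ‖pairCutoff d 0‖⁻¹ * (1 + |δ|⁻¹ * ‖v.2 - τ • v.1‖) ^ m *
        (4 * (C * ∫ ξ, localMass p τ (d + 1) m v ξ) * κ) := by
        rw [integral_const_mul, integral_mul_const, integral_const_mul, integral_const_mul]
    _ ≤ ‖pairCutoff d 0‖⁻¹ * (1 + |δ|⁻¹ * ‖v.2 - τ • v.1‖) ^ m * (4 * (C * I) * κ) := by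
        gcongr
        exact hM.2
    _ = _ := by ring

/-- Absolute convergence of the integral that defines the operator. -/
theorem integrable_opIntegrand (hp : Smooth p.uncurry) (hC : 0 ≤ C) (hT : T 0 0 + T 0 1 = 1)
    (hdet : T.det ≠ 0)
    (hJ : ∀ b : ℕ → ℂ, (∀ l, ‖b l‖ ≤ 2 ^ m) →
      HasJetBound (T 1 0 + T 1 1) T.det (d + 1) m p b C)
    (hi : WeightIntegrable p (T 1 0 + T 1 1) (d + 1) m) {h : Eu d → ℂ} (hh : MemLattice h)
    (u : 𝓢(Eu d, ℂ)) (α : ℝ) (x : Eu d) :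
    Integrable (opIntegrand α (p.transform T) (fun y => h y * u y) x) (volume.prod volume) := by
  obtain ⟨K, hK0, hK⟩ := integral_norm_amplitude_le hp hC hJ hi
  have heq : opIntegrand α (p.transform T) (fun y => h y * u y) x = fun q : Eu d × Eu d =>
      phase (α * ⟪x - q.1, q.2⟫_ℝ) * p (linPair T x q.1).1 (linPair T x q.1).2 q.2 *
        (h q.1 * u q.1) := rfl
  have hmeas : AEStronglyMeasurable (opIntegrand α (p.transform T) (fun y => h y * u y) x)
      (volume.prod volume) := by
    rw [heq]
    refine AEStronglyMeasurable.mul (Continuous.aestronglyMeasurable ?_) ?_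
    · refine (continuous_phase.comp (by fun_prop)).mul ?_
      exact hp.continuous.comp (f := fun q : Eu d × Eu d =>
        ((linPair T x q.1).1, (linPair T x q.1).2, q.2)) (by unfold linPair; fun_prop)
    · exact (hh.1.mul u.continuous.aestronglyMeasurable).comp_fst
  have hdist : ∀ y, |T.det|⁻¹ * ‖(linPair T x y).2 - (T 1 0 + T 1 1) • (linPair T x y).1‖ =
      ‖y - x‖ := fun y => by
    rw [linPair_snd_sub hT, norm_smul, Real.norm_eq_abs, inv_mul_cancel_left₀ (abs_ne_zero.2 hdet)]
  rw [integrable_prod_iff hmeas]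
  constructor
  · refine Filter.Eventually.of_forall fun y => ?_
    rw [heq]
    have hr : AEMeasurable (fun ξ : Eu d => α * ⟪x - y, ξ⟫_ℝ) volume := by fun_prop
    exact ((integrable_amplitude_slice hp hJ hi (linPair T x y)).phase_mul hr).mul_const
      (h y * u y)
  -- The growth in `y - x` is split into growth in `x`, which is fixed, and in `y`.
  · refine Integrable.mono' (((hh.integrable_mul_schwartz u m).norm.const_mul
      (K * (1 + ‖x‖) ^ m))) hmeas.norm.integral_prod_right'
      (Filter.Eventually.of_forall fun y => ?_)
    rw [Real.norm_of_nonneg (integral_nonneg fun _ => norm_nonneg _)]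
    simp only [heq, norm_mul, norm_phase, one_mul]
    rw [integral_mul_const, Complex.norm_real, Real.norm_of_nonneg (by positivity)]
    have h1 := hK (linPair T x y)
    rw [hdist] at h1
    have h2 : (1 + ‖y - x‖) ^ m ≤ (1 + ‖x‖) ^ m * (1 + ‖y‖) ^ m := by
      rw [← mul_pow]
      gcongr
      nlinarith [norm_sub_le y x, norm_nonneg x, norm_nonneg y]
    calc (∫ ξ, ‖p (linPair T x y).1 (linPair T x y).2 ξ‖) * (‖h y‖ * ‖u y‖)
        ≤ (K * ((1 + ‖x‖) ^ m * (1 + ‖y‖) ^ m)) * (‖h y‖ * ‖u y‖) := by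
          gcongr
          exact h1.trans (by gcongr)
      _ = _ := by ring

/-- The coefficients of the rank one operators that make up `h₁ Op^a_α(p_T) h₂`. -/
def operatorCoeff (T : Matrix (Fin 2) (Fin 2) ℝ) (m : ℕ) (α : ℝ) (p : Amplitude d)
    (θ : ((Eu d × Eu d) × Eu d) × (Eu d × Eu d)) : ℂ :=
  (((α / (2 * Real.pi)) ^ d : ℝ) : ℂ) *
    kernelCoeff (T 1 0 + T 1 1) T.det m p (ibpCoeff α m) θ

/-- The rank one operators that make up `h₁ Op^a_α(p_T) h₂`. -/
def rankOneFamily (T : Matrix (Fin 2) (Fin 2) ℝ) (m : ℕ) (α R : ℝ) (p : Amplitude d)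
    {h₁ h₂ : Eu d → ℂ} (hh₁ : MemLattice h₁) (hh₂ : MemLattice h₂)
    (θ : ((Eu d × Eu d) × Eu d) × (Eu d × Eu d)) : L2 d →L[ℂ] L2 d :=
  operatorCoeff T m α p θ • InnerProductSpace.rankOne ℂ (windowVec hh₁ R (leftParam T α θ))
    (windowVec hh₂.conj R (rightParam T α θ))

/-- The vectors are bounded in `L²` uniformly in the parameters, so only the coefficients have to be
integrable. -/
theorem integrable_rankOneFamily {R : ℝ} {n : ℕ} {h₁ h₂ : Eu d → ℂ} (hh₁ : MemLattice h₁)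
    (hh₂ : MemLattice h₂) {α : ℝ}
    (hn : ∀ (h : Eu d → ℂ) (X : Eu d),
      ∫⁻ x in Metric.closedBall X (R + 1), ‖h x‖ₑ ^ 2 ≤ n * latticeNorm h ^ 2)
    (hc : Integrable (operatorCoeff T m α p)) :
    Integrable (rankOneFamily T m α R p hh₁ hh₂) := by
  have hcont : Continuous fun θ : ((Eu d × Eu d) × Eu d) × (Eu d × Eu d) =>
      InnerProductSpace.rankOne ℂ (windowVec hh₁ R (leftParam T α θ))
        (windowVec hh₂.conj R (rightParam T α θ)) := by
    simp only [InnerProductSpace.rankOne_def']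
    exact ((ContinuousLinearMap.toSpanSingletonCLE (𝕜 := ℂ) (E := L2 d)).continuous.comp
      ((continuous_windowVec hh₁ R).comp (continuous_leftParam T α))).clm_comp
        ((innerSL ℂ (E := L2 d)).continuous.comp
          ((continuous_windowVec hh₂.conj R).comp (continuous_rightParam T α)))
  set B₁ := (ENNReal.ofReal (Real.sqrt n) * latticeNorm h₁).toReal
  set B₂ := (ENNReal.ofReal (Real.sqrt n) * latticeNorm fun y => (starRingEnd ℂ) (h₂ y)).toReal
  have hb : ∀ {h : Eu d → ℂ} (hh : MemLattice h) (π : Eu d × Eu d), ‖windowVec hh R π‖ ≤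
      (ENNReal.ofReal (Real.sqrt n) * latticeNorm h).toReal := fun hh π => by
    rw [← toReal_enorm]
    exact ENNReal.toReal_mono (ENNReal.mul_ne_top ENNReal.ofReal_ne_top hh.2.ne)
      (enorm_windowVec_le hh (hn _) π)
  refine (hc.norm.mul_const (B₁ * B₂)).mono' (hc.1.smul hcont.aestronglyMeasurable)
    (Filter.Eventually.of_forall fun θ => ?_)
  rw [rankOneFamily, norm_smul, InnerProductSpace.norm_rankOne]
  have h1 := hb hh₁ (leftParam T α θ)
  have h2 := hb hh₂.conj (rightParam T α θ)
  gcongr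

theorem inner_windowVec_toLp {R : ℝ} {h : Eu d → ℂ} (hh : MemLattice h) (π : Eu d × Eu d)
    (u : 𝓢(Eu d, ℂ)) : ⟪windowVec hh.conj R π, u.toLp 2 volume⟫_ℂ =
      ∫ y, h y * u y * (starRingEnd ℂ) (windowWave R π y) := by
  rw [L2.inner_def]
  refine integral_congr_ae ?_
  filter_upwards [coeFn_windowVec hh.conj R π, u.coeFn_toLp 2 volume] with y h1 h2
  rw [h1, h2, RCLike.inner_apply, map_mul, Complex.conj_conj]
  ring

/-- The kernel of the operator as a superposition of products of functions of `x` and of `y`. -/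
theorem integral_windowWave_kernelCoeff {t₀ δ₀ : ℝ} (hδ₀ : 0 < δ₀) (hTe : ∀ j k, |T j k| ≤ t₀)
    (hdet : δ₀ ≤ |T.det|) (hT : T 0 0 + T 0 1 = 1) (hp : Smooth p.uncurry)
    (hJ : ∀ b : ℕ → ℂ, (∀ l, ‖b l‖ ≤ 2 ^ m) →
      HasJetBound (T 1 0 + T 1 1) T.det (d + 1) m p b C)
    (hi : WeightIntegrable p (T 1 0 + T 1 1) (d + 1) m) {α : ℝ} (hα : 1 ≤ α) (x y : Eu d) :
    ∫ θ, (windowWave (2 * t₀ / δ₀) (leftParam T α θ) x * (starRingEnd ℂ)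
        (windowWave (2 * t₀ / δ₀) (rightParam T α θ) y)) *
        kernelCoeff (T 1 0 + T 1 1) T.det m p (ibpCoeff α m) θ =
      ∫ ξ, phase (α * ⟪x - y, ξ⟫_ℝ) * p (linPair T x y).1 (linPair T x y).2 ξ := by
  rw [← integral_kernelCoeff hp hα hJ hi (x - y) (linPair T x y)
    (inner_sub_eq_offDiagForm hT (abs_pos.1 (hδ₀.trans_le hdet)) x y)
    (continuous_pairWindow T (2 * t₀ / δ₀) x y).measurable
    (norm_pairWindow_le T _ x y) (pairWindow_eq_one hδ₀ hTe hdet x y)]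
  refine integral_congr_ae (Filter.Eventually.of_forall fun θ => ?_)
  simp only [windowWave_mul_conj]
  ring

section Generic

variable {Θ : Type*} [MeasurableSpace Θ] {μ : Measure Θ} {P Q : Θ → Eu d × Eu d} {F : Θ → ℂ}

theorem measurable_windowWave (R : ℝ) (hP : Measurable P) {X : Θ → Eu d} (hX : Measurable X) :
    Measurable fun θ => windowWave R (P θ) (X θ) :=
  Measurable.comp (g := fun q : (Eu d × Eu d) × Eu d => windowWave R q.1 q.2)
    (f := fun θ => (P θ, X θ)) (continuous_windowWave R).measurable (hP.prodMk hX)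

theorem integrable_windowWave_mul [SFinite μ] {R : ℝ} (hP : Measurable P) (hQ : Measurable Q)
    (hF : Integrable F μ) {g : Eu d → ℂ} (hg : Integrable g) (x : Eu d) :
    Integrable (fun q : Θ × Eu d => (windowWave R (P q.1) x * (starRingEnd ℂ)
      (windowWave R (Q q.1) q.2)) * (F q.1 * g q.2)) (μ.prod volume) := by
  refine (hF.mul_prod hg).bdd_mul (c := 1) (Measurable.aestronglyMeasurable ?_)
    (Filter.Eventually.of_forall fun q => ?_)
  · refine Measurable.mul ?_ (Complex.continuous_conj.measurable.comp ?_)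
    · exact measurable_windowWave R (hP.comp measurable_fst) measurable_const
    · exact measurable_windowWave R (hQ.comp measurable_fst) measurable_snd
  · rw [norm_mul, RCLike.norm_conj]
    exact mul_le_one₀ (norm_windowWave_le _ _ _) (norm_nonneg _) (norm_windowWave_le _ _ _)

theorem integral_inner_windowVec_mul [SFinite μ] {R : ℝ} (hP : Measurable P) (hQ : Measurable Q)
    (hF : Integrable F μ) {h : Eu d → ℂ} (hh : MemLattice h) (u : 𝓢(Eu d, ℂ)) (x : Eu d)
    (a : ℂ) :
    ∫ θ, F θ * (⟪windowVec hh.conj R (Q θ), u.toLp 2 volume⟫_ℂ * (a * windowWave R (P θ) x)) ∂μ =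
      a * ∫ y, (∫ θ, (windowWave R (P θ) x * (starRingEnd ℂ) (windowWave R (Q θ) y)) * F θ ∂μ) *
        (h y * u y) := by
  have h0 : Integrable fun y => h y * u y := by
    simpa using hh.integrable_mul_schwartz u 0
  have h1 : ∀ θ, F θ *
      (⟪windowVec hh.conj R (Q θ), u.toLp 2 volume⟫_ℂ * (a * windowWave R (P θ) x)) =
      a * ∫ y, (windowWave R (P θ) x * (starRingEnd ℂ) (windowWave R (Q θ) y)) *
        (F θ * (h y * u y)) := by
    intro θ
    rw [inner_windowVec_toLp hh, ← integral_mul_const, ← integral_const_mul,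
      ← integral_const_mul]
    refine integral_congr_ae (Filter.Eventually.of_forall fun y => ?_)
    simp only
    ring
  simp only [h1]
  rw [integral_const_mul, integral_integral_swap (integrable_windowWave_mul hP hQ hF h0 x)]
  congr 1
  refine integral_congr_ae (Filter.Eventually.of_forall fun y => ?_)
  simp only
  rw [← integral_mul_const]
  simp only [mul_assoc]

/-- The value of a superposition of rank one operators at a Schwartz function. -/
theorem coeFn_integral_rankOne_windowVec [SigmaFinite μ] {R : ℝ} (hP : Measurable P)
    (hQ : Measurable Q) (hF : Integrable F μ) {h₁ h₂ : Eu d → ℂ} (hh₁ : MemLattice h₁)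
    (hh₂ : MemLattice h₂) (u : 𝓢(Eu d, ℂ))
    (hr : Integrable (fun θ => F θ • InnerProductSpace.rankOne ℂ (windowVec hh₁ R (P θ))
      (windowVec hh₂.conj R (Q θ))) μ) :
    ((∫ θ, F θ • InnerProductSpace.rankOne ℂ (windowVec hh₁ R (P θ))
      (windowVec hh₂.conj R (Q θ)) ∂μ) (u.toLp 2 volume) : Eu d → ℂ) =ᵐ[volume] fun x =>
      h₁ x * ∫ y, (∫ θ, (windowWave R (P θ) x * (starRingEnd ℂ) (windowWave R (Q θ) y)) *
        F θ ∂μ) * (h₂ y * u y) := by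
  rw [ContinuousLinearMap.integral_apply hr]
  have hΦ : AEStronglyMeasurable (fun q : Θ × Eu d =>
      F q.1 * (⟪windowVec hh₂.conj R (Q q.1), u.toLp 2 volume⟫_ℂ *
        (h₁ q.2 * windowWave R (P q.1) q.2))) (μ.prod volume) := by
    have h2 : Measurable fun θ => ⟪windowVec hh₂.conj R (Q θ), u.toLp 2 volume⟫_ℂ :=
      ((continuous_windowVec hh₂.conj R).inner continuous_const).measurable.comp hQ
    have h3 : Measurable fun q : Θ × Eu d => windowWave R (P q.1) q.2 :=
      measurable_windowWave R (hP.comp measurable_fst) measurable_snd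
    exact hF.1.comp_fst.mul ((h2.comp measurable_fst).aestronglyMeasurable.mul
      (hh₁.1.comp_snd.mul h3.aestronglyMeasurable))
  refine (coeFn_integral_L2 (hr.apply_continuousLinearMap _) hΦ fun θ => ?_).trans
    (Filter.Eventually.of_forall fun x =>
      integral_inner_windowVec_mul hP hQ hF hh₂ u x (h₁ x))
  rw [smul_apply, InnerProductSpace.rankOne_apply]
  filter_upwards [Lp.coeFn_smul (F θ)
    (⟪windowVec hh₂.conj R (Q θ), u.toLp 2 volume⟫_ℂ • windowVec hh₁ R (P θ)),
    Lp.coeFn_smul ⟪windowVec hh₂.conj R (Q θ), u.toLp 2 volume⟫_ℂ (windowVec hh₁ R (P θ)),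
    coeFn_windowVec hh₁ R (P θ)] with x hx1 hx2 hx3
  rw [hx1, Pi.smul_apply, hx2, Pi.smul_apply, hx3]
  simp only [smul_eq_mul]

end Generic

/-- The double integral that defines the operator, with the integration over `ξ` done first. -/
theorem opAmp_eq_integral {α : ℝ} {h : Eu d → ℂ} {u : Eu d → ℂ} {x : Eu d}
    (hop : Integrable (opIntegrand α (p.transform T) (fun y => h y * u y) x)
      (volume.prod volume)) :
    opAmp α (p.transform T) (fun y => h y * u y) x = (((α / (2 * Real.pi)) ^ d : ℝ) : ℂ) *
      ∫ y, (∫ ξ, phase (α * ⟪x - y, ξ⟫_ℝ) * p (linPair T x y).1 (linPair T x y).2 ξ) *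
        (h y * u y) := by
  rw [opAmp, Measure.volume_eq_prod, integral_prod _ hop]
  congr 1
  refine integral_congr_ae (Filter.Eventually.of_forall fun y => ?_)
  exact integral_mul_const (h y * u y) _

/-- The superposition of the rank one operators is the operator `h₁ Op^a_α(p_T) h₂`. -/
theorem isWeightedOp_integral {t₀ δ₀ : ℝ} (hδ₀ : 0 < δ₀) (hTe : ∀ j k, |T j k| ≤ t₀)
    (hdet : δ₀ ≤ |T.det|) (hT : T 0 0 + T 0 1 = 1) (hp : Smooth p.uncurry) (hC : 0 ≤ C)
    (hJ : ∀ b : ℕ → ℂ, (∀ l, ‖b l‖ ≤ 2 ^ m) →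
      HasJetBound (T 1 0 + T 1 1) T.det (d + 1) m p b C)
    (hi : WeightIntegrable p (T 1 0 + T 1 1) (d + 1) m) {h₁ h₂ : Eu d → ℂ}
    (hh₁ : MemLattice h₁) (hh₂ : MemLattice h₂) {α : ℝ} (hα : 1 ≤ α)
    (hc : Integrable (operatorCoeff T m α p))
    (hr : Integrable (rankOneFamily T m α (2 * t₀ / δ₀) p hh₁ hh₂)) :
    IsWeightedOp α (p.transform T) h₁ h₂
      (∫ θ, rankOneFamily T m α (2 * t₀ / δ₀) p hh₁ hh₂ θ) := by
  intro u
  have hop := integrable_opIntegrand hp hC hT (abs_pos.1 (hδ₀.trans_le hdet)) hJ hi hh₂ u α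
  refine ⟨hop, ?_⟩
  -- Instance search does not find this on its own for a product of this depth.
  have hσ : SigmaFinite (volume : Measure (((Eu d × Eu d) × Eu d) × (Eu d × Eu d))) :=
    Measure.prod.instSigmaFinite
  refine (coeFn_integral_rankOne_windowVec (continuous_leftParam T α).measurable
    (continuous_rightParam T α).measurable hc hh₁ hh₂ u hr).trans
    (Filter.Eventually.of_forall fun x => ?_)
  beta_reduce
  rw [opAmp_eq_integral (hop x), ← integral_const_mul (((α / (2 * Real.pi)) ^ d : ℝ) : ℂ)]
  refine congrArg (h₁ x * ·) (integral_congr_ae (Filter.Eventually.of_forall fun y => ?_))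
  beta_reduce
  rw [← integral_windowWave_kernelCoeff hδ₀ hTe hdet hT hp hJ hi hα x y,
    ← mul_assoc (((α / (2 * Real.pi)) ^ d : ℝ) : ℂ),
    ← integral_const_mul (((α / (2 * Real.pi)) ^ d : ℝ) : ℂ)]
  refine congrArg (· * (h₂ y * u y)) (integral_congr_ae (Filter.Eventually.of_forall fun θ => ?_))
  beta_reduce
  rw [operatorCoeff]
  ring

/-- The integral of the weighted derivative is the sum of the integrals of its terms. -/
theorem integral_weightedDeriv {τ : ℝ} (hp : Smooth p.uncurry)
    (hi : Integrable fun v : Eu d × Eu d × Eu d => p.weightedDeriv τ (d + 1) m v.1 v.2.1 v.2.2) :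
    WeightIntegrable p τ (d + 1) m ∧
    ∫ q : (Eu d × Eu d) × Eu d, p.weightedDeriv τ (d + 1) m q.1.1 q.1.2 q.2 =
      ∑ n₁ ∈ Finset.range (d + 2), ∑ n₂ ∈ Finset.range (d + 2), ∑ l ∈ Finset.range (m + 1),
        ∫ v : Eu d × Eu d × Eu d, p.mixedDeriv n₁ n₂ l v.1 v.2.1 v.2.2 /
          (1 + ‖τ • v.1 - v.2.1‖ ^ m) := by
  have hmp : MeasurePreserving (MeasurableEquiv.prodAssoc : (Eu d × Eu d) × Eu d ≃ᵐ _) :=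
    volume_preserving_prodAssoc
  refine ⟨(hmp.integrable_comp_emb MeasurableEquiv.prodAssoc.measurableEmbedding).2 hi, ?_⟩
  have h1 := hmp.integral_comp MeasurableEquiv.prodAssoc.measurableEmbedding
    fun v : Eu d × Eu d × Eu d => p.weightedDeriv τ (d + 1) m v.1 v.2.1 v.2.2
  refine Eq.trans h1 ?_
  have hterm : ∀ n₁ ∈ Finset.range (d + 2), ∀ n₂ ∈ Finset.range (d + 2), ∀ l ∈ Finset.range (m + 1),
      Integrable fun v : Eu d × Eu d × Eu d => p.mixedDeriv n₁ n₂ l v.1 v.2.1 v.2.2 /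
          (1 + ‖τ • v.1 - v.2.1‖ ^ m) := by
    intro n₁ h₁ n₂ h₂ l hl
    refine hi.mono' (Continuous.aestronglyMeasurable ?_) (Filter.Eventually.of_forall fun v => ?_)
    · refine (Amplitude.continuous_mixedDeriv hp n₁ n₂ l).div (by fun_prop) fun v => ?_
      positivity
    · have h0 := p.mixedDeriv_nonneg n₁ n₂ l v.1 v.2.1 v.2.2
      rw [Real.norm_of_nonneg (by positivity), norm_sub_rev, Amplitude.weightedDeriv, div_eq_mul_one_div,
        mul_comm]
      refine mul_le_mul_of_nonneg_left ?_ (by positivity)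
      refine le_trans ?_ (Finset.single_le_sum (f := fun n₁ => ∑ n₂ ∈ Finset.range (d + 1 + 1),
        ∑ l ∈ Finset.range (m + 1), p.mixedDeriv n₁ n₂ l v.1 v.2.1 v.2.2) (fun _ _ =>
        Finset.sum_nonneg fun _ _ => Finset.sum_nonneg fun _ _ => p.mixedDeriv_nonneg _ _ _ _ _ _) h₁)
      refine le_trans ?_ (Finset.single_le_sum (f := fun n₂ =>
        ∑ l ∈ Finset.range (m + 1), p.mixedDeriv n₁ n₂ l v.1 v.2.1 v.2.2) (fun _ _ =>
        Finset.sum_nonneg fun _ _ => p.mixedDeriv_nonneg _ _ _ _ _ _) h₂)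
      exact Finset.single_le_sum (f := fun l => p.mixedDeriv n₁ n₂ l v.1 v.2.1 v.2.2)
        (fun _ _ => p.mixedDeriv_nonneg _ _ _ _ _ _) hl
  have hsum : ∀ v : Eu d × Eu d × Eu d, p.weightedDeriv τ (d + 1) m v.1 v.2.1 v.2.2 =
      ∑ n₁ ∈ Finset.range (d + 2), ∑ n₂ ∈ Finset.range (d + 2), ∑ l ∈ Finset.range (m + 1),
        p.mixedDeriv n₁ n₂ l v.1 v.2.1 v.2.2 / (1 + ‖τ • v.1 - v.2.1‖ ^ m) := by
    intro v
    rw [Amplitude.weightedDeriv, norm_sub_rev, one_div]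
    simp only [Finset.mul_sum, div_eq_inv_mul]
  simp only [hsum]
  rw [integral_finsetSum _ fun n₁ h₁ => integrable_finsetSum _ fun n₂ h₂ =>
    integrable_finsetSum _ fun l hl => hterm n₁ h₁ n₂ h₂ l hl]
  refine Finset.sum_congr rfl fun n₁ h₁ => ?_
  rw [integral_finsetSum _ fun n₂ h₂ => integrable_finsetSum _ fun l hl => hterm n₁ h₁ n₂ h₂ l hl]
  refine Finset.sum_congr rfl fun n₂ h₂ => ?_
  rw [integral_finsetSum _ fun l hl => hterm n₁ h₁ n₂ h₂ l hl]

end Assembly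

end

theorem mainTheorem12 (d : ℕ) (hd : 1 ≤ d) (m : ℕ) (t₀ δ₀ : ℝ) (ht₀ : 0 < t₀) (hδ₀ : 0 < δ₀) :
    ∃ C : ℝ, 0 < C ∧
      ∀ T : Matrix (Fin 2) (Fin 2) ℝ,
        (∀ j k, |T j k| ≤ t₀) → δ₀ ≤ |T.det| → T 0 0 + T 0 1 = 1 →
      ∀ h₁ h₂ : Eu d → ℂ, MemLattice h₁ → MemLattice h₂ →
      ∀ p : Amplitude d, p.IsSmooth →
        Integrable (fun v : Eu d × Eu d × Eu d =>
          p.weightedDeriv (T 1 0 + T 1 1) (d + 1) m v.1 v.2.1 v.2.2) →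
      ∀ α : ℝ, 1 ≤ α →
        ∃ A : L2 d →L[ℂ] L2 d,
          IsWeightedOp α (p.transform T) h₁ h₂ A ∧
          IsTraceClass A ∧
          traceNorm A ≤
            ENNReal.ofReal (C * α ^ d) * latticeNorm h₁ * latticeNorm h₂ *
              ENNReal.ofReal
                (∑ n₁ ∈ Finset.range (d + 2), ∑ n₂ ∈ Finset.range (d + 2),
                  ∑ l ∈ Finset.range (m + 1),
                    ∫ v : Eu d × Eu d × Eu d,
                      p.mixedDeriv n₁ n₂ l v.1 v.2.1 v.2.2 /
                        (1 + ‖(T 1 0 + T 1 1) • v.1 - v.2.1‖ ^ m)) := by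
  obtain ⟨n, hn⟩ := exists_setLIntegral_closedBall_le d (2 * t₀ / δ₀ + 1)
  obtain ⟨C, hC, hCJ⟩ := exists_hasJetBound d (d + 1) m t₀ δ₀ hδ₀ (2 ^ m) (by positivity)
  set V := (volume (Metric.closedBall (0 : Eu d × Eu d) 1)).toReal
  set κ := ∫ k : Eu d × Eu d, freqWeight (d + 1) k
  have hκ : 0 ≤ κ := integral_nonneg fun k => freqWeight_nonneg _ k
  have hV : 0 ≤ V := ENNReal.toReal_nonneg
  -- The summand `1` only ensures that the constant is positive.
  refine ⟨n * (4 * C * V * κ) + 1, by positivity, ?_⟩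
  intro T hTe hdet hT h₁ h₂ hh₁ hh₂ p hps hpi α hα
  have hp : Smooth p.uncurry := hps
  have hτ : |T 1 0 + T 1 1| ≤ 2 * t₀ := by
    linarith [abs_add_le (T 1 0) (T 1 1), hTe 1 0, hTe 1 1]
  have hδ : |T.det| ≤ 2 * t₀ ^ 2 := by
    rw [Matrix.det_fin_two]
    have h1 : |T 0 0 * T 1 1| ≤ t₀ * t₀ := by
      rw [abs_mul]
      exact mul_le_mul (hTe 0 0) (hTe 1 1) (abs_nonneg _) ht₀.le
    have h2 : |T 0 1 * T 1 0| ≤ t₀ * t₀ := by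
      rw [abs_mul]
      exact mul_le_mul (hTe 0 1) (hTe 1 0) (abs_nonneg _) ht₀.le
    linarith [abs_sub (T 0 0 * T 1 1) (T 0 1 * T 1 0)]
  have hJ : ∀ b : ℕ → ℂ, (∀ l, ‖b l‖ ≤ 2 ^ m) →
      HasJetBound (T 1 0 + T 1 1) T.det (d + 1) m p b C :=
    fun b hb => hCJ _ _ hτ hδ hdet p hp b hb
  obtain ⟨hi, hI⟩ := integral_weightedDeriv hp hpi
  obtain ⟨hF, hFle⟩ := integrable_kernelCoeff hp (hJ _ (norm_ibpCoeff_le hα m)) hi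
  rw [← hI]
  set I := ∫ q : (Eu d × Eu d) × Eu d, p.weightedDeriv (T 1 0 + T 1 1) (d + 1) m q.1.1 q.1.2 q.2
  have hI0 : 0 ≤ I := integral_nonneg fun q => p.weightedDeriv_nonneg _ _ _ _ _ _
  have hc : Integrable (operatorCoeff T m α p) := hF.const_mul _
  have hr := integrable_rankOneFamily hh₁ hh₂ hn hc
  obtain ⟨htc, hle⟩ := isTraceClass_integral_rankOne hr
  refine ⟨_, isWeightedOp_integral hδ₀ hTe hdet hT hp hC hJ hi hh₁ hh₂ hα hc hr, htc, hle.trans ?_⟩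
  have hpt : ∀ θ, ‖operatorCoeff T m α p θ‖ₑ *
      (‖windowVec hh₁ (2 * t₀ / δ₀) (leftParam T α θ)‖ₑ *
        ‖windowVec hh₂.conj (2 * t₀ / δ₀) (rightParam T α θ)‖ₑ) ≤
      ‖operatorCoeff T m α p θ‖ₑ * (ENNReal.ofReal n * (latticeNorm h₁ * latticeNorm h₂)) := by
    intro θ
    refine mul_le_mul_right ?_ _
    refine (mul_le_mul' (enorm_windowVec_le hh₁ (hn _) _)
      (enorm_windowVec_le hh₂.conj (hn _) _)).trans (le_of_eq ?_)
    rw [latticeNorm_conj]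
    calc _ = (ENNReal.ofReal (Real.sqrt n) * ENNReal.ofReal (Real.sqrt n)) *
          (latticeNorm h₁ * latticeNorm h₂) := by ring
      _ = _ := by rw [← ENNReal.ofReal_mul (Real.sqrt_nonneg _), Real.mul_self_sqrt (by positivity)]
  refine (lintegral_mono hpt).trans ?_
  rw [lintegral_mul_const' _ _ (ENNReal.mul_ne_top ENNReal.ofReal_ne_top
    (ENNReal.mul_ne_top hh₁.2.ne hh₂.2.ne)), ← ofReal_integral_norm_eq_lintegral_enorm hc]
  have hαd : ∫ θ, ‖operatorCoeff T m α p θ‖ ≤ α ^ d * (4 * C * V * κ * I) := by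
    simp only [operatorCoeff, norm_mul]
    rw [integral_const_mul, Complex.norm_real, norm_pow]
    have h1 : ‖α / (2 * Real.pi)‖ ≤ α := by
      rw [Real.norm_of_nonneg (by positivity)]
      exact div_le_self (by linarith) (by linarith [Real.pi_gt_three])
    gcongr
  calc ENNReal.ofReal (∫ θ, ‖operatorCoeff T m α p θ‖) *
        (ENNReal.ofReal n * (latticeNorm h₁ * latticeNorm h₂))
      = ENNReal.ofReal ((∫ θ, ‖operatorCoeff T m α p θ‖) * n) *
        (latticeNorm h₁ * latticeNorm h₂) := by
        rw [ENNReal.ofReal_mul (integral_nonneg fun _ => norm_nonneg _)]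
        ring
    _ ≤ ENNReal.ofReal (((n * (4 * C * V * κ) + 1) * α ^ d) * I) *
        (latticeNorm h₁ * latticeNorm h₂) := by
        refine mul_le_mul' (ENNReal.ofReal_le_ofReal ?_) le_rfl
        calc (∫ θ, ‖operatorCoeff T m α p θ‖) * n ≤ α ^ d * (4 * C * V * κ * I) * n :=
              mul_le_mul_of_nonneg_right hαd (Nat.cast_nonneg n)
          _ ≤ α ^ d * (4 * C * V * κ * I) * n + α ^ d * I := by
              have : 0 ≤ α ^ d * I := by positivity
              linarith
          _ = _ := by ring
    _ = _ := by
        rw [ENNReal.ofReal_mul (by positivity)]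
        ring
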